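/- Let $p\in[0,1]$ and let $m$ be a probability measure on $(0,\infty)$. Let $(x_n)_{n\ge1}$ be the points of a renewal process whose interdistances $x_1, x_2-x_1, x_3-x_2,\dots$ are i.i.d. with law $m$; let $(v_n)_{n\ge1}$ be i.i.d. with $\mathbb P(v_n=0)=p$ and $\mathbb P(v_n=1)=\mathbb P(v_n=-1)=\frac{1-p}{2}$; let $(s_n)_{n\ge1}$ be i.i.d. uniform on $\{-1,+1\}$; and let these three sequences be independent. At time $0$, for each $n\ge1$, a particle $\bullet_n$ starts from $x_n$ and moves with constant velocity $v_n$ until it is annihilated. When exactly two particles meet, both are annihilated. When three particles meet (necessarily one of each velocity), the static particle $\bullet_k$ and one of the two moving particles are annihilated, and the moving particle whose velocity equals the spin $s_k$ survives and continues its motion unperturbed. Annihilated particles are removed from the system. Let $A\in\{1,2,\dots\}\cup\{\infty\}$ be the smallest index $k$ such that $\bullet_k$ reaches $0$ (that is, $v_k=-1$ and $\bullet_k$ is not annihilated when or before it reaches $0$), with $A=\infty$ if no particle reaches $0$. Then, for given $p$, the law of $A$ does not depend on $m$. Furthermore, its generating series $f(x)=\mathbb E[x^A\mathbf 1_{\{A<\infty\}}]$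 satisfies, for all $x\in[-1,1]$, $$p\,x\,f(x)^4-(1+2p)\,x\,f(x)^2+2f(x)-(1-p)\,x=0.$$ -/

import Mathlib

open MeasureTheory ProbabilityTheory Set

namespace BallisticAnnihilation

/-- An initial configuration of particles. The index `n : ℕ` stands for the `(n+1)`-st particle
(counted from the left); each particle has a starting location, a velocity and a spin. -/
structure Config where
  pos : ℕ → ℝ
  vel : ℕ → ℤ
  spin : ℕ → ℤ

namespace Config

variable (c : Config)

/-- The virtual trajectories (those in the absence of any other particle) of the particles `i` and
`j`, with different velocities, meet at time `t ≥ 0`. -/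
def VirtuallyCollide (i j : ℕ) (t : ℝ) : Prop :=
  c.vel i ≠ c.vel j ∧ 0 ≤ t ∧ c.pos i + (c.vel i : ℝ) * t = c.pos j + (c.vel j : ℝ) * t

/-- If `i`, `j`, `k` take part in a triple collision, then it is resolved by the survival of `k`:
the static particle is one of `i`, `j`, and its spin is the velocity of `k`. -/
def SpinSpares (i j k : ℕ) : Prop :=
  (c.vel i = 0 ∧ c.spin i = c.vel k) ∨ (c.vel j = 0 ∧ c.spin j = c.vel k)

/-- The particle `k` is, because of a virtual collision at time `r ≤ t` with `i` or `j`, an obstacle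
to the mutual annihilation of `i` and `j` at time `t`, unless another particle removes it in time.
A third particle at the very place and time of the collision of `i` and `j` is no obstacle when
the spin rule selects it as the survivor. -/
def Obstructs (i j : ℕ) (t : ℝ) (k : ℕ) (r : ℝ) : Prop :=
  k ≠ i ∧ k ≠ j ∧ r ≤ t ∧ (c.VirtuallyCollide k i r ∨ c.VirtuallyCollide k j r) ∧
    ¬ (r = t ∧ c.SpinSpares i j k)

/-- `c.Annihilate i j t`: the particles `i` and `j` mutually annihilate at time `t`.

This happens when their virtual trajectories meet at time `t` and every obstacle `k`, which would
collide with `i` or `j` at a time `r ≤ t`, annihilates with a particle other than `i` and `j` at some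
time `≤ r`. The time of removal of `k` may be equal to `r`: then `k` and its partner annihilate
in a triple collision that `i` (or `j`) survives because of the spin, and this `r` is less
than `t` when the locations are distinct. -/
inductive Annihilate : ℕ → ℕ → ℝ → Prop
  | intro (i j : ℕ) (t : ℝ) (partner : ℕ → ℕ) (death : ℕ → ℝ)
      (collide : c.VirtuallyCollide i j t)
      (removed_by_other : ∀ k r, c.Obstructs i j t k r →
        partner k ≠ i ∧ partner k ≠ j ∧ death k ≤ r)
      (removed : ∀ k r, c.Obstructs i j t k r → Annihilate k (partner k) (death k)) :
      Annihilate i j t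

/-- The particle `i` reaches `0` from the right: it starts on `(0, ∞)` with velocity `-1`, and it is
not annihilated when or before it reaches `0`, that is, until time `c.pos i`. -/
def ReachesZero (i : ℕ) : Prop :=
  c.vel i = -1 ∧ 0 < c.pos i ∧ ∀ j t, c.Annihilate i j t → c.pos i < t

/-- The index, counted from `1`, of the first particle that reaches `0`; it is `⊤` if there is none
(an infimum over the empty set). -/
noncomputable def firstArrival : ℕ∞ :=
  ⨅ (i : ℕ) (_ : c.ReachesZero i), ((i + 1 : ℕ) : ℕ∞)

end Config

/-- The configuration with interdistances `d 0, d 1, …`, the first location being `d 0`. -/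
noncomputable def configOf (d : ℕ → ℝ) (v s : ℕ → ℤ) : Config where
  pos n := ∑ i ∈ Finset.range (n + 1), d i
  vel := v
  spin := s

/-- The random index `A` of the first particle that reaches `0`. -/
noncomputable def A {Ω : Type*} (D : ℕ → Ω → ℝ) (V S : ℕ → Ω → ℤ) (ω : Ω) : ℕ∞ :=
  (configOf (fun n => D n ω) (fun n => V n ω) (fun n => S n ω)).firstArrival

/-- The random variable `x ^ A * 1_{A < ∞}`. -/
noncomputable def powA {Ω : Type*} (D : ℕ → Ω → ℝ) (V S : ℕ → Ω → ℤ) (x : ℝ) : Ω → ℝ :=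
  {ω | A D V S ω < ⊤}.indicator fun ω => x ^ (A D V S ω).toNat

/-- The generating series `f(x) = E[x ^ A * 1_{A < ∞}]`. -/
noncomputable def genSeries {Ω : Type*} [MeasurableSpace Ω] (P : Measure Ω)
    (D : ℕ → Ω → ℝ) (V S : ℕ → Ω → ℤ) (x : ℝ) : ℝ :=
  ∫ ω, powA D V S x ω ∂P

/-- Interdistances `D`, velocities `V` and spins `S` of the three-speed model with parameter `p` and
interdistance law `m`, on the probability space `(Ω, P)`. -/
structure IsModel {Ω : Type*} [MeasurableSpace Ω] (P : Measure Ω) (p : ℝ) (m : Measure ℝ)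
    (D : ℕ → Ω → ℝ) (V S : ℕ → Ω → ℤ) : Prop where
  measurable_D : ∀ n, Measurable (D n)
  measurable_V : ∀ n, Measurable (V n)
  measurable_S : ∀ n, Measurable (S n)
  law_D : ∀ n, P.map (D n) = m
  prob_V_zero : ∀ n, P.real {ω | V n ω = 0} = p
  prob_V_neg : ∀ n, P.real {ω | V n ω = -1} = (1 - p) / 2
  prob_V_pos : ∀ n, P.real {ω | V n ω = 1} = (1 - p) / 2
  prob_S_neg : ∀ n, P.real {ω | S n ω = -1} = 1 / 2
  prob_S_pos : ∀ n, P.real {ω | S n ω = 1} = 1 / 2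
  indep_D : iIndepFun D P
  indep_V : iIndepFun V P
  indep_S : iIndepFun S P
  indep_D_V : IndepFun (fun ω n => D n ω) (fun ω n => V n ω) P
  indep_DV_S : IndepFun (fun ω => ((fun n => D n ω), (fun n => V n ω))) (fun ω n => S n ω) P

end BallisticAnnihilation

/-! Let q = (1-p)/2. Write α_k for the probability that A = k+1 (`arrivalProb`); γ_k for the
probability that particle 0 moves right, particle k+1 moves left and the two annihilate each other
(`faceProb`); β_{ij} for the probability that particle 0 annihilates with a static particle i+1
which, had it stayed, would have been hit later from its right by j+i+2, ties being decided by its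
spin (`releaseProb`). Let α, γ, β be the generating series, with β_s the sum of β_{ij} over i+j = s.
Three relations hold.

(1) α = q + X²(pα² + γα + β). If the first arrival is not particle 0, then 0 is annihilated by some
m, and the arrival is the first one from the particles after m. The three terms correspond to 0
static, to 0 and m facing each other, and to m static; only in the last case must the left block and
the later arrival be compared (`arrivalProb_succ_succ`).

(2) qα = γ + X²βα. Put a right-moving particle in front of a first arrival. Either these two
annihilate, or the new particle removes a static one and so releases the left-moving particle that
was to hit it; the old first arrival is then the next one after the released particle
(`faceProb_recursion`).

(3) 2β = pα². Reflecting the left block turns β_{ij} into the probability that, of two independent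
first arrivals on the two sides of a static particle, the left one wins. Exchanging the sides and
reversing the spin exchanges winner and loser, so β_{ij} + β_{ji} = pα_iα_j (`raceProb_add`). The
comparison of distances thus disappears whatever m is, atoms included, because the spin is a fair
tie-break.

Eliminating γ and β, with f = Xα, gives the quartic equation between formal power series. The
difference of two solutions is killed by a factor with constant term 2, so p determines f and hence
the law of A. On [-1,1] the series converges absolutely and the equation can be evaluated.

The deterministic half proves that these events depend on finite blocks only. Annihilation is
studied in subsets S of the particles (`AnnihilateOn`). The main facts are that partners are unique
(`partner_unique`), that of two particles whose trajectories meet at least one is annihilated by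
then (`annihilateOn_or`), that a surviving left-moving particle shields its left side
(`annihilateOn_of_barrier`), that pairs are nested (`annihilateOn_enclosed`), and that blocks which
do not disturb each other can be juxtaposed (`annihilateOn_union`). -/

namespace BallisticAnnihilation

/-! ### Annihilation within a set of particles; uniqueness of the partner. -/

namespace Config

variable {c : Config} {S S' : Set ℕ} {i j k l q : ℕ} {t r d : ℝ}

/-- Strictly increasing locations, velocities in `{-1, 0, 1}` and spins in `{-1, 1}`. -/
structure Regular (c : Config) : Prop where
  strictMono : StrictMono c.pos
  neg_one_le : ∀ i, -1 ≤ c.vel i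
  le_one : ∀ i, c.vel i ≤ 1
  spin_eq : ∀ i, c.spin i = 1 ∨ c.spin i = -1

/-- The location at time `t` of the virtual trajectory of the particle `i`. -/
def loc (c : Config) (i : ℕ) (t : ℝ) : ℝ := c.pos i + (c.vel i : ℝ) * t

/-- Mutual annihilation in the configuration restricted to the particles in `S`. -/
inductive AnnihilateOn (c : Config) (S : Set ℕ) : ℕ → ℕ → ℝ → Prop
  | intro (i j : ℕ) (t : ℝ) (partner : ℕ → ℕ) (death : ℕ → ℝ)
      (left_mem : i ∈ S) (right_mem : j ∈ S)
      (collide : c.VirtuallyCollide i j t)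
      (removed_by_other : ∀ k ∈ S, ∀ r, c.Obstructs i j t k r →
        partner k ≠ i ∧ partner k ≠ j ∧ death k ≤ r)
      (removed : ∀ k ∈ S, ∀ r, c.Obstructs i j t k r →
        AnnihilateOn c S k (partner k) (death k)) :
      AnnihilateOn c S i j t

theorem annihilateOn_univ : c.AnnihilateOn univ i j t ↔ c.Annihilate i j t := by
  constructor
  · intro h
    induction h with
    | intro i j t p d _ _ hc h1 _ ih =>
      exact .intro i j t p d hc (fun k r h => h1 k trivial r h) (fun k r h => ih k trivial r h)
  · intro h
    induction h with
    | intro i j t p d hc h1 _ ih =>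
      exact .intro i j t p d trivial trivial hc (fun k _ r h => h1 k r h) (fun k _ r h => ih k r h)

theorem VirtuallyCollide.symm (h : c.VirtuallyCollide i j t) : c.VirtuallyCollide j i t :=
  ⟨h.1.symm, h.2.1, h.2.2.symm⟩

theorem VirtuallyCollide.loc_eq (h : c.VirtuallyCollide i j t) : c.loc i t = c.loc j t := h.2.2

theorem VirtuallyCollide.ne (h : c.VirtuallyCollide i j t) : i ≠ j := by
  rintro rfl; exact h.1 rfl

theorem VirtuallyCollide.time_unique (h : c.VirtuallyCollide i j t)
    (h' : c.VirtuallyCollide i j r) : t = r := by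
  have h0 : (c.vel i : ℝ) - c.vel j ≠ 0 := by
    rw [sub_ne_zero]; exact_mod_cast h.1
  have h1 := h.2.2
  have h2 := h'.2.2
  apply mul_left_cancel₀ h0
  linarith

theorem SpinSpares.symm (h : c.SpinSpares i j k) : c.SpinSpares j i k := Or.symm h

theorem Obstructs.symm (h : c.Obstructs i j t k r) : c.Obstructs j i t k r :=
  ⟨h.2.1, h.1, h.2.2.1, h.2.2.2.1.symm, fun h' => h.2.2.2.2 ⟨h'.1, h'.2.symm⟩⟩

theorem Obstructs.le (h : c.Obstructs i j t k r) : r ≤ t := h.2.2.1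

namespace AnnihilateOn

theorem left_mem (h : c.AnnihilateOn S i j t) : i ∈ S := by cases h; assumption

theorem right_mem (h : c.AnnihilateOn S i j t) : j ∈ S := by cases h; assumption

theorem collide (h : c.AnnihilateOn S i j t) : c.VirtuallyCollide i j t := by cases h; assumption

theorem exists_removal (h : c.AnnihilateOn S i j t) (hk : k ∈ S) (ho : c.Obstructs i j t k r) :
    ∃ p d, c.AnnihilateOn S k p d ∧ p ≠ i ∧ p ≠ j ∧ d ≤ r := by
  cases h with
  | intro _ _ _ p d _ _ _ h1 h2 =>
    exact ⟨p k, d k, h2 k hk r ho, h1 k hk r ho⟩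

theorem symm (h : c.AnnihilateOn S i j t) : c.AnnihilateOn S j i t := by
  cases h with
  | intro _ _ _ p d hi hj hc h1 h2 =>
    refine .intro j i t p d hj hi hc.symm (fun k hk r h => ?_) (fun k hk r h => h2 k hk r h.symm)
    have := h1 k hk r h.symm
    tauto

theorem time_nonneg (h : c.AnnihilateOn S i j t) : 0 ≤ t := h.collide.2.1

theorem loc_eq (h : c.AnnihilateOn S i j t) : c.loc i t = c.loc j t := h.collide.loc_eq

theorem ne (h : c.AnnihilateOn S i j t) : i ≠ j := h.collide.ne

end AnnihilateOn

namespace Regular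

theorem vel_ne (hc : c.Regular) (hij : i ≠ j) (h : c.loc i t = c.loc j t) :
    c.vel i ≠ c.vel j := by
  intro hv
  apply hij
  apply hc.strictMono.injective
  unfold loc at h
  rw [hv] at h
  linarith

theorem collide (hc : c.Regular) (hij : i ≠ j) (ht : 0 ≤ t) (h : c.loc i t = c.loc j t) :
    c.VirtuallyCollide i j t := ⟨hc.vel_ne hij h, ht, h⟩

/-- At most three particles can be at the same place at the same time. -/
theorem four_collide (hc : c.Regular) (hij : i ≠ j) (hik : i ≠ k) (hil : i ≠ l) (hjk : j ≠ k)
    (hjl : j ≠ l) (hkl : k ≠ l) (h1 : c.loc i t = c.loc j t) (h2 : c.loc i t = c.loc k t)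
    (h3 : c.loc i t = c.loc l t) : False := by
  have a1 := hc.vel_ne hij h1
  have a2 := hc.vel_ne hik h2
  have a3 := hc.vel_ne hil h3
  have a4 := hc.vel_ne hjk (h1.symm.trans h2)
  have a5 := hc.vel_ne hjl (h1.symm.trans h3)
  have a6 := hc.vel_ne hkl (h2.symm.trans h3)
  have b1 := hc.neg_one_le i
  have b2 := hc.neg_one_le j
  have b3 := hc.neg_one_le k
  have b4 := hc.neg_one_le l
  have c1 := hc.le_one i
  have c2 := hc.le_one j
  have c3 := hc.le_one k
  have c4 := hc.le_one l
  omega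

/-- An overtaking is preceded by a virtual collision. -/
theorem exists_crossing (hc : c.Regular) (hij : i < j) (h : c.loc j t < c.loc i t) (ht : 0 ≤ t) :
    ∃ r, r < t ∧ c.VirtuallyCollide i j r := by
  have hp := hc.strictMono hij
  unfold loc at h
  have hv : (0 : ℝ) < ((c.vel i : ℝ) - c.vel j) * t := by linarith
  have hv' : (0 : ℝ) < (c.vel i : ℝ) - c.vel j := by
    by_contra h0
    nlinarith
  refine ⟨(c.pos j - c.pos i) / ((c.vel i : ℝ) - c.vel j), ?_, ?_, ?_, ?_⟩
  · rw [div_lt_iff₀ hv']; linarith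
  · intro h0; rw [h0] at hv'; simp at hv'
  · exact div_nonneg (by linarith) hv'.le
  · field_simp; ring

theorem exists_crossing_le (hc : c.Regular) (hij : i < j) (h : c.loc j t ≤ c.loc i t)
    (ht : 0 ≤ t) : ∃ r, r ≤ t ∧ c.VirtuallyCollide i j r := by
  rcases h.lt_or_eq with h | h
  · obtain ⟨r, h1, h2⟩ := hc.exists_crossing hij h ht
    exact ⟨r, h1.le, h2⟩
  · exact ⟨t, le_rfl, hc.collide hij.ne ht h.symm⟩

theorem loc_lt_of_vel_eq_neg_one (hc : c.Regular) (hij : i < j) (hv : c.vel i = -1) (ht : 0 ≤ t) :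
    c.loc i t < c.loc j t := by
  have hp := hc.strictMono hij
  have : (-1 : ℝ) ≤ c.vel j := by exact_mod_cast hc.neg_one_le j
  unfold loc
  rw [hv]
  push_cast
  nlinarith

/-- A third particle at the place of a collision which is not spared obstructs it. -/
theorem obstructs (hki : k ≠ i) (hkj : k ≠ j) (hrt : r ≤ t)
    (h : c.VirtuallyCollide k i r ∨ c.VirtuallyCollide k j r)
    (hs : r = t → ¬ c.SpinSpares i j k) : c.Obstructs i j t k r :=
  ⟨hki, hkj, hrt, h, fun h => hs h.1 h.2⟩

/-- Spins are nonzero, so a triple collision never spares the static particle. -/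
theorem not_spinSpares_of_vel_eq_zero (hc : c.Regular) (h : c.vel k = 0) :
    ¬ c.SpinSpares i j k := by
  have h1 := hc.spin_eq i
  have h2 := hc.spin_eq j
  unfold SpinSpares
  omega

/-- Induction on both derivations. If `i` had two partners, the one met earlier would obstruct the
later annihilation, hence would be removed by a particle other than `i`; by induction its only
partner is `i`. At equal times each of the two partners would have to be the survivor selected by
the same spin. -/
theorem partner_unique (hc : c.Regular) (h : c.AnnihilateOn S i j t)
    (h' : c.AnnihilateOn S i l r) : l = j ∧ r = t := by
  suffices H : ∀ a b s, c.AnnihilateOn S a b s → (a = i → b = j ∧ s = t) ∧ (a = j → b = i ∧ s = t)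
    from (H i l r h').1 rfl
  clear h'
  induction h with
  | intro i j t p d hi hj hcol h1 h2 ih =>
    have hA : c.AnnihilateOn S i j t := .intro i j t p d hi hj hcol h1 h2
    intro a b s h'
    induction h' with
    | intro a b s p' d' ha hb hcol' h1' h2' ih' =>
      have hB : c.AnnihilateOn S a b s := .intro a b s p' d' ha hb hcol' h1' h2'
      -- a common argument for both ends of the collision
      have key : ∀ i j, c.AnnihilateOn S i j t →
          (∀ k r, c.Obstructs i j t k r → k ∈ S → ∀ s, ¬ c.AnnihilateOn S k i s) →
          (∀ x, x ∈ S → ∀ r, c.Obstructs a b s x r → x = j → p' x = i) →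
          a = i → b = j ∧ s = t := by
        rintro i j hA hA1 hA2 rfl
        by_cases hbj : b = j
        · subst hbj; exact ⟨rfl, hcol'.time_unique hA.collide⟩
        exfalso
        have hab := hcol'.ne
        have haj := hA.ne
        by_cases hst : s ≤ t ∧ c.Obstructs a j t b s
        · exact hA1 b s hst.2 hb s hB.symm
        by_cases hts : t ≤ s ∧ c.Obstructs a b s j t
        · have := hA2 j hA.right_mem t hts.2 rfl
          exact (h1' j hA.right_mem t hts.2).1 this
        rcases lt_trichotomy s t with hlt | heq | hgt
        · exact hst ⟨hlt.le, obstructs hab.symm hbj hlt.le (Or.inl hcol'.symm)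
            (fun h => absurd h hlt.ne)⟩
        · subst heq
          have e1 : c.SpinSpares a j b := by
            by_contra h0
            exact hst ⟨le_rfl, obstructs hab.symm hbj le_rfl (Or.inl hcol'.symm) (fun _ => h0)⟩
          have e2 : c.SpinSpares a b j := by
            by_contra h0
            exact hts ⟨le_rfl, obstructs haj.symm (Ne.symm hbj) le_rfl
              (Or.inl hA.collide.symm) (fun _ => h0)⟩
          have v1 := hcol'.1
          have v2 := hA.collide.1
          have v3 := hc.vel_ne hbj (hcol'.loc_eq.symm.trans hA.loc_eq)
          have s1 := hc.spin_eq a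
          have s2 := hc.spin_eq b
          have s3 := hc.spin_eq j
          unfold SpinSpares at e1 e2
          omega
        · exact hts ⟨hgt.le, obstructs haj.symm (Ne.symm hbj) hgt.le (Or.inl hA.collide.symm)
            (fun h => absurd h hgt.ne)⟩
      refine ⟨key i j hA ?_ ?_, key j i hA.symm ?_ ?_⟩
      · intro k r ho hk s hs
        have h3 := (ih k hk r ho k i s hs).1 rfl
        exact (h1 k hk r ho).1 h3.1.symm
      · intro x hx r ho hxj
        exact ((ih' x hx r ho).2 hxj).1
      · intro k r ho hk s hs
        have h3 := (ih k hk r ho.symm k j s hs).1 rfl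
        exact (h1 k hk r ho.symm).2.1 h3.1.symm
      · intro x hx r ho hxj
        exact ((ih' x hx r ho).1 hxj).1

/-- The constructor asks for a partner and a death time depending on `k` alone, whereas `k` may be
an obstacle at two times `r`, one for `i` and one for `j`. Uniqueness of the partner makes one
choice valid for both. -/
theorem annihilateOn_intro (hc : c.Regular) (hi : i ∈ S) (hj : j ∈ S)
    (hcol : c.VirtuallyCollide i j t)
    (h : ∀ k ∈ S, ∀ r, c.Obstructs i j t k r →
      ∃ p d, c.AnnihilateOn S k p d ∧ p ≠ i ∧ p ≠ j ∧ d ≤ r) : c.AnnihilateOn S i j t := by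
  classical
  have h' : ∀ k, ∃ p d, ∀ r, k ∈ S → c.Obstructs i j t k r →
      c.AnnihilateOn S k p d ∧ p ≠ i ∧ p ≠ j ∧ d ≤ r := by
    intro k
    by_cases hk : k ∈ S ∧ ∃ r, c.Obstructs i j t k r
    · obtain ⟨hk, r, hr⟩ := hk
      obtain ⟨p, d, h1, h2⟩ := h k hk r hr
      refine ⟨p, d, fun r' _ hr' => ?_⟩
      obtain ⟨p', d', h3, h4⟩ := h k hk r' hr'
      obtain ⟨rfl, rfl⟩ := hc.partner_unique h1 h3
      exact ⟨h1, h4⟩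
    · exact ⟨0, 0, fun r h1 h2 => absurd ⟨h1, r, h2⟩ hk⟩
  choose p d hpd using h'
  exact .intro i j t p d hi hj hcol (fun k hk r ho => (hpd k r hk ho).2)
    (fun k hk r ho => (hpd k r hk ho).1)

/-- The times of the virtual collisions in a finite set of particles are well-founded. -/
theorem _root_.BallisticAnnihilation.Config.collision_induction (c : Config) (hS : S.Finite)
    {motive : ℝ → Prop}
    (h : ∀ t, (∀ r, r < t → (∃ i ∈ S, ∃ j ∈ S, c.VirtuallyCollide i j r) → motive r) → motive t)
    (t : ℝ) : motive t := by
  have hfin : {t : ℝ | ∃ i ∈ S, ∃ j ∈ S, c.VirtuallyCollide i j t}.Finite := by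
    have : {t : ℝ | ∃ i ∈ S, ∃ j ∈ S, c.VirtuallyCollide i j t}
        = ⋃ i ∈ S, ⋃ j ∈ S, {t | c.VirtuallyCollide i j t} := by
      ext; simp
    rw [this]
    refine hS.biUnion fun i _ => hS.biUnion fun j _ => Set.Subsingleton.finite ?_
    intro t ht r hr
    exact ht.time_unique hr
  have hwf := hfin.wellFoundedOn (r := (· < ·))
  -- The given `t` need not be a collision time; one use of `h` reduces to those that are, and these
  -- form a finite set.
  apply h
  intro r _ hr
  refine hwf.induction hr (P := motive) ?_
  intro y hy ih
  exact h y (fun r hr hr' => ih r hr' hr)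

/-- A relation whose obstacles are removed by the relation itself consists of annihilations. -/
theorem annihilateOn_of_closed (hc : c.Regular) (hS : S.Finite) (M : ℕ → ℕ → ℝ → Prop)
    (hM : ∀ i j t, M i j t → i ∈ S ∧ j ∈ S ∧ c.VirtuallyCollide i j t)
    (h : ∀ i j t, M i j t → ∀ k ∈ S, ∀ r, c.Obstructs i j t k r →
      ∃ p d, M k p d ∧ p ≠ i ∧ p ≠ j ∧ d ≤ r) (hij : M i j t) : c.AnnihilateOn S i j t := by
  refine c.collision_induction hS (motive := fun t => ∀ i j, M i j t → c.AnnihilateOn S i j t)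
    ?_ t i j hij
  clear hij
  intro t ih i j hij
  obtain ⟨hi, hj, hcol⟩ := hM i j t hij
  refine hc.annihilateOn_intro hi hj hcol fun k hk r ho => ?_
  obtain ⟨p, d, hp, hpi, hpj, hdr⟩ := h i j t hij k hk r ho
  obtain ⟨_, hp', hcol'⟩ := hM k p d hp
  have hdt : d ≤ t := hdr.trans ho.le
  refine ⟨p, d, ?_, hpi, hpj, hdr⟩
  rcases hdt.lt_or_eq with hlt | rfl
  · exact ih d hlt ⟨k, hk, p, hp', hcol'⟩ k p hp
  -- If `k` died exactly at `t`, the four particles `i`, `j`, `k`, `p` would be at one place.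
  · exfalso
    obtain rfl : r = d := le_antisymm ho.le hdr
    have hk : c.loc i r = c.loc k r := by
      rcases ho.2.2.2.1 with h | h
      · exact h.loc_eq.symm
      · exact hcol.loc_eq.trans h.loc_eq.symm
    exact hc.four_collide hcol.ne ho.1.symm hpi.symm ho.2.1.symm hpj.symm hcol'.ne
      hcol.loc_eq hk (hk.trans hcol'.loc_eq)

end Regular

end Config

end BallisticAnnihilation

/-! ### Existence of annihilations; restriction, juxtaposition, shielding and nesting. -/

namespace BallisticAnnihilation

namespace Config

variable {c : Config} {S S' : Set ℕ} {i j k l q : ℕ} {t r d : ℝ}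

namespace Regular

/-- Two particles that virtually collide are annihilated by then. -/
theorem annihilateOn_or (hc : c.Regular) (hS : S.Finite) (hi : i ∈ S) (hj : j ∈ S)
    (hcol : c.VirtuallyCollide i j t) : c.AnnihilateOn S i j t ∨
      (∃ l d, c.AnnihilateOn S i l d ∧ l ≠ j ∧ d ≤ t) ∨
      (∃ l d, c.AnnihilateOn S j l d ∧ l ≠ i ∧ d ≤ t) := by
  refine c.collision_induction hS (motive := fun t => ∀ i ∈ S, ∀ j ∈ S, c.VirtuallyCollide i j t →
    c.AnnihilateOn S i j t ∨ (∃ l d, c.AnnihilateOn S i l d ∧ l ≠ j ∧ d ≤ t) ∨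
      (∃ l d, c.AnnihilateOn S j l d ∧ l ≠ i ∧ d ≤ t)) ?_ t i hi j hj hcol
  clear hi hj hcol
  intro t ih
  -- Obstacles strictly before `t`: the induction hypothesis for `k` and `i` at time `r` yields an
  -- annihilation of one of them; `i` has none before `t`, so it is `k` that is removed, by a third
  -- particle.
  have removed_lt : ∀ i ∈ S, ∀ j, c.VirtuallyCollide i j t →
      (¬ ∃ l d, c.AnnihilateOn S i l d ∧ l ≠ j ∧ d ≤ t) →
      (¬ ∃ l d, c.AnnihilateOn S j l d ∧ l ≠ i ∧ d ≤ t) →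
      ∀ k ∈ S, ∀ r, r < t → k ≠ i → k ≠ j → c.VirtuallyCollide k i r →
      ∃ p d, c.AnnihilateOn S k p d ∧ p ≠ i ∧ p ≠ j ∧ d ≤ r := by
    intro i hi j hcol hni hnj k hk r hr hki hkj hkc
    rcases ih r hr ⟨k, hk, i, hi, hkc⟩ k hk i hi hkc with h | ⟨l, d, h, hl, hd⟩ | ⟨l, d, h, hl, hd⟩
    · exact absurd ⟨k, r, h.symm, hkj, hr.le⟩ hni
    · by_cases hlj : l = j
      · subst hlj
        exact absurd ⟨k, d, h.symm, hki, hd.trans hr.le⟩ hnj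
      · exact ⟨l, d, h, hl, hlj, hd⟩
    · by_cases hlj : l = j
      · subst hlj
        have := h.collide.time_unique hcol
        linarith
      · exact absurd ⟨l, d, h, hlj, hd.trans hr.le⟩ hni
  have no_third : ∀ i ∈ S, ∀ j ∈ S, c.VirtuallyCollide i j t →
      (¬ ∃ l d, c.AnnihilateOn S i l d ∧ l ≠ j ∧ d ≤ t) →
      (¬ ∃ l d, c.AnnihilateOn S j l d ∧ l ≠ i ∧ d ≤ t) →
      (∀ k ∈ S, c.Obstructs i j t k t →
        ∃ p d, c.AnnihilateOn S k p d ∧ p ≠ i ∧ p ≠ j ∧ d ≤ t) → c.AnnihilateOn S i j t := by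
    intro i hi j hj hcol hni hnj h
    refine hc.annihilateOn_intro hi hj hcol fun k hk r ho => ?_
    rcases ho.le.lt_or_eq with hr | rfl
    · rcases ho.2.2.2.1 with h | h
      · exact removed_lt i hi j hcol hni hnj k hk r hr ho.1 ho.2.1 h
      · obtain ⟨p, d, h1, h2, h3, h4⟩ :=
          removed_lt j hj i hcol.symm hnj hni k hk r hr ho.2.1 ho.1 h
        exact ⟨p, d, h1, h3, h2, h4⟩
    · exact h k hk ho
  intro i hi j hj hcol
  by_contra hcon
  push Not at hcon
  obtain ⟨hnij, hni, hnj⟩ := hcon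
  -- Triple collision in which `j` is spared: unless `k` is removed by a third particle, nothing
  -- obstructs the annihilation of `i` and `k` at time `t`, contrary to the assumption on `i`.
  have triple : ∀ i ∈ S, ∀ j ∈ S, c.VirtuallyCollide i j t → ¬ c.AnnihilateOn S i j t →
      (¬ ∃ l d, c.AnnihilateOn S i l d ∧ l ≠ j ∧ d ≤ t) →
      (¬ ∃ l d, c.AnnihilateOn S j l d ∧ l ≠ i ∧ d ≤ t) →
      ∀ k ∈ S, k ≠ i → k ≠ j → c.loc i t = c.loc k t → c.SpinSpares i k j →
      ∃ p d, c.AnnihilateOn S k p d ∧ p ≠ i ∧ p ≠ j ∧ d ≤ t := by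
    intro i hi j hj hcol hnij hni hnj k hk hki hkj hloc hs
    by_contra hno
    have hik : c.VirtuallyCollide i k t := hc.collide hki.symm hcol.2.1 hloc
    refine hni ⟨k, t, no_third i hi k hk hik ?_ ?_ ?_, hkj, le_rfl⟩
    · rintro ⟨l, d, h, hl, hd⟩
      by_cases hlj : l = j
      · subst hlj
        obtain rfl := h.collide.time_unique hcol
        exact hnij h
      · exact hni ⟨l, d, h, hlj, hd⟩
    · rintro ⟨l, d, h, hl, hd⟩
      by_cases hlj : l = j
      · subst hlj
        exact hnj ⟨k, d, h.symm, hki, hd⟩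
      · exact hno ⟨l, d, h, hl, hlj, hd⟩
    · intro q hq ho
      exfalso
      by_cases hqj : q = j
      · subst hqj
        exact ho.2.2.2.2 ⟨rfl, hs⟩
      · have hqi : c.loc i t = c.loc q t := by
          rcases ho.2.2.2.1 with h | h
          · exact h.loc_eq.symm
          · exact hloc.trans h.loc_eq.symm
        exact hc.four_collide hcol.ne hki.symm ho.1.symm hkj.symm (Ne.symm hqj) ho.2.1.symm
          hcol.loc_eq hloc hqi
  refine hnij (no_third i hi j hj hcol (by push Not; exact hni) (by push Not; exact hnj)
    fun k hk ho => ?_)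
  have hloc : c.loc i t = c.loc k t := by
    rcases ho.2.2.2.1 with h | h
    · exact h.loc_eq.symm
    · exact hcol.loc_eq.trans h.loc_eq.symm
  have hns : ¬ c.SpinSpares i j k := fun h => ho.2.2.2.2 ⟨rfl, h⟩
  -- The spin of the static particle spares exactly one of the three; it is not `k`, so it is `i` or
  -- `j`.
  have hcases : c.SpinSpares i k j ∨ c.SpinSpares j k i := by
    have v1 := hcol.1
    have v2 := hc.vel_ne ho.1.symm hloc
    have v3 := hc.vel_ne ho.2.1.symm (hcol.loc_eq.symm.trans hloc)
    have s1 := hc.spin_eq i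
    have s2 := hc.spin_eq j
    have s3 := hc.spin_eq k
    have b1 := hc.neg_one_le i
    have b2 := hc.neg_one_le j
    have b3 := hc.neg_one_le k
    have c1 := hc.le_one i
    have c2 := hc.le_one j
    have c3 := hc.le_one k
    unfold SpinSpares at hns ⊢
    omega
  rcases hcases with h | h
  · exact triple i hi j hj hcol hnij (by push Not; exact hni) (by push Not; exact hnj) k hk
      ho.1 ho.2.1 hloc h
  · obtain ⟨p, d, h1, h2, h3, h4⟩ := triple j hj i hi hcol.symm (fun h => hnij h.symm)
      (by push Not; exact hnj) (by push Not; exact hni) k hk ho.2.1 ho.1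
      (hcol.loc_eq.symm.trans hloc) h
    exact ⟨p, d, h1, h3, h2, h4⟩

/-- Restriction to a set of particles that is closed under annihilation before time `t`. -/
theorem annihilateOn_restrict (hc : c.Regular) (h : c.AnnihilateOn S i j t) (hS : S' ⊆ S)
    (hcl : ∀ k ∈ S', ∀ p d, c.AnnihilateOn S k p d → d < t → p ∈ S')
    (hi : i ∈ S') (hj : j ∈ S') : c.AnnihilateOn S' i j t := by
  induction h with
  | intro i j t p d hi' hj' hcol h1 h2 ih =>
    refine hc.annihilateOn_intro hi hj hcol fun k hk r ho => ?_
    obtain ⟨h3, h4, h5⟩ := h1 k (hS hk) r ho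
    have h6 := h2 k (hS hk) r ho
    refine ⟨p k, d k, ?_, h3, h4, h5⟩
    have hdt := h5.trans ho.le
    rcases hdt.lt_or_eq with hlt | heq
    · exact ih k (hS hk) r ho (fun k hk p d h hd => hcl k hk p d h (hd.trans hlt)) hk
        (hcl k hk _ _ h6 hlt)
    -- A removal of `k` at time `t` itself would bring four particles together.
    · exfalso
      obtain rfl : r = t := le_antisymm ho.le (heq ▸ h5)
      have hl : c.loc i r = c.loc k r := by
        rcases ho.2.2.2.1 with h | h
        · exact h.loc_eq.symm
        · exact hcol.loc_eq.trans h.loc_eq.symm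
      have h7 := h6.loc_eq
      rw [heq] at h7
      exact hc.four_collide hcol.ne ho.1.symm h3.symm ho.2.1.symm h4.symm h6.ne
        hcol.loc_eq hl (hl.trans h7)

/-- A right-moving particle meets a partner that does not move right, so the meeting place is not
beyond the start of the partner. -/
theorem loc_le_of_forall_pos_le (hc : c.Regular) {w : ℝ} (hw : ∀ i ∈ S, c.pos i ≤ w)
    (h : c.AnnihilateOn S i j t) (hr0 : 0 ≤ r) (hr : r ≤ t) : c.loc i r ≤ w := by
  have h1 := hw i h.left_mem
  have h2 := hw j h.right_mem
  have h3 := h.loc_eq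
  have h4 := h.time_nonneg
  have h5 := hc.le_one i
  have h6 := hc.neg_one_le i
  have hne := h.collide.1
  have h7 := hc.le_one j
  unfold loc at h3 ⊢
  by_cases hv : c.vel i ≤ 0
  · have : (c.vel i : ℝ) ≤ 0 := by exact_mod_cast hv
    nlinarith
  · have h8 : c.vel i = 1 := by omega
    have : (c.vel j : ℝ) ≤ 0 := by
      have : c.vel j ≤ 0 := by omega
      exact_mod_cast this
    rw [h8] at h3 ⊢
    push_cast at h3 ⊢
    nlinarith

theorem lt_loc_of_forall_lt_pos (hc : c.Regular) {w : ℝ} (hw : ∀ i ∈ S, w < c.pos i)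
    (h : c.AnnihilateOn S i j t) (hr0 : 0 ≤ r) (hr : r ≤ t) : w < c.loc i r := by
  have h1 := hw i h.left_mem
  have h2 := hw j h.right_mem
  have h3 := h.loc_eq
  have h4 := h.time_nonneg
  have h5 := hc.le_one i
  have h6 := hc.neg_one_le i
  have hne := h.collide.1
  have h7 := hc.neg_one_le j
  unfold loc at h3 ⊢
  by_cases hv : 0 ≤ c.vel i
  · have : (0 : ℝ) ≤ c.vel i := by exact_mod_cast hv
    nlinarith
  · have h8 : c.vel i = -1 := by omega
    have : (0 : ℝ) ≤ c.vel j := by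
      have : 0 ≤ c.vel j := by omega
      exact_mod_cast this
    rw [h8] at h3 ⊢
    push_cast at h3 ⊢
    nlinarith

/-- Juxtaposition of two finite sets of particles such that a particle that is not annihilated in
one of them obstructs no annihilation in the other. -/
theorem annihilateOn_union (hc : c.Regular) {L R : Set ℕ} (hL : L.Finite) (hR : R.Finite) {w : ℝ}
    (hLw : ∀ i ∈ L, c.pos i ≤ w) (hRw : ∀ i ∈ R, w < c.pos i)
    (hLR : ∀ i j t, c.AnnihilateOn L i j t → ∀ k ∈ R, (∀ p d, ¬ c.AnnihilateOn R k p d) →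
      ∀ r, ¬ c.Obstructs i j t k r)
    (hRL : ∀ i j t, c.AnnihilateOn R i j t → ∀ k ∈ L, (∀ p d, ¬ c.AnnihilateOn L k p d) →
      ∀ r, ¬ c.Obstructs i j t k r)
    (h : c.AnnihilateOn L i j t ∨ c.AnnihilateOn R i j t) : c.AnnihilateOn (L ∪ R) i j t := by
  have hdisj : ∀ i ∈ L, ∀ j ∈ R, i ≠ j := by
    rintro i hi j hj rfl
    linarith [hLw i hi, hRw i hj]
  refine hc.annihilateOn_of_closed (hL.union hR)
    (fun i j t => c.AnnihilateOn L i j t ∨ c.AnnihilateOn R i j t) ?_ ?_ h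
  · rintro i j t (h | h)
    · exact ⟨Or.inl h.left_mem, Or.inl h.right_mem, h.collide⟩
    · exact ⟨Or.inr h.left_mem, Or.inr h.right_mem, h.collide⟩
  · rintro i j t (h | h) k (hk | hk) r ho
    · obtain ⟨p, d, h1, h2⟩ := h.exists_removal hk ho
      exact ⟨p, d, Or.inl h1, h2⟩
    · by_cases hk' : ∀ p d, ¬ c.AnnihilateOn R k p d
      · exact absurd ho (hLR i j t h k hk hk' r)
      · push Not at hk'
        obtain ⟨p, d, hp⟩ := hk'
        refine ⟨p, d, Or.inr hp, (hdisj _ h.left_mem _ hp.right_mem).symm,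
          (hdisj _ h.right_mem _ hp.right_mem).symm, ?_⟩
        -- Until their annihilations, particles of `L` stay at or left of `w` and particles of `R`
        -- strictly right of it; a meeting across `w` can only happen after the death of `k`.
        by_contra hlt
        push Not at hlt
        rcases ho.2.2.2.1 with h' | h'
        · have := hc.lt_loc_of_forall_lt_pos hRw hp h'.2.1 hlt.le
          have := hc.loc_le_of_forall_pos_le hLw h h'.2.1 ho.le
          linarith [h'.loc_eq]
        · have := hc.lt_loc_of_forall_lt_pos hRw hp h'.2.1 hlt.le
          have := hc.loc_le_of_forall_pos_le hLw h.symm h'.2.1 ho.le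
          linarith [h'.loc_eq]
    · by_cases hk' : ∀ p d, ¬ c.AnnihilateOn L k p d
      · exact absurd ho (hRL i j t h k hk hk' r)
      · push Not at hk'
        obtain ⟨p, d, hp⟩ := hk'
        refine ⟨p, d, Or.inl hp, hdisj _ hp.right_mem _ h.left_mem,
          hdisj _ hp.right_mem _ h.right_mem, ?_⟩
        by_contra hlt
        push Not at hlt
        rcases ho.2.2.2.1 with h' | h'
        · have := hc.lt_loc_of_forall_lt_pos hRw h h'.2.1 ho.le
          have := hc.loc_le_of_forall_pos_le hLw hp h'.2.1 hlt.le
          linarith [h'.loc_eq]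
        · have := hc.lt_loc_of_forall_lt_pos hRw h.symm h'.2.1 ho.le
          have := hc.loc_le_of_forall_pos_le hLw hp h'.2.1 hlt.le
          linarith [h'.loc_eq]
    · obtain ⟨p, d, h1, h2⟩ := h.exists_removal hk ho
      exact ⟨p, d, Or.inr h1, h2⟩

/-- A left-moving particle is not passed before its annihilation. -/
theorem partner_le_of_barrier (hc : c.Regular) (hk : k ∈ S) (hv : c.vel k = -1)
    (halive : ∀ p d, c.AnnihilateOn S k p d → t ≤ d) (h : c.AnnihilateOn S i j t)
    (hi : i ≤ k) : j ≤ k := by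
  by_contra hj
  push Not at hj
  have h1 := hc.loc_lt_of_vel_eq_neg_one hj hv h.time_nonneg
  have h2 := h.loc_eq
  rcases hi.lt_or_eq with hi | rfl
  · obtain ⟨r, hr, hcol⟩ := hc.exists_crossing hi (by rw [h2]; exact h1) h.time_nonneg
    have ho : c.Obstructs i j t k r :=
      obstructs hi.ne' hj.ne hr.le (Or.inl hcol.symm) (fun h => absurd h hr.ne)
    obtain ⟨p, d, h3, _, _, h4⟩ := h.exists_removal hk ho
    linarith [halive p d h3]
  · linarith

/-- A left-moving particle shields its left from its right before its annihilation. -/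
theorem not_virtuallyCollide_of_barrier (hc : c.Regular) (hk : k ∈ S) (hv : c.vel k = -1)
    (halive : ∀ p d, c.AnnihilateOn S k p d → t ≤ d) (h : c.AnnihilateOn S i j t)
    (hi : i ≤ k) (hkq : k < q) (hr : r ≤ t) : ¬ c.VirtuallyCollide q i r := by
  intro hqi
  have h3 := hc.loc_lt_of_vel_eq_neg_one hkq hv hqi.2.1
  rw [hqi.loc_eq] at h3
  rcases hi.lt_or_eq with hi | rfl
  · obtain ⟨s, hs, hcol'⟩ := hc.exists_crossing hi h3 hqi.2.1
    have hst : s < t := hs.trans_le hr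
    by_cases hkj : k = j
    · subst hkj
      linarith [h.collide.time_unique hcol']
    · have ho : c.Obstructs i j t k s :=
        obstructs hi.ne' hkj hst.le (Or.inl hcol'.symm) (fun h => absurd h hst.ne)
      obtain ⟨p, d, h3, _, _, h4⟩ := h.exists_removal hk ho
      linarith [halive p d h3]
  · linarith

/-- Particles on the right of a left-moving one have no influence on its left, as long as it is
not annihilated. -/
theorem annihilateOn_of_barrier (hc : c.Regular) (hSS : ∀ q ≤ k, q ∈ S → q ∈ S')
    (hSS' : ∀ q ≤ k, q ∈ S' → q ∈ S) (hk : k ∈ S)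
    (hv : c.vel k = -1) (h : c.AnnihilateOn S i j t)
    (halive : ∀ p d, c.AnnihilateOn S k p d → t ≤ d)
    (hi : i ≤ k) (hj : j ≤ k) : c.AnnihilateOn S' i j t := by
  induction h with
  | intro i j t p d hi' hj' hcol h1 h2 ih =>
    have hA : c.AnnihilateOn S i j t := .intro i j t p d hi' hj' hcol h1 h2
    refine hc.annihilateOn_intro (hSS i hi hi') (hSS j hj hj') hcol fun q hq r ho => ?_
    by_cases hqk : q ≤ k
    · have hqS := hSS' q hqk hq
      obtain ⟨h3, h4, h5⟩ := h1 q hqS r ho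
      have h6 := h2 q hqS r ho
      have h7 : ∀ p' d', c.AnnihilateOn S k p' d' → d q ≤ d' :=
        fun p' d' h => (h5.trans ho.le).trans (halive p' d' h)
      exact ⟨p q, d q, ih q hqS r ho h7 hqk (hc.partner_le_of_barrier hk hv h7 h6 hqk), h3, h4, h5⟩
    · exfalso
      push Not at hqk
      rcases ho.2.2.2.1 with h | h
      · exact hc.not_virtuallyCollide_of_barrier hk hv halive hA hi hqk ho.le h
      · exact hc.not_virtuallyCollide_of_barrier hk hv halive hA.symm hj hqk ho.le h

/-- The particles between two mutually annihilating ones annihilate among themselves. -/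
theorem annihilateOn_enclosed (hc : c.Regular) (h : c.AnnihilateOn S i j t)
    (hik : i < k) (hkj : k < j) (hk : k ∈ S) :
    ∃ p d, c.AnnihilateOn S k p d ∧ i < p ∧ p < j ∧ d ≤ t := by
  have ht := h.time_nonneg
  have hcross : ∃ r, r ≤ t ∧ (c.VirtuallyCollide k i r ∨ c.VirtuallyCollide k j r) := by
    rcases le_total (c.loc k t) (c.loc i t) with h' | h'
    · obtain ⟨r, hr, hcol⟩ := hc.exists_crossing_le hik h' ht
      exact ⟨r, hr, Or.inl hcol.symm⟩
    · obtain ⟨r, hr, hcol⟩ := hc.exists_crossing_le hkj (h.loc_eq ▸ h') ht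
      exact ⟨r, hr, Or.inr hcol⟩
  obtain ⟨r, hr, hcol⟩ := hcross
  -- a particle in the middle of a triple collision is static
  have mid : ∀ {a b m : ℕ} {s : ℝ}, a < m → m < b → 0 ≤ s → c.loc a s = c.loc m s →
      c.loc a s = c.loc b s → c.vel m = 0 := by
    intro a b m s h1 h2 hs h3 h4
    have p1 := hc.strictMono h1
    have p2 := hc.strictMono h2
    have v1 : c.vel m < c.vel a := by
      have : (c.vel m : ℝ) < c.vel a := by
        unfold loc at h3; by_contra h0; push Not at h0; nlinarith
      exact_mod_cast this
    have v2 : c.vel b < c.vel m := by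
      have : (c.vel b : ℝ) < c.vel m := by
        unfold loc at h3 h4; by_contra h0; push Not at h0; nlinarith
      exact_mod_cast this
    have := hc.neg_one_le b
    have := hc.le_one a
    omega
  -- Even if `k` joins the collision of `i` and `j`, it is in the middle, hence static, hence not
  -- spared.
  have ho : c.Obstructs i j t k r := by
    refine obstructs hik.ne' hkj.ne hr hcol fun hrt => hc.not_spinSpares_of_vel_eq_zero ?_
    subst hrt
    have : c.loc i r = c.loc k r := by
      rcases hcol with h' | h'
      · exact h'.loc_eq.symm
      · exact h.loc_eq.trans h'.loc_eq.symm
    exact mid hik hkj ht this h.loc_eq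
  obtain ⟨p, d, hp, hpi, hpj, hd⟩ := h.exists_removal hk ho
  have hdt := hd.trans hr
  have hd0 := hp.time_nonneg
  -- a particle `b` at one end that would be passed by `k` and `p` at time `d`
  have key : ∀ a b, c.AnnihilateOn S a b t → p ≠ a → k ≠ a → k ≠ b → p ≠ b →
      (∃ s, s ≤ d ∧ c.VirtuallyCollide b k s ∨ s ≤ d ∧ c.VirtuallyCollide b p s) →
      (c.loc k d = c.loc b d → c.vel b = 0) → False := by
    rintro a b hab hpa hka hkb hpb ⟨s, hs⟩ hmid
    have hs' : s ≤ d := by tauto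
    have ho : c.Obstructs k p d b s := by
      refine obstructs hkb.symm hpb.symm hs' (by tauto)
        fun hsd => hc.not_spinSpares_of_vel_eq_zero (hmid ?_)
      subst hsd
      rcases hs with h' | h'
      · exact h'.2.loc_eq.symm
      · exact hp.loc_eq.trans h'.2.loc_eq.symm
    -- The only partner of `b` is `a`, at time `t`; being removed by time `s ≤ d ≤ t` forces `s = d
    -- = t`, and then `a`, `b`, `k`, `p` all meet.
    obtain ⟨p', d', h1, h2, h3, h4⟩ := hp.exists_removal hab.right_mem ho
    obtain ⟨rfl, rfl⟩ := hc.partner_unique hab.symm h1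
    obtain rfl : d' = d := by linarith
    obtain rfl : s = d' := by linarith
    have hkb' : c.loc k s = c.loc b s := by
      rcases hs with h' | h'
      · exact h'.2.loc_eq.symm
      · exact hp.loc_eq.trans h'.2.loc_eq.symm
    exact hc.four_collide hp.ne hkb hka hpb hpa hab.ne.symm hp.loc_eq hkb'
      (hkb'.trans hab.loc_eq.symm)
  refine ⟨p, d, hp, ?_, ?_, hdt⟩
  · by_contra hpi'
    have hpi' : p < i := by omega
    refine key j i h.symm hpj hkj.ne hik.ne' hpi ?_ ?_
    · rcases le_total (c.loc k d) (c.loc i d) with h' | h'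
      · obtain ⟨s, h1, h2⟩ := hc.exists_crossing_le hik h' hd0
        exact ⟨s, Or.inl ⟨h1, h2⟩⟩
      · obtain ⟨s, h1, h2⟩ := hc.exists_crossing_le hpi' (hp.loc_eq ▸ h') hd0
        exact ⟨s, Or.inr ⟨h1, h2.symm⟩⟩
    · intro h'
      exact mid hpi' hik hd0 (hp.loc_eq.symm.trans h') hp.loc_eq.symm
  · by_contra hpj'
    have hpj' : j < p := by omega
    refine key i j h hpi hik.ne' hkj.ne hpj ?_ ?_
    · rcases le_total (c.loc j d) (c.loc k d) with h' | h'
      · obtain ⟨s, h1, h2⟩ := hc.exists_crossing_le hkj h' hd0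
        exact ⟨s, Or.inl ⟨h1, h2.symm⟩⟩
      · obtain ⟨s, h1, h2⟩ := hc.exists_crossing_le hpj' (hp.loc_eq ▸ h') hd0
        exact ⟨s, Or.inr ⟨h1, h2⟩⟩
    · intro h'
      exact mid hkj hpj' hd0 h' hp.loc_eq

end Regular

end Config

end BallisticAnnihilation

/-! ### First arrivals and the fate of the first particle of a block. -/

namespace BallisticAnnihilation

namespace Config

variable {c : Config} {S S' : Set ℕ} {i j k l q a m n : ℕ} {t r d : ℝ}

/-- Among the particles `a, …, n`, the last one is the only one that is not annihilated, and it
moves to the left: `n` is the first one to cross all of the starting locations. -/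
def FirstArrivalOn (c : Config) (a n : ℕ) : Prop :=
  a ≤ n ∧ c.vel n = -1 ∧ ∀ j, a ≤ j → j < n → ∃ p d, p ≠ n ∧ c.AnnihilateOn (Icc a n) j p d

/-- Among the particles `a, …, m`, the first and the last one annihilate mutually. -/
def EndsAnnihilate (c : Config) (a m : ℕ) : Prop := ∃ t, c.AnnihilateOn (Icc a m) a m t

/-- The location of `m` is crossed by `a` before it is by `n` (in case of a tie, according to the
spin of `m`). -/
def Sooner (c : Config) (a m n : ℕ) : Prop :=
  c.pos m - c.pos a < c.pos n - c.pos m ∨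
    (c.pos m - c.pos a = c.pos n - c.pos m ∧ c.spin m = -1)

namespace Regular

theorem vel_lt_of_annihilateOn (hc : c.Regular) (h : c.AnnihilateOn S i j t) (hij : i < j) :
    c.vel j < c.vel i := by
  have h1 := hc.strictMono hij
  have h2 := h.loc_eq
  have h3 := h.time_nonneg
  unfold loc at h2
  have : (c.vel j : ℝ) < c.vel i := by
    by_contra h0
    push Not at h0
    nlinarith
  exact_mod_cast this

theorem not_annihilateOn_last (hc : c.Regular) (h : c.FirstArrivalOn a n) (p : ℕ) (d : ℝ) :
    ¬ c.AnnihilateOn (Icc a n) n p d := by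
  intro h'
  have hp := h'.right_mem
  obtain ⟨p', d', h1, h2⟩ := h.2.2 p hp.1 (lt_of_le_of_ne hp.2 h'.ne.symm)
  exact h1 (hc.partner_unique h'.symm h2).1

theorem enclosed_partner (hc : c.Regular) (h : c.AnnihilateOn S i j t) (hik : i < k)
    (hkj : k < j) (hk : c.AnnihilateOn S k q d) : i < q ∧ q < j ∧ d ≤ t := by
  obtain ⟨p, d, h1, h2, h3, h4⟩ := hc.annihilateOn_enclosed h hik hkj hk.left_mem
  obtain ⟨rfl, rfl⟩ := hc.partner_unique h1 hk
  exact ⟨h2, h3, h4⟩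

theorem partner_mem_Icc (hc : c.Regular) (h : c.AnnihilateOn S i j t) (hij : i < j)
    (hk : k ∈ Icc i j) (h' : c.AnnihilateOn S k q d) : q ∈ Icc i j ∧ d ≤ t := by
  rcases hk.1.lt_or_eq with h1 | rfl
  · rcases hk.2.lt_or_eq with h2 | rfl
    · have := hc.enclosed_partner h h1 h2 h'
      exact ⟨⟨this.1.le, this.2.1.le⟩, this.2.2⟩
    · obtain ⟨rfl, rfl⟩ := hc.partner_unique h.symm h'
      exact ⟨⟨le_rfl, hij.le⟩, le_rfl⟩
  · obtain ⟨rfl, rfl⟩ := hc.partner_unique h h'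
    exact ⟨⟨hij.le, le_rfl⟩, le_rfl⟩

theorem annihilateOn_Icc_ends (hc : c.Regular) (h : c.AnnihilateOn (Icc a n) i j t) (hij : i < j) :
    c.AnnihilateOn (Icc i j) i j t :=
  hc.annihilateOn_restrict h (Icc_subset_Icc h.left_mem.1 h.right_mem.2)
    (fun _ hk _ _ hp _ => (hc.partner_mem_Icc h hij hk hp).1) ⟨le_rfl, hij.le⟩ ⟨hij.le, le_rfl⟩

/-- The particles strictly inside pair off among themselves by time `t`, and `a` does not interfere
before `t`; so they do the same once `a` is deleted. -/
theorem exists_partner_of_ends (hc : c.Regular) (h : c.AnnihilateOn (Icc a m) a m t)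
    (hi : a < i) (him : i < m) :
    ∃ p d, c.AnnihilateOn (Icc (a + 1) m) i p d ∧ a < p ∧ p < m ∧ d ≤ t := by
  obtain ⟨p, d, h1, h2, h3, h4⟩ := hc.annihilateOn_enclosed h hi him ⟨hi.le, him.le⟩
  refine ⟨p, d, hc.annihilateOn_restrict h1 (Icc_subset_Icc (by omega) le_rfl) ?_ ⟨hi, him.le⟩
    ⟨h2, h3.le⟩, h2, h3, h4⟩
  intro k hk p' d' hp' hd'
  rcases hk.2.lt_or_eq with hkm | rfl
  · have := hc.enclosed_partner h hk.1 hkm hp'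
    exact ⟨this.1, this.2.1.le⟩
  · have := (hc.partner_unique h.symm hp').2
    linarith

theorem lt_of_ends (h : c.AnnihilateOn (Icc a m) i j t) (hi : i = a) : a < j := by
  subst hi
  exact lt_of_le_of_ne h.right_mem.1 h.ne

theorem firstArrivalOn_succ_of_ends (hc : c.Regular) (h : c.EndsAnnihilate a m)
    (hv : c.vel m = -1) : c.FirstArrivalOn (a + 1) m := by
  obtain ⟨t, h⟩ := h
  refine ⟨lt_of_ends h rfl, hv, fun j hj hjm => ?_⟩
  obtain ⟨p, d, h1, _, h2, _⟩ := hc.exists_partner_of_ends h hj hjm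
  exact ⟨p, d, h2.ne, h1⟩

/-- If `m < n`, then `m` shields its left, so all particles before `m` have the same partners in the
longer block. The partner of `m` there would lie to its right, which is impossible for a particle
moving left at maximal speed. -/
theorem firstArrivalOn_unique_aux (hc : c.Regular) (h : c.FirstArrivalOn a m)
    (h' : c.FirstArrivalOn a n) : n ≤ m := by
  by_contra hmn
  push Not at hmn
  obtain ⟨p, d, h1, h2⟩ := h'.2.2 m h.1 hmn
  have hp := h2.right_mem
  rcases lt_trichotomy p m with hpm | rfl | hpm
  · obtain ⟨p', d', h3, h4⟩ := h.2.2 p hp.1 hpm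
    have h5 := hc.annihilateOn_of_barrier (S := Icc a m) (S' := Icc a n) (k := m)
      (fun q _ hq => ⟨hq.1, hq.2.trans hmn.le⟩) (fun q hq hq' => ⟨hq'.1, hq⟩) ⟨h.1, le_rfl⟩ h.2.1 h4
      (fun p d h6 => absurd h6 (hc.not_annihilateOn_last h p d)) hpm.le h4.right_mem.2
    exact h3 (hc.partner_unique h2.symm h5).1
  · exact h2.ne rfl
  · have := hc.vel_lt_of_annihilateOn h2 hpm
    have := hc.neg_one_le p
    have := h.2.1
    omega

theorem firstArrivalOn_unique (hc : c.Regular) (h : c.FirstArrivalOn a m)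
    (h' : c.FirstArrivalOn a n) : m = n :=
  le_antisymm (hc.firstArrivalOn_unique_aux h' h) (hc.firstArrivalOn_unique_aux h h')

/-- The time of the annihilation of a static particle by a particle coming from its left. -/
theorem time_eq_of_static (hc : c.Regular) (h : c.AnnihilateOn S i j t) (hij : i < j)
    (hv : c.vel j = 0) : t = c.pos j - c.pos i := by
  have h1 := hc.vel_lt_of_annihilateOn h hij
  have h2 := hc.le_one i
  have h3 : c.vel i = 1 := by omega
  have h4 := h.loc_eq
  unfold loc at h4
  rw [h3, hv] at h4
  push_cast at h4
  linarith

theorem Icc_union_Icc_succ (h1 : a ≤ m) (h2 : m ≤ n) : Icc a m ∪ Icc (m + 1) n = Icc a n := by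
  ext x
  simp only [mem_union, mem_Icc]
  omega

/-- If `a` is annihilated by `m`, the first arrival among `a, …, n` is that among the particles
after `m`. -/
theorem firstArrivalOn_of_ends (hc : c.Regular) (h : c.EndsAnnihilate a m)
    (hF : c.FirstArrivalOn (m + 1) n) (hs : c.vel m = 0 → c.Sooner a m n) :
    c.FirstArrivalOn a n ∧ ∃ t, c.AnnihilateOn (Icc a n) a m t := by
  obtain ⟨t, h⟩ := h
  have ham := lt_of_ends h rfl
  have hmn : m < n := hF.1
  have hall : ∀ k ∈ Icc a m, ∃ p d, c.AnnihilateOn (Icc a m) k p d := by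
    intro k hk
    rcases hk.1.lt_or_eq with h1 | rfl
    · rcases hk.2.lt_or_eq with h2 | rfl
      · obtain ⟨p, d, h3, _⟩ := hc.annihilateOn_enclosed h h1 h2 hk
        exact ⟨p, d, h3⟩
      · exact ⟨_, _, h.symm⟩
    · exact ⟨_, _, h⟩
  have hpos : ∀ i ∈ Icc a m, c.pos i ≤ c.pos m := fun i hi => hc.strictMono.monotone hi.2
  -- The arrival `n` meets no particle of the left block before its annihilation, except in a tie
  -- where `n` is spared. If `m` moves left it is a shield; if `m` is static, `Sooner` says that `n`
  -- comes too late.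
  have key : ∀ i j d r, c.AnnihilateOn (Icc a m) i j d → r ≤ d → c.VirtuallyCollide n i r →
      r = d ∧ c.SpinSpares i j n := by
    intro i j d r hij hrd hcol
    have hdt := (hc.partner_mem_Icc h ham hij.left_mem hij).2
    have hvm : c.vel m ≤ 0 := by
      have := hc.vel_lt_of_annihilateOn h ham
      have := hc.le_one a
      omega
    rcases hvm.lt_or_eq with hvm | hvm
    · have hvm : c.vel m = -1 := by
        have := hc.neg_one_le m
        omega
      refine absurd hcol (hc.not_virtuallyCollide_of_barrier (S := Icc a m) (k := m)
        ⟨ham.le, le_rfl⟩ hvm ?_ hij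
        hij.left_mem.2 hmn hrd)
      intro p d' hp
      rw [(hc.partner_unique h.symm hp).2]
      exact hdt
    · have h1 := hc.loc_le_of_forall_pos_le hpos hij hcol.2.1 hrd
      have h2 := hcol.loc_eq
      have h3 := hc.time_eq_of_static h ham hvm
      have h4 : c.loc n r = c.pos n - r := by
        unfold loc; rw [hF.2.1]; push_cast; ring
      have h5 := hs hvm
      have hrt : r ≤ t := hrd.trans hdt
      unfold Sooner at h5
      obtain ⟨h6, h7⟩ : c.pos m - c.pos a = c.pos n - c.pos m ∧ c.spin m = -1 := by
        rcases h5 with h5 | h5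
        · linarith
        · exact h5
      obtain rfl : r = t := by linarith
      obtain rfl : r = d := le_antisymm hrd hdt
      refine ⟨rfl, ?_⟩
      have e1 : c.loc m r = c.pos m := by unfold loc; rw [hvm]; push_cast; ring
      have e2 : c.loc n r = c.loc m r := by rw [e1, h4]; linarith
      -- In a tie, `a`, `m` and `n` already occupy the meeting place, which leaves no room for a
      -- fourth particle.
      have hia : i = a ∨ i = m := by
        by_contra hcon
        push Not at hcon
        exact hc.four_collide hmn.ne' (ham.trans hmn).ne' hcol.ne ham.ne' (Ne.symm hcon.2)
          (Ne.symm hcon.1) e2 (e2.trans h.loc_eq.symm) hcol.loc_eq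
      have hsp : c.spin m = c.vel n := by rw [h7, hF.2.1]
      rcases hia with rfl | rfl
      · rw [(hc.partner_unique h hij).1]
        exact Or.inr ⟨hvm, hsp⟩
      · exact Or.inl ⟨hvm, hsp⟩
  have hU : ∀ i j d, c.AnnihilateOn (Icc a m) i j d ∨ c.AnnihilateOn (Icc (m + 1) n) i j d →
      c.AnnihilateOn (Icc a n) i j d := by
    intro i j d hij
    rw [← Icc_union_Icc_succ ham.le hmn.le]
    refine hc.annihilateOn_union (finite_Icc _ _) (finite_Icc _ _) hpos
      (fun i hi => hc.strictMono hi.1) ?_ ?_ hij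
    · clear hij i j d
      intro i j d hij k hk hk' r ho
      obtain rfl : k = n := by
        by_contra hkn
        obtain ⟨p, d, _, h1⟩ := hF.2.2 k hk.1 (lt_of_le_of_ne hk.2 hkn)
        exact hk' p d h1
      rcases ho.2.2.2.1 with h1 | h1
      · exact ho.2.2.2.2 (key i j d r hij ho.le h1)
      · have := key j i d r hij.symm ho.le h1
        exact ho.2.2.2.2 ⟨this.1, this.2.symm⟩
    · intro i j d hij k hk hk'
      obtain ⟨p, d, h1⟩ := hall k hk
      exact absurd h1 (hk' p d)
  refine ⟨⟨ham.le.trans hmn.le, hF.2.1, fun j hj hjn => ?_⟩, t, hU a m t (Or.inl h)⟩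
  rcases le_or_gt j m with hjm | hjm
  · obtain ⟨p, d, h1⟩ := hall j ⟨hj, hjm⟩
    exact ⟨p, d, (h1.right_mem.2.trans_lt hmn).ne, hU _ _ _ (Or.inl h1)⟩
  · obtain ⟨p, d, h1, h2⟩ := hF.2.2 j hjm hjn
    exact ⟨p, d, h1, hU _ _ _ (Or.inr h2)⟩

/-- Converse of `firstArrivalOn_of_ends`. Nesting splits the annihilations into those inside `a, …,
m` and those after `m`. If `m` is static and `n` were to cross it first, `n` would obstruct the
annihilation of `a` and `m` although nothing removes it. -/
theorem ends_of_firstArrivalOn (hc : c.Regular) (hF : c.FirstArrivalOn a n)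
    (h : c.AnnihilateOn (Icc a n) a m t) : c.EndsAnnihilate a m ∧ c.FirstArrivalOn (m + 1) n ∧
      (c.vel m = 0 → c.Sooner a m n) := by
  have ham := lt_of_ends h rfl
  have hmn : m < n := by
    refine lt_of_le_of_ne h.right_mem.2 ?_
    rintro rfl
    exact hc.not_annihilateOn_last hF _ _ h.symm
  have hcl : ∀ k ∈ Icc (m + 1) n, ∀ p d, c.AnnihilateOn (Icc a n) k p d → p ∈ Icc (m + 1) n := by
    intro k hk p d hp
    have h1 := hp.right_mem
    refine ⟨?_, h1.2⟩
    by_contra hpm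
    have := (hc.partner_mem_Icc h ham ⟨h1.1, by omega⟩ hp.symm).1.2
    have := hk.1
    omega
  refine ⟨⟨t, hc.annihilateOn_Icc_ends h ham⟩, ⟨hmn, hF.2.1, fun j hj hjn => ?_⟩, fun hvm => ?_⟩
  · obtain ⟨p, d, h1, h2⟩ := hF.2.2 j (by omega) hjn
    exact ⟨p, d, h1, hc.annihilateOn_restrict h2 (Icc_subset_Icc (by omega) le_rfl)
      (fun k hk p d hp _ => hcl k hk p d hp) ⟨hj, hjn.le⟩ (hcl j ⟨hj, hjn.le⟩ p d h2)⟩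
  · by_contra hs
    unfold Sooner at hs
    push Not at hs
    have h3 := hc.time_eq_of_static h ham hvm
    have hp := hc.strictMono hmn
    have hcol : c.VirtuallyCollide n m (c.pos n - c.pos m) := by
      refine hc.collide hmn.ne' (by linarith) ?_
      unfold loc; rw [hF.2.1, hvm]; push_cast; ring
    have ho : c.Obstructs a m t n (c.pos n - c.pos m) := by
      refine obstructs (ham.trans hmn).ne' hmn.ne' (by linarith [hs.1]) (Or.inr hcol) ?_
      intro h4 h5
      have := hc.vel_lt_of_annihilateOn h ham
      have h6 := hs.2 (by linarith)
      have h7 := hF.2.1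
      unfold SpinSpares at h5
      omega
    obtain ⟨p, d, h5, _⟩ := h.exists_removal ⟨hF.1, le_rfl⟩ ho
    exact hc.not_annihilateOn_last hF p d h5

theorem exists_annihilateOn_first (hF : c.FirstArrivalOn a n) (han : a < n) :
    ∃ m t, c.AnnihilateOn (Icc a n) a m t := by
  obtain ⟨p, d, _, h⟩ := hF.2.2 a le_rfl han
  exact ⟨p, d, h⟩

/-- The particles to the right of a static one stay strictly to its right until they are
annihilated, so it does not disturb them and simply waits for their first arrival. -/
theorem ends_iff_of_static (hc : c.Regular) (hv : c.vel a = 0) :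
    c.EndsAnnihilate a m ↔ c.FirstArrivalOn (a + 1) m := by
  constructor
  · intro h
    refine hc.firstArrivalOn_succ_of_ends h ?_
    obtain ⟨t, h⟩ := h
    have := hc.vel_lt_of_annihilateOn h (lt_of_ends h rfl)
    have := hc.neg_one_le m
    omega
  · intro hF
    have ham : a < m := hF.1
    have hU : ∀ i j d, c.AnnihilateOn (Icc (a + 1) m) i j d → c.AnnihilateOn (Icc a m) i j d := by
      intro i j d hij
      rw [← Icc_union_Icc_succ le_rfl ham.le]
      refine hc.annihilateOn_union (w := c.pos a) (finite_Icc _ _) (finite_Icc _ _)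
        (fun i hi => hc.strictMono.monotone hi.2) (fun i hi => hc.strictMono hi.1) ?_ ?_
        (Or.inr hij)
      · intro i j d hij
        have h1 := hij.left_mem
        have h2 := hij.right_mem
        have h3 := hij.ne
        simp only [mem_Icc] at h1 h2
        omega
      · intro i j d hij k hk _ r ho
        obtain rfl : k = a := le_antisymm hk.2 hk.1
        have hk0 : c.loc k r = c.pos k := by unfold loc; rw [hv]; push_cast; ring
        rcases ho.2.2.2.1 with h | h
        · have := hc.lt_loc_of_forall_lt_pos (w := c.pos k) (fun i hi => hc.strictMono hi.1) hij
            h.2.1 ho.le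
          linarith [h.loc_eq]
        · have := hc.lt_loc_of_forall_lt_pos (w := c.pos k) (fun i hi => hc.strictMono hi.1)
            hij.symm h.2.1 ho.le
          linarith [h.loc_eq]
    have hp := hc.strictMono ham
    have hcol : c.VirtuallyCollide a m (c.pos m - c.pos a) := by
      refine hc.collide ham.ne (by linarith) ?_
      unfold loc; rw [hF.2.1, hv]; push_cast; ring
    have hother : ∀ q ∈ Icc a m, q ≠ a → q ≠ m → ∀ p d, c.AnnihilateOn (Icc a m) q p d →
        p ≠ a ∧ p ≠ m := by
      intro q hq hqa hqm p d h
      obtain ⟨p', d', h1, h2⟩ := hF.2.2 q (lt_of_le_of_ne hq.1 hqa.symm) (lt_of_le_of_ne hq.2 hqm)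
      obtain ⟨rfl, rfl⟩ := hc.partner_unique (hU _ _ _ h2) h
      exact ⟨(Nat.lt_of_succ_le h2.right_mem.1).ne', h1⟩
    rcases hc.annihilateOn_or (finite_Icc a m) ⟨le_rfl, ham.le⟩ ⟨ham.le, le_rfl⟩ hcol with
      h | ⟨l, d, h, hl, _⟩ | ⟨l, d, h, hl, _⟩
    · exact ⟨_, h⟩
    · exact absurd rfl (hother l h.right_mem h.ne.symm hl _ _ h.symm).1
    · exact absurd rfl (hother l h.right_mem hl h.ne.symm _ _ h.symm).2

end Regular

end Config

end BallisticAnnihilation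

/-! ### Deleting a right-moving first particle; first arrivals and reaching 0. -/

namespace BallisticAnnihilation

namespace Config

variable {c : Config} {S S' : Set ℕ} {i j k l q a m n : ℕ} {t r d : ℝ}

namespace Regular

/-- With `a` deleted, the static `m` is no longer removed by it and absorbs `l` instead. The whole
block `a + 1, …, l` is then annihilated, and the next arrival `n` passes through. -/
theorem firstArrivalOn_succ_of_release (hc : c.Regular) (h : c.EndsAnnihilate a m)
    (hv : c.vel m = 0) (hF : c.FirstArrivalOn (m + 1) l) (hs : c.Sooner a m l)
    (hF' : c.FirstArrivalOn (l + 1) n) : c.FirstArrivalOn (a + 1) n := by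
  obtain ⟨t, h⟩ := h
  have ham := lt_of_ends h rfl
  have hml : m < l := hF.1
  have hln : l < n := hF'.1
  have ht := hc.time_eq_of_static h ham hv
  have htT : t ≤ c.pos l - c.pos m := by
    rcases hs with hs | hs
    · linarith
    · linarith [hs.1]
  have hinner := fun i (hi : a < i) (him : i < m) => hc.exists_partner_of_ends h hi him
  have hlast : ∀ p d, ¬ c.AnnihilateOn (Icc (a + 1) m) m p d := by
    intro p d hp
    have hpm := lt_of_le_of_ne hp.right_mem.2 hp.ne.symm
    obtain ⟨p', d', h1, _, h2, _⟩ := hinner p hp.right_mem.1 hpm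
    exact h2.ne (hc.partner_unique h1 hp.symm).1.symm
  have hdt : ∀ i j d, c.AnnihilateOn (Icc (a + 1) m) i j d → i ≠ m ∧ d ≤ t := by
    intro i j d hij
    have him : i ≠ m := by
      rintro rfl
      exact hlast _ _ hij
    obtain ⟨p', d', h1, _, _, h2⟩ := hinner i hij.left_mem.1 (lt_of_le_of_ne hij.left_mem.2 him)
    rw [(hc.partner_unique h1 hij).2]
    exact ⟨him, h2⟩
  have hpos : ∀ i ∈ Icc (a + 1) m, c.pos i ≤ c.pos m := fun i hi => hc.strictMono.monotone hi.2
  have hml0 : ∀ r, c.loc m r = c.pos m := fun r => by unfold loc; rw [hv]; push_cast; ring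
  have hl0 : ∀ r, c.loc l r = c.pos l - r := fun r => by
    unfold loc; rw [hF.2.1]; push_cast; ring
  -- By `Sooner`, `l` reaches the location of `m` no earlier than `t`, when the particles before `m`
  -- have been annihilated; in case of equality it would be a fourth particle next to `a`, `m` and
  -- `i`.
  have hnol : ∀ i j d r, c.AnnihilateOn (Icc (a + 1) m) i j d → r ≤ d →
      ¬ c.VirtuallyCollide l i r := by
    intro i j d r hij hrd hcol
    obtain ⟨him, hdt'⟩ := hdt i j d hij
    have h1 := hc.loc_le_of_forall_pos_le hpos hij hcol.2.1 hrd
    have h2 := hcol.loc_eq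
    rw [hl0] at h2
    obtain rfl : r = t := by linarith
    have e : c.loc l r = c.loc m r := by rw [hl0, hml0]; linarith
    exact hc.four_collide hml.ne' (ham.trans hml).ne' hcol.ne ham.ne' him.symm
      (Nat.lt_of_succ_le hij.left_mem.1).ne e (e.trans h.loc_eq.symm) hcol.loc_eq
  have hU : ∀ i j d, c.AnnihilateOn (Icc (a + 1) m) i j d ∨ c.AnnihilateOn (Icc (m + 1) l) i j d →
      c.AnnihilateOn (Icc (a + 1) l) i j d := by
    intro i j d hij
    rw [← Icc_union_Icc_succ (m := m) (by omega) hml.le]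
    refine hc.annihilateOn_union (finite_Icc _ _) (finite_Icc _ _) hpos
      (fun i hi => hc.strictMono hi.1) ?_ ?_ hij
    · clear hij i j d
      intro i j d hij k hk hk' r ho
      obtain rfl : k = l := by
        by_contra hkn
        obtain ⟨p, d, _, h1⟩ := hF.2.2 k hk.1 (lt_of_le_of_ne hk.2 hkn)
        exact hk' p d h1
      rcases ho.2.2.2.1 with h1 | h1
      · exact hnol i j d r hij ho.le h1
      · exact hnol j i d r hij.symm ho.le h1
    · clear hij i j d
      intro i j d hij k hk hk' r ho
      obtain rfl : k = m := by
        by_contra hkm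
        obtain ⟨p, d, h1, _⟩ := hinner k hk.1 (lt_of_le_of_ne hk.2 hkm)
        exact hk' p d h1
      have hmR : ∀ i ∈ Icc (k + 1) l, c.pos k < c.pos i := fun i hi => hc.strictMono hi.1
      rcases ho.2.2.2.1 with h1 | h1
      · linarith [hc.lt_loc_of_forall_lt_pos hmR hij h1.2.1 ho.le, h1.loc_eq, hml0 r]
      · linarith [hc.lt_loc_of_forall_lt_pos hmR hij.symm h1.2.1 ho.le, h1.loc_eq, hml0 r]
  have hall : ∀ q ∈ Icc (a + 1) l, q ≠ m → q ≠ l →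
      ∃ p d, c.AnnihilateOn (Icc (a + 1) l) q p d ∧ p ≠ m ∧ p ≠ l := by
    intro q hq hqm hql
    rcases lt_or_gt_of_ne hqm with hqm | hqm
    · obtain ⟨p, d, h1, _, h2, _⟩ := hinner q hq.1 hqm
      exact ⟨p, d, hU _ _ _ (Or.inl h1), h2.ne, (h2.trans hml).ne⟩
    · obtain ⟨p, d, h1, h2⟩ := hF.2.2 q hqm (lt_of_le_of_ne hq.2 hql)
      exact ⟨p, d, hU _ _ _ (Or.inr h2), (Nat.lt_of_succ_le h2.right_mem.1).ne', h1⟩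
  have hmem : m ∈ Icc (a + 1) l := ⟨ham, hml.le⟩
  have lmem : l ∈ Icc (a + 1) l := ⟨(ham.trans hml), le_rfl⟩
  -- All other particles of the block pair off without `m` and `l`, so by `annihilateOn_or` these
  -- two can only annihilate each other.
  have hmlT : c.AnnihilateOn (Icc (a + 1) l) m l (c.pos l - c.pos m) := by
    have hcol : c.VirtuallyCollide m l (c.pos l - c.pos m) := by
      refine hc.collide hml.ne (by linarith [hc.strictMono hml]) ?_
      rw [hml0, hl0]; ring
    rcases hc.annihilateOn_or (finite_Icc _ _) hmem lmem hcol with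
      h | ⟨p, d, h, hp, _⟩ | ⟨p, d, h, hp, _⟩
    · exact h
    · obtain ⟨p', d', h1, h2, _⟩ := hall p h.right_mem h.ne.symm hp
      exact absurd (hc.partner_unique h1 h.symm).1.symm h2
    · obtain ⟨p', d', h1, _, h2⟩ := hall p h.right_mem hp h.ne.symm
      exact absurd (hc.partner_unique h1 h.symm).1.symm h2
  -- Nothing in the block outlives `l`, which therefore shields every annihilation of the block from
  -- the particles after `l`.
  have htime : ∀ i j d, c.AnnihilateOn (Icc (a + 1) l) i j d → d ≤ c.pos l - c.pos m := by
    intro i j d hij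
    rcases lt_or_ge i m with him | him
    · obtain ⟨p, d', h1, _, _, h2⟩ := hinner i hij.left_mem.1 him
      rw [(hc.partner_unique (hU _ _ _ (Or.inl h1)) hij).2]
      exact h2.trans htT
    · exact (hc.partner_mem_Icc hmlT hml ⟨him, hij.left_mem.2⟩ hij).2
  have hall' : ∀ q ∈ Icc (a + 1) l, ∃ p d, c.AnnihilateOn (Icc (a + 1) l) q p d := by
    intro q hq
    by_cases hqm : q = m
    · rw [hqm]; exact ⟨_, _, hmlT⟩
    by_cases hql : q = l
    · rw [hql]; exact ⟨_, _, hmlT.symm⟩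
    obtain ⟨p, d, h1, _⟩ := hall q hq hqm hql
    exact ⟨p, d, h1⟩
  have hU' : ∀ i j d, c.AnnihilateOn (Icc (a + 1) l) i j d ∨ c.AnnihilateOn (Icc (l + 1) n) i j d →
      c.AnnihilateOn (Icc (a + 1) n) i j d := by
    intro i j d hij
    rw [← Icc_union_Icc_succ (m := l) (by omega) hln.le]
    refine hc.annihilateOn_union (w := c.pos l) (finite_Icc _ _) (finite_Icc _ _)
      (fun i hi => hc.strictMono.monotone hi.2) (fun i hi => hc.strictMono hi.1) ?_ ?_ hij
    · clear hij i j d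
      intro i j d hij k hk hk' r ho
      have halive : ∀ p d', c.AnnihilateOn (Icc (a + 1) l) l p d' → d ≤ d' := by
        intro p d' hp
        rw [(hc.partner_unique hmlT.symm hp).2]
        exact htime i j d hij
      rcases ho.2.2.2.1 with h1 | h1
      · exact hc.not_virtuallyCollide_of_barrier lmem hF.2.1 halive hij hij.left_mem.2 hk.1
          ho.le h1
      · exact hc.not_virtuallyCollide_of_barrier lmem hF.2.1 halive hij.symm hij.right_mem.2 hk.1
          ho.le h1
    · intro i j d hij k hk hk'
      obtain ⟨p, d, h1⟩ := hall' k hk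
      exact absurd h1 (hk' p d)
  refine ⟨by omega, hF'.2.1, fun j hj hjn => ?_⟩
  rcases le_or_gt j l with hjl | hjl
  · obtain ⟨p, d, h1⟩ := hall' j ⟨hj, hjl⟩
    exact ⟨p, d, (h1.right_mem.2.trans_lt hln).ne, hU' _ _ _ (Or.inl h1)⟩
  · obtain ⟨p, d, h1, h2⟩ := hF'.2.2 j hjl hjn
    exact ⟨p, d, h1, hU' _ _ _ (Or.inr h2)⟩

/-- The right-moving `a` cannot survive, for it would have to cross `n`. If its partner `m` is not
`n`, then `m` is static, since a left-moving `m` would itself be the first arrival after `a`. The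
`l` of the second alternative is the particle that annihilates `m` when `a` is absent. -/
theorem ends_or_release_of_firstArrivalOn_succ (hc : c.Regular) (hv : c.vel a = 1)
    (hF : c.FirstArrivalOn (a + 1) n) : c.EndsAnnihilate a n ∨
      ∃ m l, c.EndsAnnihilate a m ∧ c.vel m = 0 ∧ c.FirstArrivalOn (m + 1) l ∧ c.Sooner a m l ∧
        c.FirstArrivalOn (l + 1) n := by
  have han : a < n := hF.1
  have hdrop : ∀ i j d, c.AnnihilateOn (Icc a n) i j d → i ≠ a → j ≠ a →
      (∀ p d', c.AnnihilateOn (Icc a n) a p d' → d ≤ d') →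
      c.AnnihilateOn (Icc (a + 1) n) i j d := by
    intro i j d hij hi hj halive
    refine hc.annihilateOn_restrict hij (Icc_subset_Icc (by omega) le_rfl) ?_
      ⟨lt_of_le_of_ne hij.left_mem.1 hi.symm, hij.left_mem.2⟩
      ⟨lt_of_le_of_ne hij.right_mem.1 hj.symm, hij.right_mem.2⟩
    intro k hk p d' hp hd
    refine ⟨lt_of_le_of_ne hp.right_mem.1 ?_, hp.right_mem.2⟩
    rintro rfl
    linarith [halive k d' hp.symm]
  have hex : ∃ m t, c.AnnihilateOn (Icc a n) a m t := by
    by_contra hno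
    push Not at hno
    have hp := hc.strictMono han
    obtain ⟨r, _, hcol⟩ := hc.exists_crossing_le (t := c.pos n - c.pos a) han
      (by unfold loc; rw [hF.2.1, hv]; push_cast; linarith) (by linarith)
    rcases hc.annihilateOn_or (finite_Icc a n) ⟨le_rfl, han.le⟩ ⟨han.le, le_rfl⟩ hcol with
      h | ⟨p, d, h, _⟩ | ⟨p, d, h, hp, _⟩
    · exact hno _ _ h
    · exact hno _ _ h
    · exact hc.not_annihilateOn_last hF p d
        (hdrop _ _ _ h han.ne' hp (fun p d' h => absurd h (hno p d')))
  obtain ⟨m, t, h⟩ := hex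
  have ham := lt_of_ends h rfl
  have hE : c.EndsAnnihilate a m := ⟨t, hc.annihilateOn_Icc_ends h ham⟩
  rcases h.right_mem.2.lt_or_eq with hmn | rfl
  swap
  · exact Or.inl hE
  right
  have hvm := hc.vel_lt_of_annihilateOn h ham
  have hvm0 : c.vel m = 0 := by
    by_contra h0
    have := hc.neg_one_le m
    exact hmn.ne (hc.firstArrivalOn_unique (hc.firstArrivalOn_succ_of_ends hE (by omega)) hF)
  have halive : ∀ d, d ≤ t → ∀ p d', c.AnnihilateOn (Icc a n) a p d' → d ≤ d' := by
    intro d hd p d' hp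
    rw [(hc.partner_unique h hp).2]
    exact hd
  have hinner : ∀ i, a < i → i < m → ∃ p d, c.AnnihilateOn (Icc (a + 1) n) i p d ∧
      a < p ∧ p < m := by
    intro i hi him
    obtain ⟨p, d, h1, h2, h3, h4⟩ :=
      hc.annihilateOn_enclosed h hi him ⟨hi.le, (him.trans hmn).le⟩
    exact ⟨p, d, hdrop _ _ _ h1 hi.ne' h2.ne' (halive d h4), h2, h3⟩
  obtain ⟨l, T, hln, hml'⟩ := hF.2.2 m ham hmn
  have hml : m < l := by
    by_contra hlm
    have hlm : l < m := lt_of_le_of_ne (not_lt.1 hlm) hml'.ne.symm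
    obtain ⟨p, d, h1, _, h2⟩ := hinner l hml'.right_mem.1 hlm
    exact h2.ne (hc.partner_unique h1 hml'.symm).1.symm
  have hvl : c.vel l = -1 := by
    have := hc.vel_lt_of_annihilateOn hml' hml
    have := hc.neg_one_le l
    omega
  have hl' : l < n := lt_of_le_of_ne hml'.right_mem.2 hln
  have hcl : ∀ k ∈ Icc (l + 1) n, ∀ p d, c.AnnihilateOn (Icc (a + 1) n) k p d →
      p ∈ Icc (l + 1) n := by
    intro k hk p d hp
    refine ⟨?_, hp.right_mem.2⟩
    by_contra hpl
    have hkl := hk.1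
    rcases lt_or_ge p m with hpm | hpm
    · obtain ⟨p', d', h1, _, h2⟩ := hinner p hp.right_mem.1 hpm
      have := (hc.partner_unique h1 hp.symm).1
      omega
    · have := (hc.partner_mem_Icc hml' hml ⟨hpm, by omega⟩ hp.symm).1.2
      omega
  refine ⟨m, l, hE, hvm0, hc.firstArrivalOn_succ_of_ends
    ⟨T, hc.annihilateOn_Icc_ends hml' hml⟩ hvl, ?_, hl', hF.2.1, fun j hj hjn => ?_⟩
  -- Were `l` to reach `m` first, it would obstruct the annihilation of `a` and `m` and be removed
  -- by some other particle. That removal would persist without `a`, where the partner of `l` is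
  -- `m`.
  · by_contra hs
    unfold Sooner at hs
    push Not at hs
    have h3 := hc.time_eq_of_static h ham hvm0
    have hp := hc.strictMono hml
    have hcol : c.VirtuallyCollide l m (c.pos l - c.pos m) := by
      refine hc.collide hml.ne' (by linarith) ?_
      unfold loc; rw [hvl, hvm0]; push_cast; ring
    have ho : c.Obstructs a m t l (c.pos l - c.pos m) := by
      refine obstructs (ham.trans hml).ne' hml.ne' (by linarith [hs.1]) (Or.inr hcol) ?_
      intro h4 h5
      have h6 := hs.2 (by linarith)
      unfold SpinSpares at h5
      omega
    obtain ⟨p, d, h5, h6, h7, h8⟩ := h.exists_removal ⟨(ham.trans hml).le, hl'.le⟩ ho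
    have := hdrop _ _ _ h5 (ham.trans hml).ne' h6 (halive d (h8.trans ho.le))
    exact h7 (hc.partner_unique hml'.symm this).1
  · obtain ⟨p, d, h1, h2⟩ := hF.2.2 j (by omega) hjn
    exact ⟨p, d, h1, hc.annihilateOn_restrict h2 (Icc_subset_Icc (by omega) le_rfl)
      (fun k hk p d hp _ => hcl k hk p d hp) ⟨hj, hjn.le⟩ (hcl j ⟨hj, hjn.le⟩ p d h2)⟩

/-- In every block that contains `l`, the partner of `a` is `m`. This makes the release events with
different indices, and the face event, mutually exclusive. -/
theorem annihilateOn_of_release (hc : c.Regular) (h : c.EndsAnnihilate a m)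
    (hF : c.FirstArrivalOn (m + 1) l) (hs : c.Sooner a m l)
    (hln : l ≤ n) : ∃ t, c.AnnihilateOn (Icc a n) a m t := by
  obtain ⟨hF', t, h'⟩ := hc.firstArrivalOn_of_ends h hF (fun _ => hs)
  exact ⟨t, hc.annihilateOn_of_barrier (S := Icc a l) (k := l)
    (fun q _ hq => ⟨hq.1, hq.2.trans hln⟩) (fun q hq hq' => ⟨hq'.1, hq⟩) ⟨hF'.1, le_rfl⟩ hF'.2.1 h'
    (fun p d h6 => absurd h6 (hc.not_annihilateOn_last hF' p d)) hF'.1 h'.right_mem.2⟩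

/-- The left-moving `k` shields the particles before it, which keep their annihilations in the full
system. These take place on `(0, ∞)`, so none of those particles reaches 0, and none is available to
stop `k`. -/
theorem reachesZero_of_firstArrivalOn (hc : c.Regular) (hpos : ∀ i, 0 < c.pos i)
    (hF : c.FirstArrivalOn 0 k) : c.ReachesZero k ∧ ∀ i < k, ¬ c.ReachesZero i := by
  have hall : ∀ i < k, ∃ p d, p ≠ k ∧ c.AnnihilateOn univ i p d := by
    intro i hi
    obtain ⟨p, d, h1, h2⟩ := hF.2.2 i (Nat.zero_le _) hi
    exact ⟨p, d, h1, hc.annihilateOn_of_barrier (S := Icc 0 k) (k := k) (fun _ _ _ => trivial)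
      (fun q hq _ => ⟨Nat.zero_le _, hq⟩) ⟨Nat.zero_le _, le_rfl⟩ hF.2.1 h2
      (fun p d h6 => absurd h6 (hc.not_annihilateOn_last hF p d)) hi.le h2.right_mem.2⟩
  refine ⟨⟨hF.2.1, hpos k, fun j t h => ?_⟩, fun i hi hri => ?_⟩
  · exfalso
    rw [← annihilateOn_univ] at h
    rcases lt_trichotomy j k with hjk | rfl | hjk
    · obtain ⟨p, d, h1, h2⟩ := hall j hjk
      exact h1 (hc.partner_unique h2 h.symm).1.symm
    · exact h.ne rfl
    · have := hc.vel_lt_of_annihilateOn h hjk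
      have := hc.neg_one_le j
      have := hF.2.1
      omega
  · obtain ⟨p, d, _, h⟩ := hall i hi
    have h1 := hri.2.2 p d (annihilateOn_univ.1 h)
    have h2 := hc.lt_loc_of_forall_lt_pos (fun i _ => hpos i) h h.time_nonneg le_rfl
    unfold loc at h2
    rw [hri.1] at h2
    push_cast at h2
    linarith

/-- Take for `j` the first left-moving particle that is not annihilated among `0, …, k`. A particle
before `j` that survives would not move left, and would then meet `k`, which survives too. -/
theorem exists_firstArrivalOn_of_reachesZero (hc : c.Regular) (hpos : ∀ i, 0 < c.pos i)
    (h : c.ReachesZero k) : ∃ j ≤ k, c.FirstArrivalOn 0 j := by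
  classical
  have hk : ∀ p d, ¬ c.AnnihilateOn (Icc 0 k) k p d := by
    intro p d hp
    have h1 := hc.annihilateOn_of_barrier (S := Icc 0 k) (S' := univ) (k := k)
      (fun _ _ _ => trivial) (fun q hq _ => ⟨Nat.zero_le _, hq⟩) ⟨Nat.zero_le _, le_rfl⟩ h.1 hp
      (fun p' d' hp' => (hc.partner_unique hp hp').2.ge) le_rfl hp.right_mem.2
    have h2 := h.2.2 p d (annihilateOn_univ.1 h1)
    have h3 := hc.lt_loc_of_forall_lt_pos (fun i _ => hpos i) hp hp.time_nonneg le_rfl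
    unfold loc at h3
    rw [h.1] at h3
    push_cast at h3
    linarith
  have hex : ∃ j, j ≤ k ∧ c.vel j = -1 ∧ ∀ p d, ¬ c.AnnihilateOn (Icc 0 k) j p d :=
    ⟨k, le_rfl, h.1, hk⟩
  obtain ⟨hjk, hvj, hj⟩ := Nat.find_spec hex
  have hmin := fun i (hi : i < Nat.find hex) => Nat.find_min hex hi
  generalize Nat.find hex = j at hjk hvj hj hmin
  refine ⟨j, hjk, Nat.zero_le _, hvj, fun i _ hij => ?_⟩
  have hi : ∃ p d, c.AnnihilateOn (Icc 0 k) i p d := by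
    by_contra hno
    push Not at hno
    have hik := hij.trans_le hjk
    by_cases hvi : c.vel i = -1
    · exact hmin i hij ⟨hik.le, hvi, hno⟩
    · have hvi : 0 ≤ c.vel i := by
        have := hc.neg_one_le i
        omega
      have hvi' : (0 : ℝ) ≤ c.vel i := by exact_mod_cast hvi
      have hp := hc.strictMono hik
      obtain ⟨r, _, hcol⟩ := hc.exists_crossing_le (t := c.pos k - c.pos i) hik
        (by unfold loc; rw [h.1]; push_cast; nlinarith) (by linarith)
      rcases hc.annihilateOn_or (finite_Icc 0 k) ⟨Nat.zero_le _, hik.le⟩ ⟨Nat.zero_le _, le_rfl⟩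
        hcol with h | ⟨p, d, h, _⟩ | ⟨p, d, h, _⟩
      · exact hno _ _ h
      · exact hno _ _ h
      · exact hk _ _ h
  obtain ⟨p, d, hp⟩ := hi
  have halive : ∀ p d', c.AnnihilateOn (Icc 0 k) j p d' → d ≤ d' :=
    fun p d' h => absurd h (hj p d')
  have hjS : j ∈ Icc 0 k := ⟨Nat.zero_le _, hjk⟩
  have hpj := hc.partner_le_of_barrier hjS hvj halive hp hij.le
  refine ⟨p, d, ?_, hc.annihilateOn_of_barrier (S := Icc 0 k) (S' := Icc 0 j) (k := j)
    (fun q hq _ => ⟨Nat.zero_le _, hq⟩) (fun q hq _ => ⟨Nat.zero_le _, hq.trans hjk⟩) hjS hvj hp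
    halive hij.le hpj⟩
  rintro rfl
  exact hj _ _ hp.symm

theorem firstArrival_eq_iff (hc : c.Regular) (hpos : ∀ i, 0 < c.pos i) (k : ℕ) :
    c.firstArrival = ((k + 1 : ℕ) : ℕ∞) ↔ c.FirstArrivalOn 0 k := by
  have hle : ∀ k, c.ReachesZero k → c.firstArrival ≤ ((k + 1 : ℕ) : ℕ∞) := fun k hk =>
    iInf₂_le k hk
  have heq : ∀ k, c.FirstArrivalOn 0 k → c.firstArrival = ((k + 1 : ℕ) : ℕ∞) := by
    intro k hF
    obtain ⟨h1, h2⟩ := hc.reachesZero_of_firstArrivalOn hpos hF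
    refine le_antisymm (hle k h1) (le_iInf₂ fun i hi => ?_)
    by_contra hlt
    push Not at hlt
    have : i < k := by
      have : (i + 1 : ℕ) < k + 1 := by exact_mod_cast hlt
      omega
    exact h2 i this hi
  refine ⟨fun h => ?_, heq k⟩
  by_cases hex : ∃ i, c.ReachesZero i
  · obtain ⟨i, hi⟩ := hex
    obtain ⟨j, _, hj⟩ := hc.exists_firstArrivalOn_of_reachesZero hpos hi
    have h1 := (heq j hj).symm.trans h
    have : j = k := by
      have : j + 1 = k + 1 := by exact_mod_cast h1
      omega
    exact this ▸ hj
  · push Not at hex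
    have : c.firstArrival = ⊤ := by
      unfold firstArrival
      simp [hex]
    rw [this] at h
    exact absurd h (ENat.natCast_ne_top _).symm

end Regular

end Config

end BallisticAnnihilation

/-! ### Invariance under translation, reflection and change of the meeting times. -/

namespace BallisticAnnihilation

namespace Config

variable {c c' : Config} {S S' : Set ℕ} {i j k l q a m n : ℕ} {t r d : ℝ}

/-- Annihilations are preserved by translations and reflections. -/
theorem AnnihilateOn.map {σ : ℕ → ℕ} {ε : ℤ} (hε : ε = 1 ∨ ε = -1) {b : ℝ} (hσ : BijOn σ S S')
    (hpos : ∀ i ∈ S, c'.pos (σ i) = ε * c.pos i + b) (hvel : ∀ i ∈ S, c'.vel (σ i) = ε * c.vel i)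
    (hspin : ∀ i ∈ S, c'.spin (σ i) = ε * c.spin i) (h : c.AnnihilateOn S i j t) :
    c'.AnnihilateOn S' (σ i) (σ j) t := by
  have hinv : ∀ k ∈ S', Function.invFunOn σ S k ∈ S ∧ σ (Function.invFunOn σ S k) = k :=
    fun k hk => Function.invFunOn_pos (hσ.surjOn hk)
  have hε0 : (ε : ℝ) ≠ 0 := by rcases hε with rfl | rfl <;> norm_num
  have hcol : ∀ i ∈ S, ∀ j ∈ S, ∀ t,
      c'.VirtuallyCollide (σ i) (σ j) t ↔ c.VirtuallyCollide i j t := by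
    intro i hi j hj t
    unfold VirtuallyCollide
    rw [hpos i hi, hpos j hj, hvel i hi, hvel j hj]
    refine and_congr ?_ (and_congr Iff.rfl ?_)
    · rcases hε with rfl | rfl <;> simp
    · push_cast
      constructor
      · intro h
        apply mul_left_cancel₀ hε0
        linarith
      · intro h
        linear_combination (ε : ℝ) * h
  have hspares : ∀ i ∈ S, ∀ j ∈ S, ∀ k ∈ S, c'.SpinSpares (σ i) (σ j) (σ k) ↔
      c.SpinSpares i j k := by
    intro i hi j hj k hk
    unfold SpinSpares
    rw [hvel i hi, hvel j hj, hvel k hk, hspin i hi, hspin j hj]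
    rcases hε with rfl | rfl <;> simp
  induction h with
  | intro i j t p d hi hj hc h1 h2 ih =>
    have hob : ∀ k ∈ S', ∀ r, c'.Obstructs (σ i) (σ j) t k r →
        c.Obstructs i j t (Function.invFunOn σ S k) r := by
      intro k hk r ho
      obtain ⟨hk1, hk2⟩ := hinv k hk
      rw [← hk2] at ho
      unfold Obstructs at ho ⊢
      rw [hcol _ hk1 _ hi, hcol _ hk1 _ hj, hspares _ hi _ hj _ hk1] at ho
      exact ⟨fun h => ho.1 (congrArg σ h), fun h => ho.2.1 (congrArg σ h), ho.2.2⟩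
    refine .intro _ _ t (fun k => σ (p (Function.invFunOn σ S k)))
      (fun k => d (Function.invFunOn σ S k)) (hσ.mapsTo hi) (hσ.mapsTo hj)
      ((hcol i hi j hj t).2 hc) ?_ ?_
    · intro k hk r ho
      have hk1 := (hinv k hk).1
      obtain ⟨h3, h4, h5⟩ := h1 _ hk1 r (hob k hk r ho)
      have hp := (h2 _ hk1 r (hob k hk r ho)).right_mem
      exact ⟨fun h => h3 (hσ.injOn hp hi h), fun h => h4 (hσ.injOn hp hj h), h5⟩
    · intro k hk r ho
      obtain ⟨hk1, hk2⟩ := hinv k hk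
      have h3 := ih _ hk1 r (hob k hk r ho)
      rwa [hk2] at h3

theorem FirstArrivalOn.shift (hpos : ∀ i ≤ n, ∀ j ≤ n,
      c'.pos (i + a) - c'.pos (j + a) = c.pos i - c.pos j)
    (hvel : ∀ i ≤ n, c'.vel (i + a) = c.vel i) (hspin : ∀ i ≤ n, c'.spin (i + a) = c.spin i) :
    c'.FirstArrivalOn a (n + a) ↔ c.FirstArrivalOn 0 n := by
  have hpos' : ∀ i ≤ n, c'.pos (i + a) = c.pos i + (c'.pos (0 + a) - c.pos 0) := by
    intro i hi
    linarith [hpos i hi 0 (Nat.zero_le _)]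
  have h1 : ∀ i j t, c.AnnihilateOn (Icc 0 n) i j t →
      c'.AnnihilateOn (Icc a (n + a)) (i + a) (j + a) t := by
    intro i j t h
    refine h.map (σ := (· + a)) (ε := 1) (Or.inl rfl) (b := c'.pos (0 + a) - c.pos 0)
      ⟨?_, ?_, ?_⟩ ?_ ?_ ?_
    · rintro i ⟨_, hi⟩
      simp only [mem_Icc]; omega
    · intro i _ j _ h
      simpa using h
    · rintro i ⟨h1, h2⟩
      exact ⟨i - a, ⟨Nat.zero_le _, by omega⟩, by simp only; omega⟩
    · rintro i ⟨_, hi⟩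
      rw [hpos' i hi]; push_cast; ring
    · rintro i ⟨_, hi⟩
      rw [hvel i hi, one_mul]
    · rintro i ⟨_, hi⟩
      rw [hspin i hi, one_mul]
  have h2 : ∀ i j t, c'.AnnihilateOn (Icc a (n + a)) i j t →
      c.AnnihilateOn (Icc 0 n) (i - a) (j - a) t := by
    intro i j t h
    refine h.map (σ := (· - a)) (ε := 1) (Or.inl rfl) (b := c.pos 0 - c'.pos (0 + a))
      ⟨?_, ?_, ?_⟩ ?_ ?_ ?_
    · rintro i ⟨_, hi⟩
      simp only [mem_Icc]; omega
    · rintro i ⟨hi, _⟩ j ⟨hj, _⟩ h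
      simp only at h; omega
    · rintro i ⟨h1, h2⟩
      exact ⟨i + a, ⟨by omega, by omega⟩, by simp⟩
    · rintro i ⟨hi, hi'⟩
      have := hpos' (i - a) (by omega)
      rw [Nat.sub_add_cancel hi] at this
      rw [this]; push_cast; ring
    · rintro i ⟨hi, hi'⟩
      have := hvel (i - a) (by omega)
      rw [Nat.sub_add_cancel hi] at this
      rw [this, one_mul]
    · rintro i ⟨hi, hi'⟩
      have := hspin (i - a) (by omega)
      rw [Nat.sub_add_cancel hi] at this
      rw [this, one_mul]
  unfold FirstArrivalOn
  rw [hvel n le_rfl]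
  refine and_congr (by simp) (and_congr Iff.rfl ⟨fun h j _ hj => ?_, fun h j hj hjn => ?_⟩)
  · obtain ⟨p, d, hp, hd⟩ := h (j + a) (by omega) (by omega)
    have hpm := hd.right_mem.1
    refine ⟨p - a, d, by omega, ?_⟩
    simpa using h2 _ _ _ hd
  · obtain ⟨p, d, hp, hd⟩ := h (j - a) (Nat.zero_le _) (by omega)
    refine ⟨p + a, d, by omega, ?_⟩
    simpa [Nat.sub_add_cancel hj] using h1 _ _ _ hd

theorem AnnihilateOn.congr (hpos : ∀ i ∈ S, c'.pos i = c.pos i)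
    (hvel : ∀ i ∈ S, c'.vel i = c.vel i) (hspin : ∀ i ∈ S, c'.spin i = c.spin i) :
    c'.AnnihilateOn S i j t ↔ c.AnnihilateOn S i j t := by
  constructor
  · intro h
    exact h.map (σ := id) (ε := 1) (b := 0) (Or.inl rfl) (bijOn_id S)
      (fun i hi => by simp [hpos i hi]) (fun i hi => by simp [hvel i hi])
      (fun i hi => by simp [hspin i hi])
  · intro h
    exact h.map (σ := id) (ε := 1) (b := 0) (Or.inl rfl) (bijOn_id S)
      (fun i hi => by simp [hpos i hi]) (fun i hi => by simp [hvel i hi])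
      (fun i hi => by simp [hspin i hi])

theorem EndsAnnihilate.of_reflect {b : ℝ} (hpos : ∀ i ≤ m, c'.pos (m - i) = b - c.pos i)
    (hvel : ∀ i ≤ m, c'.vel (m - i) = -c.vel i) (hspin : ∀ i ≤ m, c'.spin (m - i) = -c.spin i)
    (h : c.EndsAnnihilate 0 m) : c'.EndsAnnihilate 0 m := by
  obtain ⟨t, h⟩ := h
  have h' : c'.AnnihilateOn (Icc 0 m) (m - 0) (m - m) t := by
    refine h.map (σ := (m - ·)) (ε := -1) (Or.inr rfl) (b := b) ⟨?_, ?_, ?_⟩ ?_ ?_ ?_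
    · rintro i ⟨_, hi⟩
      exact ⟨Nat.zero_le _, Nat.sub_le _ _⟩
    · rintro i ⟨_, hi⟩ j ⟨_, hj⟩ h
      simp only at h; omega
    · rintro i ⟨_, hi⟩
      exact ⟨m - i, ⟨Nat.zero_le _, Nat.sub_le _ _⟩, by simp only; omega⟩
    · rintro i ⟨_, hi⟩
      rw [hpos i hi]; push_cast; ring
    · rintro i ⟨_, hi⟩
      rw [hvel i hi]; ring
    · rintro i ⟨_, hi⟩
      rw [hspin i hi]; ring
  rw [Nat.sub_zero, Nat.sub_self] at h'
  exact ⟨t, h'.symm⟩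

theorem endsAnnihilate_reflect {b : ℝ} (hpos : ∀ i ≤ m, c'.pos (m - i) = b - c.pos i)
    (hvel : ∀ i ≤ m, c'.vel (m - i) = -c.vel i) (hspin : ∀ i ≤ m, c'.spin (m - i) = -c.spin i) :
    c'.EndsAnnihilate 0 m ↔ c.EndsAnnihilate 0 m := by
  refine ⟨fun h => h.of_reflect (b := b) ?_ ?_ ?_, fun h => h.of_reflect hpos hvel hspin⟩
  · intro i hi
    have := hpos (m - i) (Nat.sub_le _ _)
    rw [Nat.sub_sub_self hi] at this
    linarith
  · intro i hi
    have := hvel (m - i) (Nat.sub_le _ _)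
    rw [Nat.sub_sub_self hi] at this
    omega
  · intro i hi
    have := hspin (m - i) (Nat.sub_le _ _)
    rw [Nat.sub_sub_self hi] at this
    omega

/-- The time of the virtual collision of `i` and `j`. -/
noncomputable def meetingTime (c : Config) (i j : ℕ) : ℝ :=
  (c.pos j - c.pos i) / ((c.vel i : ℝ) - c.vel j)

theorem virtuallyCollide_iff : c.VirtuallyCollide i j t ↔
    c.vel i ≠ c.vel j ∧ 0 ≤ c.meetingTime i j ∧ t = c.meetingTime i j := by
  unfold VirtuallyCollide
  by_cases hv : c.vel i = c.vel j
  · simp [hv]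
  have h0 : (c.vel i : ℝ) - c.vel j ≠ 0 := by
    rw [sub_ne_zero]; exact_mod_cast hv
  have h1 : c.pos i + (c.vel i : ℝ) * t = c.pos j + (c.vel j : ℝ) * t ↔ t = c.meetingTime i j := by
    unfold meetingTime
    rw [eq_div_iff h0]
    constructor <;> intro h <;> linarith
  rw [h1]
  constructor
  · rintro ⟨h2, h3, rfl⟩
    exact ⟨h2, h3, rfl⟩
  · rintro ⟨h2, h3, rfl⟩
    exact ⟨h2, h3, rfl⟩

/-- Annihilations only depend on the order of the meeting times. -/
theorem AnnihilateOn.of_order (hvel : ∀ i ∈ S, c'.vel i = c.vel i)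
    (hspin : ∀ i ∈ S, c'.spin i = c.spin i)
    (h0 : ∀ i ∈ S, ∀ j ∈ S, (0 ≤ c'.meetingTime i j ↔ 0 ≤ c.meetingTime i j))
    (hle : ∀ i ∈ S, ∀ j ∈ S, ∀ k ∈ S, ∀ l ∈ S,
      (c'.meetingTime i j ≤ c'.meetingTime k l ↔ c.meetingTime i j ≤ c.meetingTime k l))
    (h : c.AnnihilateOn S i j t) : c'.AnnihilateOn S i j (c'.meetingTime i j) := by
  have hcol : ∀ i ∈ S, ∀ j ∈ S, ∀ r, c'.VirtuallyCollide i j r →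
      c.VirtuallyCollide i j (c.meetingTime i j) ∧ r = c'.meetingTime i j := by
    intro i hi j hj r h
    rw [virtuallyCollide_iff] at h ⊢
    rw [hvel i hi, hvel j hj, h0 i hi j hj] at h
    exact ⟨⟨h.1, h.2.1, rfl⟩, h.2.2⟩
  induction h with
  | intro i j t p d hi hj hc h1 h2 ih =>
    have ht := (virtuallyCollide_iff.1 hc).2.2
    have key : ∀ k ∈ S, ∀ r, c'.Obstructs i j (c'.meetingTime i j) k r →
        ∃ r', c.Obstructs i j t k r' ∧
          ∀ x ∈ S, ∀ y ∈ S, c.meetingTime x y ≤ r' → c'.meetingTime x y ≤ r := by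
      rintro k hk r ⟨hki, hkj, hr, hcr, hns⟩
      have aux : ∀ x ∈ S, c'.VirtuallyCollide k x r →
          c.VirtuallyCollide k x (c.meetingTime k x) ∧ c.meetingTime k x ≤ t ∧
          ¬ (c.meetingTime k x = t ∧ c.SpinSpares i j k) ∧
          ∀ y ∈ S, ∀ z ∈ S, c.meetingTime y z ≤ c.meetingTime k x → c'.meetingTime y z ≤ r := by
        intro x hx hcx
        obtain ⟨h3, rfl⟩ := hcol k hk x hx r hcx
        refine ⟨h3, ?_, ?_, fun y hy z hz h => (hle y hy z hz k hk x hx).2 h⟩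
        · rw [ht]; exact (hle k hk x hx i hi j hj).1 hr
        · rintro ⟨h4, h5⟩
          refine hns ⟨le_antisymm hr ((hle i hi j hj k hk x hx).2 (by rw [← ht, h4])), ?_⟩
          unfold SpinSpares at h5 ⊢
          rwa [hvel i hi, hvel j hj, hvel k hk, hspin i hi, hspin j hj]
      rcases hcr with h | h
      · obtain ⟨h3, h4, h5, h6⟩ := aux i hi h
        exact ⟨_, ⟨hki, hkj, h4, Or.inl h3, h5⟩, h6⟩
      · obtain ⟨h3, h4, h5, h6⟩ := aux j hj h
        exact ⟨_, ⟨hki, hkj, h4, Or.inr h3, h5⟩, h6⟩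
    refine .intro i j _ p (fun k => c'.meetingTime k (p k)) hi hj ?_ ?_ ?_
    · have := virtuallyCollide_iff.1 hc
      rw [virtuallyCollide_iff, hvel i hi, hvel j hj, h0 i hi j hj]
      exact ⟨this.1, this.2.1, rfl⟩
    · intro k hk r ho
      obtain ⟨r', h3, h4⟩ := key k hk r ho
      obtain ⟨h5, h6, h7⟩ := h1 k hk r' h3
      have h8 := h2 k hk r' h3
      refine ⟨h5, h6, h4 k hk _ h8.right_mem ?_⟩
      rwa [← (virtuallyCollide_iff.1 h8.collide).2.2]
    · intro k hk r ho
      obtain ⟨r', h3, _⟩ := key k hk r ho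
      exact ih k hk r' h3

end Config

end BallisticAnnihilation

/-! ### Words of letters; the reflection and the exchange of blocks. -/

namespace BallisticAnnihilation

/-- The coordinates `(0, n)`, `(1, n)`, `(2, n)` are the `n`-th interdistance, velocity, spin. -/
abbrev Word := Fin 3 × ℕ → ℝ

namespace Word

open Config

/-- The configuration described by a word. -/
noncomputable def toConfig (w : Word) : Config :=
  configOf (fun n => w (0, n)) (fun n => ⌊w (1, n)⌋) (fun n => ⌊w (2, n)⌋)

/-- Positive interdistances, velocities in `{-1, 0, 1}` and spins in `{-1, 1}`. -/
def Good (w : Word) : Prop :=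
  ∀ n, 0 < w (0, n) ∧ (w (1, n) = -1 ∨ w (1, n) = 0 ∨ w (1, n) = 1) ∧
    (w (2, n) = 1 ∨ w (2, n) = -1)

variable {w w' : Word}

@[simp] theorem toConfig_vel (n : ℕ) : w.toConfig.vel n = ⌊w (1, n)⌋ := rfl

@[simp] theorem toConfig_spin (n : ℕ) : w.toConfig.spin n = ⌊w (2, n)⌋ := rfl

theorem toConfig_pos (n : ℕ) : w.toConfig.pos n = ∑ i ∈ Finset.range (n + 1), w (0, i) := rfl

theorem toConfig_pos_zero : w.toConfig.pos 0 = w (0, 0) := by simp [toConfig_pos]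

theorem toConfig_pos_succ (n : ℕ) :
    w.toConfig.pos (n + 1) = w.toConfig.pos n + w (0, n + 1) := by
  rw [toConfig_pos, Finset.sum_range_succ, ← toConfig_pos]

@[simp] theorem floor_neg_one : ⌊(-1 : ℝ)⌋ = -1 := by norm_num

theorem Good.regular (hw : w.Good) : w.toConfig.Regular where
  strictMono := strictMono_nat_of_lt_succ fun n => by
    rw [toConfig_pos_succ]; linarith [(hw (n + 1)).1]
  neg_one_le i := by
    rcases (hw i).2.1 with h | h | h <;> simp [h]
  le_one i := by
    rcases (hw i).2.1 with h | h | h <;> simp [h]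
  spin_eq i := by
    rcases (hw i).2.2 with h | h <;> simp [h]

theorem Good.pos_pos (hw : w.Good) (n : ℕ) : 0 < w.toConfig.pos n := by
  rw [toConfig_pos]
  exact Finset.sum_pos (fun i _ => (hw i).1) (by simp)

/-- The word without its first `a` letters. -/
def shift (a : ℕ) (w : Word) : Word := fun x => w (x.1, x.2 + a)

theorem shift_shift (a b : ℕ) (w : Word) : (w.shift a).shift b = w.shift (b + a) := by
  funext x
  simp [Word.shift, add_assoc]

theorem shift_pos_sub (w : Word) (a i : ℕ) :
    w.toConfig.pos (i + a) = w.toConfig.pos a + ((w.shift a).toConfig.pos i - w (0, a)) := by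
  induction i with
  | zero => simp [toConfig_pos_zero, Word.shift]
  | succ n ih =>
    rw [show n + 1 + a = n + a + 1 by ring, toConfig_pos_succ, toConfig_pos_succ, ih]
    simp only [Word.shift]
    rw [show n + 1 + a = n + a + 1 by ring]
    ring

theorem shift_pos_succ (w : Word) (a i : ℕ) :
    w.toConfig.pos (i + (a + 1)) = w.toConfig.pos a + (w.shift (a + 1)).toConfig.pos i := by
  rw [shift_pos_sub, toConfig_pos_succ]
  ring

theorem firstArrivalOn_shift (w : Word) (a n : ℕ) :
    w.toConfig.FirstArrivalOn a (n + a) ↔ (w.shift a).toConfig.FirstArrivalOn 0 n := by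
  apply FirstArrivalOn.shift
  · intro i _ j _
    rw [shift_pos_sub, shift_pos_sub]
    ring
  · intro i _
    rfl
  · intro i _
    rfl

/-- The two words have the same first `N` letters. -/
def AgreeBelow (N : ℕ) (w w' : Word) : Prop := ∀ c, ∀ i < N, w (c, i) = w' (c, i)

namespace AgreeBelow

variable {N n : ℕ}

theorem pos_eq (h : AgreeBelow N w w') (hn : n < N) : w.toConfig.pos n = w'.toConfig.pos n := by
  rw [toConfig_pos, toConfig_pos]
  refine Finset.sum_congr rfl fun i hi => h 0 i ?_
  have := Finset.mem_range.1 hi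
  omega

theorem annihilateOn_iff (h : AgreeBelow N w w') {S : Set ℕ} (hS : ∀ i ∈ S, i < N) (i j : ℕ)
    (t : ℝ) : w.toConfig.AnnihilateOn S i j t ↔ w'.toConfig.AnnihilateOn S i j t :=
  AnnihilateOn.congr (fun i hi => h.pos_eq (hS i hi))
    (fun i hi => by simp [h 1 i (hS i hi)]) (fun i hi => by simp [h 2 i (hS i hi)])

theorem firstArrivalOn_iff (h : AgreeBelow N w w') (hn : n < N) (a : ℕ) :
    w.toConfig.FirstArrivalOn a n ↔ w'.toConfig.FirstArrivalOn a n := by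
  have hS : ∀ i ∈ Icc a n, i < N := fun i hi => hi.2.trans_lt hn
  unfold FirstArrivalOn
  simp only [h.annihilateOn_iff hS, toConfig_vel, h 1 n hn]

theorem endsAnnihilate_iff (h : AgreeBelow N w w') (hn : n < N) (a : ℕ) :
    w.toConfig.EndsAnnihilate a n ↔ w'.toConfig.EndsAnnihilate a n := by
  have hS : ∀ i ∈ Icc a n, i < N := fun i hi => hi.2.trans_lt hn
  unfold EndsAnnihilate
  simp only [h.annihilateOn_iff hS]

end AgreeBelow

/-- The word whose `i`-th letter is the letter of `w` of index `σ i`, where the component `c` is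
multiplied by `ε (c, i)`. -/
def reindex (σ : Fin 3 × ℕ → Fin 3 × ℕ) (ε : Fin 3 × ℕ → ℝ) (w : Word) : Word :=
  fun x => ε x * w (σ x)

/-- The reindexing that reflects the positions of the first `k + 2` particles and the velocities and
spins of the first `k + 1` ones. -/
def reflectIndex (k : ℕ) (x : Fin 3 × ℕ) : Fin 3 × ℕ :=
  (x.1, if x.1 = 0 then (if x.2 ≤ k + 1 then k + 1 - x.2 else x.2)
    else (if x.2 ≤ k then k - x.2 else x.2))

/-- The signs that accompany a reflection. -/
def reflectSign (k : ℕ) (x : Fin 3 × ℕ) : ℝ := if x.1 ≠ 0 ∧ x.2 ≤ k then -1 else 1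

/-- The reflection of the first `k + 1` particles, followed by a static particle. -/
def reflect (k : ℕ) : Word → Word := reindex (reflectIndex k) (reflectSign k)

theorem reflect_dist {k i : ℕ} (w : Word) (hi : i ≤ k + 1) :
    w.reflect k (0, i) = w (0, k + 1 - i) := by
  simp [reflect, reindex, reflectIndex, reflectSign, hi]

theorem reflect_of_le {k i : ℕ} (w : Word) {c : Fin 3} (hc : c ≠ 0) (hi : i ≤ k) :
    w.reflect k (c, i) = -w (c, k - i) := by
  simp [reflect, reindex, reflectIndex, reflectSign, hi, hc]

theorem reflect_of_lt {k i : ℕ} (w : Word) (c : Fin 3) (hi : k + 1 < i) :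
    w.reflect k (c, i) = w (c, i) := by
  have h1 : ¬ i ≤ k := by omega
  have h2 : ¬ i ≤ k + 1 := by omega
  simp [reflect, reindex, reflectIndex, reflectSign, h1, h2]

theorem reflect_succ {k : ℕ} (w : Word) {c : Fin 3} (hc : c ≠ 0) :
    w.reflect k (c, k + 1) = w (c, k + 1) := by
  simp [reflect, reindex, reflectIndex, reflectSign, hc]

theorem shift_reflect (k : ℕ) (w : Word) : (w.reflect k).shift (k + 2) = w.shift (k + 2) := by
  funext x
  exact reflect_of_lt w x.1 (by omega)

/-- The word preceded by a static particle. -/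
def consStatic (s : ℝ) (w : Word) : Word
  | (c, 0) => if c = 0 then 1 else if c = 1 then 0 else s
  | (c, n + 1) => w (c, n)

@[simp] theorem consStatic_zero (s : ℝ) (w : Word) (c : Fin 3) :
    w.consStatic s (c, 0) = if c = 0 then 1 else if c = 1 then 0 else s := rfl

theorem consStatic_pos (s : ℝ) (w : Word) (i : ℕ) :
    (w.consStatic s).toConfig.pos (i + 1) = 1 + w.toConfig.pos i := by
  induction i with
  | zero => simp [toConfig_pos_succ, toConfig_pos_zero, consStatic]
  | succ n ih =>
    rw [toConfig_pos_succ, ih, toConfig_pos_succ]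
    simp only [consStatic]
    ring

theorem Good.consStatic (hw : w.Good) {s : ℝ} (hs : s = 1 ∨ s = -1) : (w.consStatic s).Good := by
  intro n
  cases n with
  | zero => simpa [Word.consStatic] using hs
  | succ n => exact hw n

/-- Here `consStatic 1` is bookkeeping: its locations minus 1 are those of `w` preceded by a
particle at 0, which covers the index `k + 1 - i = 0`. -/
theorem reflect_pos (w : Word) (k i : ℕ) (hi : i ≤ k + 1) :
    (w.reflect k).toConfig.pos i = w.toConfig.pos (k + 1) -
      ((w.consStatic 1).toConfig.pos (k + 1 - i) - 1) := by
  induction i with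
  | zero =>
    rw [Nat.sub_zero, consStatic_pos, toConfig_pos_zero, reflect_dist w hi, toConfig_pos_succ]
    simp
  | succ n ih =>
    rw [toConfig_pos_succ, ih (by omega), reflect_dist w hi]
    obtain ⟨q, hq⟩ : ∃ q, k + 1 - n = q + 1 := ⟨k - n, by omega⟩
    rw [hq, show k + 1 - (n + 1) = q by omega, consStatic_pos]
    cases q with
    | zero => simp [toConfig_pos_zero]
    | succ q => rw [consStatic_pos, toConfig_pos_succ q]; ring

theorem floor_neg_of_eq_intCast {x : ℝ} (h : ∃ z : ℤ, x = z) : ⌊-x⌋ = -⌊x⌋ := by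
  obtain ⟨z, rfl⟩ := h
  rw [← Int.cast_neg, Int.floor_intCast, Int.floor_intCast]

theorem Good.exists_vel (hw : w.Good) (n : ℕ) : ∃ z : ℤ, w (1, n) = z := by
  rcases (hw n).2.1 with h | h | h
  · exact ⟨-1, by simp [h]⟩
  · exact ⟨0, by simp [h]⟩
  · exact ⟨1, by simp [h]⟩

theorem Good.exists_spin (hw : w.Good) (n : ℕ) : ∃ z : ℤ, w (2, n) = z := by
  rcases (hw n).2.2 with h | h
  · exact ⟨1, by simp [h]⟩
  · exact ⟨-1, by simp [h]⟩

theorem shift_consStatic (s : ℝ) (w : Word) : (w.consStatic s).shift 1 = w := rfl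

/-- Seen in a mirror, the reflected block followed by the static `k + 1` is a static particle
followed by the original block, and `ends_iff_of_static` applies. The interdistance `w (0, 0)`
between 0 and the block becomes the gap next to the static particle. -/
theorem Good.ends_reflect (hw : w.Good) {k : ℕ} (hv : ⌊w (1, k + 1)⌋ = 0) :
    (w.reflect k).toConfig.EndsAnnihilate 0 (k + 1) ↔ w.toConfig.FirstArrivalOn 0 k := by
  -- `reflect` keeps the spin of the static particle while the mirror reverses it, hence the sign.
  set u := w.consStatic (-w (2, k + 1)) with hu
  have hs : -w (2, k + 1) = 1 ∨ -w (2, k + 1) = -1 := by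
    rcases (hw (k + 1)).2.2 with h | h <;> simp [h]
  have hug : u.Good := hw.consStatic hs
  have h1 : (w.reflect k).toConfig.EndsAnnihilate 0 (k + 1) ↔
      u.toConfig.EndsAnnihilate 0 (k + 1) := by
    refine endsAnnihilate_reflect (b := w.toConfig.pos (k + 1) + 1) ?_ ?_ ?_
    · intro i hi
      rw [reflect_pos w k _ (Nat.sub_le _ _), Nat.sub_sub_self hi]
      have : (w.consStatic 1).toConfig.pos i = u.toConfig.pos i := by
        cases i with
        | zero => simp [toConfig_pos_zero, hu]
        | succ i => rw [consStatic_pos, hu, consStatic_pos]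
      rw [this]
      ring
    · intro i hi
      cases i with
      | zero =>
        simp only [toConfig_vel, Nat.sub_zero]
        rw [reflect_succ w (by decide), hv]
        simp [hu]
      | succ i =>
        simp only [toConfig_vel]
        rw [reflect_of_le w (by decide) (by omega), show k - (k + 1 - (i + 1)) = i by omega,
          floor_neg_of_eq_intCast (hw.exists_vel i)]
        rfl
    · intro i hi
      cases i with
      | zero =>
        simp only [toConfig_spin, Nat.sub_zero]
        rw [reflect_succ w (by decide), ← floor_neg_of_eq_intCast (hug.exists_spin 0)]
        simp [hu]
      | succ i =>
        simp only [toConfig_spin]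
        rw [reflect_of_le w (by decide) (by omega), show k - (k + 1 - (i + 1)) = i by omega,
          floor_neg_of_eq_intCast (hw.exists_spin i)]
        rfl
  have hv0 : u.toConfig.vel 0 = 0 := by simp [hu]
  rw [h1, hug.regular.ends_iff_of_static hv0, zero_add, firstArrivalOn_shift, hu, shift_consStatic]

/-- The event that, in the first `i + 2` letters, the first particle is annihilated by the last one,
which is static, while the first arrival after that is later and comes from `j` particles further.
-/
def ReleaseEvent (i j : ℕ) (w : Word) : Prop :=
  ⌊w (1, i + 1)⌋ = 0 ∧ w.toConfig.EndsAnnihilate 0 (i + 1) ∧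
    w.toConfig.FirstArrivalOn (i + 2) (j + (i + 2)) ∧
    w.toConfig.Sooner 0 (i + 1) (j + (i + 2))

/-- The event that there are first arrivals on both sides of a static particle, the first of which
comes from the left. -/
def RaceEvent (i j : ℕ) (w : Word) : Prop :=
  ⌊w (1, i + 1)⌋ = 0 ∧ w.toConfig.FirstArrivalOn 0 i ∧
    (w.shift (i + 2)).toConfig.FirstArrivalOn 0 j ∧
    (w.toConfig.pos i < (w.shift (i + 2)).toConfig.pos j ∨
      (w.toConfig.pos i = (w.shift (i + 2)).toConfig.pos j ∧ ⌊w (2, i + 1)⌋ = -1))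

theorem Good.releaseEvent_reflect (hw : w.Good) (i j : ℕ) :
    (w.reflect i).ReleaseEvent i j ↔ w.RaceEvent i j := by
  unfold ReleaseEvent RaceEvent
  rw [reflect_succ w (by decide)]
  refine and_congr_right fun hv => ?_
  rw [hw.ends_reflect hv, firstArrivalOn_shift, shift_reflect]
  refine and_congr Iff.rfl (and_congr Iff.rfl ?_)
  unfold Sooner
  have e1 : (w.reflect i).toConfig.pos (j + (i + 2)) - (w.reflect i).toConfig.pos (i + 1) =
      (w.shift (i + 2)).toConfig.pos j := by
    rw [shift_pos_succ _ (i + 1) j, shift_reflect]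
    ring
  have e2 : (w.reflect i).toConfig.pos (i + 1) - (w.reflect i).toConfig.pos 0 =
      w.toConfig.pos i := by
    rw [reflect_pos w i _ le_rfl, reflect_pos w i 0 (Nat.zero_le _), Nat.sub_zero, Nat.sub_self,
      consStatic_pos, toConfig_pos_zero]
    simp
  rw [e1, e2, toConfig_spin, reflect_succ w (by decide)]

/-- The exchange of the blocks on the left and on the right of the particle `k + 1`. -/
def swapIndex (k l : ℕ) (x : Fin 3 × ℕ) : Fin 3 × ℕ :=
  (x.1, if x.2 ≤ l then x.2 + (k + 2) else if x.2 = l + 1 then k + 1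
    else if x.2 ≤ k + l + 2 then x.2 - (l + 2) else x.2)

/-- The change of sign of the spin of the particle `l + 1`. -/
noncomputable def swapSign (l : ℕ) (x : Fin 3 × ℕ) : ℝ := if x = (2, l + 1) then -1 else 1

/-- The exchange of the first `k + 1` particles and of the `l + 1` ones that follow the particle
`k + 1`, whose spin is reversed. -/
noncomputable def swap (k l : ℕ) : Word → Word := reindex (swapIndex k l) (swapSign l)

/-- Exactly one side wins the race. Exchanging the blocks reverses a strict comparison of distances,
and reversing the spin changes the winner of a tie. -/
theorem Good.raceEvent_swap (hw : w.Good) (k l : ℕ) :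
    (w.swap k l).RaceEvent l k ↔ ⌊w (1, k + 1)⌋ = 0 ∧ w.toConfig.FirstArrivalOn 0 k ∧
      (w.shift (k + 2)).toConfig.FirstArrivalOn 0 l ∧ ¬ w.RaceEvent k l := by
  have h1 : AgreeBelow (l + 1) (w.swap k l) (w.shift (k + 2)) := by
    intro c i hi
    have h2 : i ≤ l := by omega
    have h3 : i ≠ l + 1 := by omega
    simp [swap, reindex, swapIndex, swapSign, Word.shift, h2, h3]
  have h2 : AgreeBelow (k + 1) ((w.swap k l).shift (l + 2)) w := by
    intro c i hi
    have h2 : ¬ i + (l + 2) ≤ l := by omega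
    have h3 : ¬ i + (l + 2) = l + 1 := by omega
    have h4 : i + (l + 2) ≤ k + l + 2 := by omega
    simp only [swap, reindex, swapIndex, swapSign, Word.shift, if_neg h2, if_neg h3, if_pos h4,
      Nat.add_sub_cancel]
    simp [h3]
  have h3 : w.swap k l (1, l + 1) = w (1, k + 1) := by
    simp [swap, reindex, swapIndex, swapSign]
  have h4 : w.swap k l (2, l + 1) = -w (2, k + 1) := by
    simp [swap, reindex, swapIndex, swapSign]
  unfold RaceEvent
  rw [h3, h4, h1.firstArrivalOn_iff (Nat.lt_succ_self _),
    h2.firstArrivalOn_iff (Nat.lt_succ_self _),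
    h1.pos_eq (Nat.lt_succ_self _), h2.pos_eq (Nat.lt_succ_self _),
    floor_neg_of_eq_intCast (hw.exists_spin _)]
  have h5 : ⌊w (2, k + 1)⌋ = 1 ∨ ⌊w (2, k + 1)⌋ = -1 := by
    rcases (hw (k + 1)).2.2 with h | h <;> simp [h]
  have h6 : (-⌊w (2, k + 1)⌋ = -1) ↔ ¬ ⌊w (2, k + 1)⌋ = -1 := by omega
  rw [h6]
  rcases lt_trichotomy (w.toConfig.pos k) ((w.shift (k + 2)).toConfig.pos l) with h | h | h
  · simp only [h, h.not_gt, h.ne', false_and, or_self, and_false, true_or, and_true, not_and]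
    tauto
  · simp only [h, lt_irrefl, false_or, true_and]
    tauto
  · simp only [h, h.not_gt, h.ne', false_and, or_self, and_false, true_or, and_true,
      not_false_eq_true]
    tauto

end Word

end BallisticAnnihilation

namespace BallisticAnnihilation

namespace Word

open Config

/-! ### Measurability -/

theorem measurable_pos (n : ℕ) : Measurable fun w : Word => w.toConfig.pos n := by
  simp only [toConfig_pos]
  exact Finset.measurable_sum _ fun i _ => measurable_pi_apply _

theorem measurable_vel (n : ℕ) : Measurable fun w : Word => w.toConfig.vel n :=
  Int.measurable_floor.comp (measurable_pi_apply _)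

theorem measurable_spin (n : ℕ) : Measurable fun w : Word => w.toConfig.spin n :=
  Int.measurable_floor.comp (measurable_pi_apply _)

theorem measurable_floor_eq (c : Fin 3) (n : ℕ) (z : ℤ) :
    Measurable fun w : Word => ⌊w (c, n)⌋ = z := by
  have h : Measurable fun w : Word => ⌊w (c, n)⌋ :=
    Int.measurable_floor.comp (measurable_pi_apply _)
  exact measurableSet_setOfPred.1 (measurableSet_eq_fun h measurable_const)

theorem measurable_meetingTime (i j : ℕ) :
    Measurable fun w : Word => w.toConfig.meetingTime i j := by
  unfold meetingTime
  have hv : ∀ n, Measurable fun w : Word => (w.toConfig.vel n : ℝ) := fun n =>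
    (measurable_of_countable _).comp (measurable_vel n)
  exact ((measurable_pos j).sub (measurable_pos i)).div ((hv i).sub (hv j))

/-- The discrete data that determine the annihilations among the first `N` particles. -/
noncomputable def orderType (N : ℕ) (w : Word) :
    (Fin N → ℤ) × (Fin N → ℤ) × (Fin N → Fin N → Prop) ×
    (Fin N → Fin N → Fin N → Fin N → Prop) :=
  (fun i => w.toConfig.vel i, fun i => w.toConfig.spin i,
    fun i j => 0 ≤ w.toConfig.meetingTime i j,
    fun i j k l => w.toConfig.meetingTime i j ≤ w.toConfig.meetingTime k l)

theorem measurable_orderType (N : ℕ) : Measurable (orderType N) := by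
  refine .prodMk (measurable_pi_lambda _ fun i => measurable_vel i)
    (.prodMk (measurable_pi_lambda _ fun i => measurable_spin i) (.prodMk ?_ ?_))
  · refine measurable_pi_lambda _ fun i => measurable_pi_lambda _ fun j => ?_
    exact measurableSet_setOfPred.1 (measurableSet_le measurable_const (measurable_meetingTime i j))
  · refine measurable_pi_lambda _ fun i => measurable_pi_lambda _ fun j =>
      measurable_pi_lambda _ fun k => measurable_pi_lambda _ fun l => ?_
    exact measurableSet_setOfPred.1
      (measurableSet_le (measurable_meetingTime i j) (measurable_meetingTime k l))

/-- By `AnnihilateOn.of_order` the event is a function of `orderType N`, a measurable map into a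
discrete space. -/
theorem measurable_exists_annihilateOn {S : Set ℕ} {N : ℕ} (hS : ∀ i ∈ S, i < N) (i j : ℕ) :
    Measurable fun w : Word => ∃ t, w.toConfig.AnnihilateOn S i j t := by
  have key : ∀ w w' : Word, orderType N w = orderType N w' →
      (∃ t, w.toConfig.AnnihilateOn S i j t) → ∃ t, w'.toConfig.AnnihilateOn S i j t := by
    rintro w w' h ⟨t, ht⟩
    simp only [orderType, Prod.mk.injEq, funext_iff, eq_iff_iff] at h
    obtain ⟨h1, h2, h3, h4⟩ := h
    exact ⟨_, ht.of_order (fun i hi => (h1 ⟨i, hS i hi⟩).symm) (fun i hi => (h2 ⟨i, hS i hi⟩).symm)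
      (fun i hi j hj => (h3 ⟨i, hS i hi⟩ ⟨j, hS j hj⟩).symm)
      (fun i hi j hj k hk l hl =>
        (h4 ⟨i, hS i hi⟩ ⟨j, hS j hj⟩ ⟨k, hS k hk⟩ ⟨l, hS l hl⟩).symm)⟩
  have h : (fun w : Word => ∃ t, w.toConfig.AnnihilateOn S i j t) =
      (fun y => ∃ w, orderType N w = y ∧ ∃ t, w.toConfig.AnnihilateOn S i j t) ∘ orderType N := by
    funext w
    exact propext ⟨fun h => ⟨w, rfl, h⟩, fun ⟨w', h1, h2⟩ => key w' w h1 h2⟩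
  rw [h]
  exact Measurable.of_discrete.comp (measurable_orderType N)

theorem measurable_firstArrivalOn (a n : ℕ) :
    Measurable fun w : Word => w.toConfig.FirstArrivalOn a n := by
  have h : ∀ w : Word, w.toConfig.FirstArrivalOn a n ↔ a ≤ n ∧ ⌊w (1, n)⌋ = -1 ∧
      ∀ j, a ≤ j → j < n → ∃ p, p ≠ n ∧ ∃ d, w.toConfig.AnnihilateOn (Icc a n) j p d := by
    intro w
    simp only [FirstArrivalOn, toConfig_vel, exists_and_left]
  simp only [h]
  refine measurable_const.and ((measurable_floor_eq 1 n _).and (Measurable.forall fun j =>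
    measurable_const.imp (measurable_const.imp (Measurable.exists fun p =>
      measurable_const.and ?_))))
  exact measurable_exists_annihilateOn (N := n + 1) (fun i hi => Nat.lt_succ_of_le hi.2) j p

theorem measurable_endsAnnihilate (a n : ℕ) :
    Measurable fun w : Word => w.toConfig.EndsAnnihilate a n :=
  measurable_exists_annihilateOn (N := n + 1) (fun _ hi => Nat.lt_succ_of_le hi.2) a n

theorem measurable_shift (a : ℕ) : Measurable (shift a) :=
  measurable_pi_lambda _ fun _ => measurable_pi_apply _

theorem measurable_releaseEvent (i j : ℕ) : Measurable (ReleaseEvent i j) := by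
  refine (measurable_floor_eq 1 _ _).and ((measurable_endsAnnihilate _ _).and
    ((measurable_firstArrivalOn _ _).and (.or ?_ (.and ?_ (measurable_floor_eq 2 _ _)))))
  · exact measurableSet_setOfPred.1 (measurableSet_lt ((measurable_pos _).sub (measurable_pos _))
      ((measurable_pos _).sub (measurable_pos _)))
  · exact measurableSet_setOfPred.1 (measurableSet_eq_fun
      ((measurable_pos _).sub (measurable_pos _)) ((measurable_pos _).sub (measurable_pos _)))

theorem measurable_raceEvent (i j : ℕ) : Measurable (RaceEvent i j) := by
  have h := (measurable_pos j).comp (measurable_shift (i + 2))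
  refine (measurable_floor_eq 1 _ _).and ((measurable_firstArrivalOn _ _).and
    (((measurable_firstArrivalOn 0 j).comp (measurable_shift (i + 2))).and
    (.or ?_ (.and ?_ (measurable_floor_eq 2 _ _)))))
  · exact measurableSet_setOfPred.1 (measurableSet_lt (measurable_pos _) h)
  · exact measurableSet_setOfPred.1 (measurableSet_eq_fun (measurable_pos _) h)

/-! ### The law of a word with independent letters -/

/-- The law of a velocity. -/
noncomputable def velLaw (p : ℝ) : Measure ℝ :=
  ENNReal.ofReal p • Measure.dirac 0 +
    ENNReal.ofReal ((1 - p) / 2) • (Measure.dirac 1 + Measure.dirac (-1))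

/-- The law of a spin. -/
noncomputable def spinLaw : Measure ℝ :=
  ENNReal.ofReal (1 / 2) • (Measure.dirac 1 + Measure.dirac (-1))

/-- The laws of the interdistances, of the velocities and of the spins. -/
noncomputable def letterLaw (p : ℝ) (m : Measure ℝ) (c : Fin 3) : Measure ℝ :=
  if c = 0 then m else if c = 1 then velLaw p else spinLaw

theorem isProbabilityMeasure_velLaw {p : ℝ} (hp : p ∈ Icc (0 : ℝ) 1) :
    IsProbabilityMeasure (velLaw p) := by
  constructor
  have h : 0 ≤ (1 - p) / 2 := by linarith [hp.2]
  simp only [velLaw, Measure.add_apply, Measure.smul_apply, measure_univ, smul_eq_mul, mul_one,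
    mul_add]
  rw [← ENNReal.ofReal_add h h, ← ENNReal.ofReal_add hp.1 (by linarith)]
  rw [show p + ((1 - p) / 2 + (1 - p) / 2) = 1 by ring, ENNReal.ofReal_one]

instance : IsProbabilityMeasure spinLaw := by
  constructor
  simp only [spinLaw, Measure.add_apply, Measure.smul_apply, measure_univ, smul_eq_mul, mul_one,
    mul_add]
  rw [← ENNReal.ofReal_add (by norm_num) (by norm_num)]
  norm_num

theorem isProbabilityMeasure_letterLaw {p : ℝ} (hp : p ∈ Icc (0 : ℝ) 1) (m : Measure ℝ)
    [IsProbabilityMeasure m] (c : Fin 3) : IsProbabilityMeasure (letterLaw p m c) := by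
  unfold letterLaw
  have := isProbabilityMeasure_velLaw hp
  split_ifs <;> infer_instance

theorem letterLaw_map_neg (p : ℝ) (m : Measure ℝ) {c : Fin 3} (hc : c ≠ 0) :
    (letterLaw p m c).map (fun x => -x) = letterLaw p m c := by
  have hm : Measurable fun x : ℝ => -x := measurable_neg
  unfold letterLaw
  rw [if_neg hc]
  split_ifs
  · simp only [velLaw, Measure.map_add _ _ hm, Measure.map_smul, Measure.map_dirac' hm, neg_zero,
      neg_neg]
    rw [add_comm (Measure.dirac (-1))]
  · simp only [spinLaw, Measure.map_add _ _ hm, Measure.map_smul, Measure.map_dirac' hm, neg_neg]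
    rw [add_comm (Measure.dirac (-1))]

/-- The law of a word with independent letters. -/
noncomputable def wordLaw (p : ℝ) (m : Measure ℝ) : Measure Word :=
  Measure.infinitePi fun x : Fin 3 × ℕ => letterLaw p m x.1

variable {p : ℝ} {m : Measure ℝ}

theorem isProbabilityMeasure_wordLaw (hp : p ∈ Icc (0 : ℝ) 1) [IsProbabilityMeasure m] :
    IsProbabilityMeasure (wordLaw p m) := by
  have := isProbabilityMeasure_letterLaw hp m
  unfold wordLaw
  infer_instance

/-- The letters are independent, those of one kind have the same law, and the laws of velocities and
spins are symmetric. Hence an injection of indices that respects the kinds, with signs on velocities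
and spins only, preserves the law. -/
theorem measurePreserving_reindex (hp : p ∈ Icc (0 : ℝ) 1) [IsProbabilityMeasure m]
    {σ : Fin 3 × ℕ → Fin 3 × ℕ} {ε : Fin 3 × ℕ → ℝ} (hσ : Function.Injective σ)
    (hσ1 : ∀ x, (σ x).1 = x.1) (hε : ∀ x, ε x = 1 ∨ ε x = -1 ∧ x.1 ≠ 0) :
    MeasurePreserving (reindex σ ε) (wordLaw p m) (wordLaw p m) := by
  have := isProbabilityMeasure_letterLaw hp m
  have hmul : ∀ x, Measurable fun y : ℝ => ε x * y := fun x => measurable_const_mul _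
  have hmeas : Measurable fun (w : Word) x => ε x * w x :=
    measurable_pi_lambda _ fun x => (hmul x).comp (measurable_pi_apply x)
  have hmeas' : Measurable fun (w : Word) x => w (σ x) :=
    measurable_pi_lambda _ fun x => measurable_pi_apply _
  refine ⟨hmeas.comp hmeas', ?_⟩
  have h1 : (wordLaw p m).map (fun w x => w (σ x)) = wordLaw p m := by
    unfold wordLaw
    rw [Measure.map_infinitePi_infinitePi_of_inj hσ]
    simp only [hσ1]
  have h2 : (wordLaw p m).map (fun w x => ε x * w x) = wordLaw p m := by
    unfold wordLaw
    rw [Measure.infinitePi_map_pi _ hmul]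
    congr 1
    funext x
    rcases hε x with h | ⟨h, hx⟩
    · simp [h]
    · simp only [h, neg_one_mul]
      exact letterLaw_map_neg p m hx
  rw [show reindex σ ε = (fun (w : Word) x => ε x * w x) ∘ fun w x => w (σ x) from rfl,
    ← Measure.map_map hmeas hmeas', h1, h2]

theorem measurePreserving_reflect (hp : p ∈ Icc (0 : ℝ) 1) [IsProbabilityMeasure m] (k : ℕ) :
    MeasurePreserving (reflect k) (wordLaw p m) (wordLaw p m) := by
  refine measurePreserving_reindex hp ?_ (fun _ => rfl) ?_
  · rintro ⟨c, i⟩ ⟨c', i'⟩ h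
    simp only [reflectIndex, Prod.mk.injEq] at h
    obtain ⟨rfl, h⟩ := h
    refine Prod.ext rfl ?_
    simp only
    split_ifs at h <;> omega
  · intro x
    unfold reflectSign
    split_ifs with h
    · exact Or.inr ⟨rfl, h.1⟩
    · exact Or.inl rfl

theorem measurePreserving_swap (hp : p ∈ Icc (0 : ℝ) 1) [IsProbabilityMeasure m] (k l : ℕ) :
    MeasurePreserving (swap k l) (wordLaw p m) (wordLaw p m) := by
  refine measurePreserving_reindex hp ?_ (fun _ => rfl) ?_
  · rintro ⟨c, i⟩ ⟨c', i'⟩ h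
    simp only [swapIndex, Prod.mk.injEq] at h
    obtain ⟨rfl, h⟩ := h
    refine Prod.ext rfl ?_
    simp only
    split_ifs at h <;> omega
  · intro x
    unfold swapSign
    split_ifs with h
    · exact Or.inr ⟨rfl, by simp [h]⟩
    · exact Or.inl rfl

/-- The word whose first `N` letters are those of `z.1` and are followed by `z.2`. -/
def merge (N : ℕ) (z : Word × Word) : Word :=
  fun x => if x.2 < N then z.1 x else z.2 (x.1, x.2 - N)

theorem measurable_merge (N : ℕ) : Measurable (merge N) := by
  refine measurable_pi_lambda _ fun x => ?_
  unfold merge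
  split_ifs
  · exact (measurable_pi_apply _).comp measurable_fst
  · exact (measurable_pi_apply _).comp measurable_snd

/-- Gluing the beginning of one word to an independent word gives a word of the same law; this is
checked on finite cylinders and yields the independence of a prefix and the rest. -/
theorem measurePreserving_merge (hp : p ∈ Icc (0 : ℝ) 1) [IsProbabilityMeasure m] (N : ℕ) :
    MeasurePreserving (merge N) ((wordLaw p m).prod (wordLaw p m)) (wordLaw p m) := by
  classical
  have := isProbabilityMeasure_letterLaw hp m
  have := isProbabilityMeasure_wordLaw hp (m := m)
  refine ⟨measurable_merge N, ?_⟩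
  conv_rhs => unfold wordLaw
  refine Measure.eq_infinitePi _ fun s t ht => ?_
  rw [Measure.map_apply (measurable_merge N) (MeasurableSet.pi s.countable_toSet fun i _ => ht i)]
  set f : Fin 3 × ℕ → Fin 3 × ℕ := fun x => (x.1, x.2 - N) with hf
  set s1 := s.filter fun x => x.2 < N with hs1
  set s2 := (s.filter fun x => ¬ x.2 < N).image f with hs2
  have hset : merge N ⁻¹' (s : Set (Fin 3 × ℕ)).pi t = ((s1 : Set (Fin 3 × ℕ)).pi t) ×ˢ
      ((s2 : Set (Fin 3 × ℕ)).pi fun x => t (x.1, x.2 + N)) := by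
    ext z
    simp only [mem_preimage, Set.mem_pi, mem_prod, Finset.mem_coe, hs1, hs2, Finset.mem_image,
      Finset.mem_filter, merge]
    constructor
    · intro h
      refine ⟨fun x hx => by simpa [hx.2] using h x hx.1, ?_⟩
      rintro _ ⟨x, hx, rfl⟩
      have h3 := h x hx.1
      rw [if_neg hx.2] at h3
      have h4 : x.2 - N + N = x.2 := by omega
      simpa [hf, h4] using h3
    · rintro ⟨h1, h2⟩ x hx
      split_ifs with hN
      · exact h1 x ⟨hx, hN⟩
      · have h3 := h2 (f x) ⟨x, ⟨hx, hN⟩, rfl⟩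
        have h4 : x.2 - N + N = x.2 := by omega
        simpa [hf, h4] using h3
  rw [hset, Measure.prod_prod]
  unfold wordLaw
  rw [Measure.infinitePi_pi _ (fun i _ => ht i), Measure.infinitePi_pi _ (fun i _ => ht _),
    hs2, Finset.prod_image, hs1, ← Finset.prod_filter_mul_prod_filter_not s (fun x => x.2 < N)]
  · congr 1
    refine Finset.prod_congr rfl fun x hx => ?_
    have h4 : x.2 - N + N = x.2 := by
      have := (Finset.mem_filter.1 hx).2
      omega
    simp [hf, h4]
  · intro x hx y hy h
    have h1 := (Finset.mem_filter.1 hx).2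
    have h2 := (Finset.mem_filter.1 hy).2
    simp only [hf, Prod.mk.injEq] at h
    exact Prod.ext h.1 (by omega)

/-- Independence of the first `N` letters and of the following ones. -/
theorem wordLaw_and_shift (hp : p ∈ Icc (0 : ℝ) 1) [IsProbabilityMeasure m] {N : ℕ}
    {E F : Word → Prop} (hE : Measurable E) (hF : Measurable F)
    (hN : ∀ w w', AgreeBelow N w w' → (E w ↔ E w')) :
    (wordLaw p m).real {w | E w ∧ F (w.shift N)} =
      (wordLaw p m).real {w | E w} * (wordLaw p m).real {w | F w} := by
  have := isProbabilityMeasure_wordLaw hp (m := m)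
  have hmeas : MeasurableSet {w | E w ∧ F (w.shift N)} :=
    measurableSet_setOfPred.2 (hE.and (hF.comp (measurable_shift N)))
  simp only [measureReal_def]
  rw [← (measurePreserving_merge hp N).measure_preimage hmeas.nullMeasurableSet]
  have hset : merge N ⁻¹' {w | E w ∧ F (w.shift N)} = {w | E w} ×ˢ {w | F w} := by
    ext z
    simp only [mem_preimage, mem_ofPred_eq, mem_prod]
    refine and_congr (hN _ _ fun c i hi => by simp [merge, hi]) ?_
    have : (merge N z).shift N = z.2 := by
      funext x
      simp [merge, shift]
    rw [this]
  rw [hset, Measure.prod_prod, ENNReal.toReal_mul]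

theorem wordLaw_apply (hp : p ∈ Icc (0 : ℝ) 1) [IsProbabilityMeasure m] (x : Fin 3 × ℕ) {B : Set ℝ}
    (hB : MeasurableSet B) : wordLaw p m {w | w x ∈ B} = letterLaw p m x.1 B := by
  have := isProbabilityMeasure_letterLaw hp m
  have h := measurePreserving_eval_infinitePi (fun x : Fin 3 × ℕ => letterLaw p m x.1) x
  exact h.measure_preimage hB.nullMeasurableSet

theorem velLaw_real (hp : p ∈ Icc (0 : ℝ) 1) (z : ℤ) : (velLaw p).real {x | ⌊x⌋ = z} =
    (if z = 0 then p else 0) + ((if z = 1 then (1 - p) / 2 else 0) +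
      (if z = -1 then (1 - p) / 2 else 0)) := by
  have hB : MeasurableSet {x : ℝ | ⌊x⌋ = z} :=
    measurableSet_eq_fun Int.measurable_floor measurable_const
  have h : 0 ≤ (1 - p) / 2 := by linarith [hp.2]
  unfold velLaw
  rw [measureReal_def, Measure.add_apply, Measure.smul_apply, Measure.smul_apply, Measure.add_apply,
    Measure.dirac_apply' _ hB, Measure.dirac_apply' _ hB, Measure.dirac_apply' _ hB]
  simp only [indicator_apply, mem_ofPred_eq, Int.floor_zero, Int.floor_one, floor_neg_one,
    Pi.one_apply, smul_eq_mul, eq_comm (b := z)]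
  by_cases h0 : z = 0
  · subst h0; simp [ENNReal.toReal_ofReal hp.1]
  by_cases h1 : z = 1
  · subst h1; simp [ENNReal.toReal_ofReal h]
  by_cases h2 : z = -1
  · subst h2; simp [ENNReal.toReal_ofReal h]
  simp [h0, h1, h2]

theorem wordLaw_vel (hp : p ∈ Icc (0 : ℝ) 1) [IsProbabilityMeasure m] (n : ℕ) (z : ℤ) :
    (wordLaw p m).real {w | ⌊w (1, n)⌋ = z} = (if z = 0 then p else 0) +
      ((if z = 1 then (1 - p) / 2 else 0) + (if z = -1 then (1 - p) / 2 else 0)) := by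
  have hB : MeasurableSet {x : ℝ | ⌊x⌋ = z} :=
    measurableSet_eq_fun Int.measurable_floor measurable_const
  rw [← velLaw_real hp z, measureReal_def, measureReal_def]
  exact congrArg _ (wordLaw_apply hp (1, n) hB)

theorem ae_good (hp : p ∈ Icc (0 : ℝ) 1) [IsProbabilityMeasure m] (hm : m (Iic 0) = 0) :
    ∀ᵐ w ∂wordLaw p m, Good w := by
  refine ae_all_iff.2 fun n => ?_
  have key : ∀ c : Fin 3, ∀ B : Set ℝ, MeasurableSet B → letterLaw p m c Bᶜ = 0 →
      ∀ᵐ w ∂wordLaw p m, w (c, n) ∈ B := by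
    intro c B hB h
    have := wordLaw_apply hp (m := m) (c, n) hB.compl
    rw [h] at this
    exact this
  have h0 := key 0 (Ioi 0) measurableSet_Ioi (by simpa [letterLaw] using hm)
  have h1 := key 1 {-1, 0, 1} (by measurability) (by
    simp only [letterLaw, velLaw, one_ne_zero, if_false, if_true]
    simp)
  have h2 := key 2 {1, -1} (by measurability) (by
    simp [letterLaw, spinLaw])
  filter_upwards [h0, h1, h2] with w a b c
  exact ⟨a, by simpa using b, by simpa using c⟩

end Word

end BallisticAnnihilation

/-! ### The three relations between the probabilities of arrival, facing and release. -/

namespace BallisticAnnihilation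

/-- Additivity over a finite partition up to null sets, which suits case distinctions valid for
`Good` words only. -/
theorem measureReal_eq_sum {Ω ι : Type*} [MeasurableSpace Ω] {μ : Measure Ω} [IsFiniteMeasure μ]
    (s : Finset ι) {E : Ω → Prop} {F : ι → Ω → Prop} (hF : ∀ i ∈ s, Measurable (F i))
    (h : ∀ᵐ w ∂μ, (E w ↔ ∃ i ∈ s, F i w))
    (hd : ∀ᵐ w ∂μ, ∀ i ∈ s, ∀ j ∈ s, F i w → F j w → i = j) :
    μ.real {w | E w} = ∑ i ∈ s, μ.real {w | F i w} := by
  have h1 : {w | E w} =ᵐ[μ] ⋃ i ∈ s, {w | F i w} := by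
    filter_upwards [h] with w hw
    refine propext (Iff.trans hw ?_)
    change _ ↔ w ∈ ⋃ i ∈ s, {w | F i w}
    simp
  simp only [measureReal_def]
  rw [measure_congr h1, measure_biUnion_finset₀,
    ENNReal.toReal_sum fun i _ => measure_ne_top _ _]
  · intro i hi j hj hij
    simp only [Function.onFun, AEDisjoint]
    rw [measure_eq_zero_iff_ae_notMem]
    filter_upwards [hd] with w hw hw'
    exact hij (hw i hi j hj hw'.1 hw'.2)
  · exact fun i hi => (measurableSet_setOfPred.2 (hF i hi)).nullMeasurableSet

namespace Word

open Config

variable {p : ℝ} {m : Measure ℝ}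

/-- The probability that the first arrival at `0` is that of the particle `k`. -/
noncomputable def arrivalProb (p : ℝ) (m : Measure ℝ) (k : ℕ) : ℝ :=
  (wordLaw p m).real {w | w.toConfig.FirstArrivalOn 0 k}

/-- The first particle and the particle `k + 1` move towards each other and annihilate. -/
def FaceEvent (k : ℕ) (w : Word) : Prop :=
  ⌊w (1, 0)⌋ = 1 ∧ ⌊w (1, k + 1)⌋ = -1 ∧ w.toConfig.EndsAnnihilate 0 (k + 1)

/-- The probability of `FaceEvent`. -/
noncomputable def faceProb (p : ℝ) (m : Measure ℝ) (k : ℕ) : ℝ :=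
  (wordLaw p m).real {w | w.FaceEvent k}

/-- The probability of `ReleaseEvent`. -/
noncomputable def releaseProb (p : ℝ) (m : Measure ℝ) (i j : ℕ) : ℝ :=
  (wordLaw p m).real {w | w.ReleaseEvent i j}

theorem measurable_faceEvent (k : ℕ) : Measurable (FaceEvent k) :=
  (measurable_floor_eq 1 _ _).and ((measurable_floor_eq 1 _ _).and (measurable_endsAnnihilate _ _))

theorem measurable_firstArrivalOn_shift (a n : ℕ) :
    Measurable fun w : Word => (w.shift a).toConfig.FirstArrivalOn 0 n :=
  (measurable_firstArrivalOn 0 n).comp (measurable_shift a)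

theorem Good.vel_cases {w : Word} (hw : w.Good) (n : ℕ) :
    ⌊w (1, n)⌋ = -1 ∨ ⌊w (1, n)⌋ = 0 ∨ ⌊w (1, n)⌋ = 1 := by
  rcases (hw n).2.1 with h | h | h <;> simp [h]

theorem Good.vel_lt_of_ends {w : Word} (hw : w.Good) {k : ℕ}
    (h : w.toConfig.EndsAnnihilate 0 (k + 1)) : ⌊w (1, k + 1)⌋ < ⌊w (1, 0)⌋ := by
  obtain ⟨t, h⟩ := h
  exact hw.regular.vel_lt_of_annihilateOn h (Nat.succ_pos k)

/-- After reflection both release events are races. After the exchange of blocks, the race for `(l,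
k)` is the complement of the race for `(k, l)` within the event that `k + 1` is static with first
arrivals of indices `k` and `l` on its sides. That event has probability pα_kα_l by independence. -/
theorem raceProb_add (hp : p ∈ Icc (0 : ℝ) 1) [IsProbabilityMeasure m] (hm : m (Iic 0) = 0)
    (k l : ℕ) : releaseProb p m k l + releaseProb p m l k =
      p * arrivalProb p m k * arrivalProb p m l := by
  have := isProbabilityMeasure_wordLaw hp (m := m)
  have hrace : ∀ i j, releaseProb p m i j = (wordLaw p m).real {w | w.RaceEvent i j} := by
    intro i j
    unfold releaseProb
    simp only [measureReal_def]
    rw [← (measurePreserving_reflect hp i).measure_preimage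
      (measurableSet_setOfPred.2 (measurable_releaseEvent i j)).nullMeasurableSet]
    congr 1
    apply measure_congr
    filter_upwards [ae_good hp hm] with w hw
    exact propext (hw.releaseEvent_reflect i j)
  have hswap : releaseProb p m l k = (wordLaw p m).real {w | ⌊w (1, k + 1)⌋ = 0 ∧
      w.toConfig.FirstArrivalOn 0 k ∧ (w.shift (k + 2)).toConfig.FirstArrivalOn 0 l ∧
        ¬ w.RaceEvent k l} := by
    rw [hrace]
    simp only [measureReal_def]
    rw [← (measurePreserving_swap hp k l).measure_preimage
      (measurableSet_setOfPred.2 (measurable_raceEvent l k)).nullMeasurableSet]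
    congr 1
    apply measure_congr
    filter_upwards [ae_good hp hm] with w hw
    exact propext (hw.raceEvent_swap k l)
  have hall : (wordLaw p m).real {w | (w.toConfig.FirstArrivalOn 0 k ∧ ⌊w (1, k + 1)⌋ = 0) ∧
      (w.shift (k + 2)).toConfig.FirstArrivalOn 0 l} =
        p * arrivalProb p m k * arrivalProb p m l := by
    rw [wordLaw_and_shift hp (N := k + 2)
      (E := fun w : Word => w.toConfig.FirstArrivalOn 0 k ∧ ⌊w (1, k + 1)⌋ = 0)
      (F := fun w : Word => w.toConfig.FirstArrivalOn 0 l)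
      ((measurable_firstArrivalOn 0 k).and (measurable_floor_eq 1 _ 0))
      (measurable_firstArrivalOn 0 l)
      (fun w w' h => by rw [h.firstArrivalOn_iff (by omega), h 1 (k + 1) (by omega)])]
    have h1 := wordLaw_and_shift hp (m := m) (N := k + 1)
      (E := fun w : Word => w.toConfig.FirstArrivalOn 0 k)
      (F := fun w : Word => ⌊w (1, 0)⌋ = 0) (measurable_firstArrivalOn 0 k)
      (measurable_floor_eq 1 _ 0) (fun w w' h => h.firstArrivalOn_iff (by omega) 0)
    simp only [Word.shift, zero_add] at h1
    rw [h1, wordLaw_vel hp]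
    unfold arrivalProb
    rw [if_pos rfl, if_neg (by decide), if_neg (by decide)]
    ring
  rw [hrace k l, hswap, ← hall]
  have h2 := measureReal_eq_sum (μ := wordLaw p m) Finset.univ
    (E := fun w : Word => (w.toConfig.FirstArrivalOn 0 k ∧ ⌊w (1, k + 1)⌋ = 0) ∧
      (w.shift (k + 2)).toConfig.FirstArrivalOn 0 l)
    (F := ![fun w : Word => w.RaceEvent k l, fun w : Word => ⌊w (1, k + 1)⌋ = 0 ∧
      w.toConfig.FirstArrivalOn 0 k ∧ (w.shift (k + 2)).toConfig.FirstArrivalOn 0 l ∧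
        ¬ w.RaceEvent k l])
    ?_ (Filter.Eventually.of_forall fun w => ?_) (Filter.Eventually.of_forall fun w => ?_)
  · rw [h2, Fin.sum_univ_two]
    rfl
  · intro i _
    fin_cases i
    · exact measurable_raceEvent k l
    · exact (measurable_floor_eq 1 _ _).and ((measurable_firstArrivalOn _ _).and
        ((measurable_firstArrivalOn_shift _ _).and (measurable_raceEvent k l).not))
  · simp only [Finset.mem_univ, true_and, Fin.exists_fin_two, Matrix.cons_val_zero,
      Matrix.cons_val_one]
    unfold RaceEvent
    tauto
  · intro i _ j _
    fin_cases i <;> fin_cases j <;> (simp; try tauto)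

theorem arrivalProb_zero (hp : p ∈ Icc (0 : ℝ) 1) [IsProbabilityMeasure m] :
    arrivalProb p m 0 = (1 - p) / 2 := by
  have h : ∀ w : Word, w.toConfig.FirstArrivalOn 0 0 ↔ ⌊w (1, 0)⌋ = -1 := by
    intro w
    simp [FirstArrivalOn]
  unfold arrivalProb
  simp only [h]
  rw [wordLaw_vel hp]
  simp

/-- For the second particle to arrive first, the first one would need a partner strictly between
them. -/
theorem arrivalProb_one [IsProbabilityMeasure m] (hp : p ∈ Icc (0 : ℝ) 1) (hm : m (Iic 0) = 0) :
    arrivalProb p m 1 = 0 := by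
  unfold arrivalProb
  rw [measureReal_def, ENNReal.toReal_eq_zero_iff]
  left
  rw [measure_eq_zero_iff_ae_notMem]
  filter_upwards [ae_good hp hm] with w hw h
  obtain ⟨j, t, h1⟩ := Regular.exists_annihilateOn_first h one_pos
  have h2 := Regular.lt_of_ends h1 rfl
  have h3 := (hw.regular.ends_of_firstArrivalOn h h1).2.1.1
  omega

/-- The event that `0` is annihilated by `i + 1` and that the first arrival after that is that of
`i + j + 2`. -/
def StepEvent (i j : ℕ) (w : Word) : Prop :=
  w.toConfig.EndsAnnihilate 0 (i + 1) ∧ w.toConfig.FirstArrivalOn (i + 2) (j + (i + 2)) ∧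
    (⌊w (1, i + 1)⌋ = 0 → w.toConfig.Sooner 0 (i + 1) (j + (i + 2)))

theorem measurable_stepEvent (i j : ℕ) : Measurable (StepEvent i j) := by
  have h : StepEvent i j = fun w => w.toConfig.EndsAnnihilate 0 (i + 1) ∧
      w.toConfig.FirstArrivalOn (i + 2) (j + (i + 2)) ∧
      (⌊w (1, i + 1)⌋ = 0 → w.ReleaseEvent i j) := by
    funext w
    unfold StepEvent ReleaseEvent
    refine propext (and_congr_right fun h1 => and_congr_right fun h2 => ?_)
    exact ⟨fun h h0 => ⟨h0, h1, h2, h h0⟩, fun h h0 => (h h0).2.2.2⟩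
  rw [h]
  exact (measurable_endsAnnihilate _ _).and ((measurable_firstArrivalOn _ _).and
    ((measurable_floor_eq 1 _ _).imp (measurable_releaseEvent _ _)))

theorem arrivalProb_eq_sum_step [IsProbabilityMeasure m] (hp : p ∈ Icc (0 : ℝ) 1)
    (hm : m (Iic 0) = 0) (s : ℕ) : arrivalProb p m (s + 2) =
      ∑ x ∈ Finset.HasAntidiagonal.antidiagonal s,
        (wordLaw p m).real {w | w.StepEvent x.1 x.2} := by
  have := isProbabilityMeasure_wordLaw hp (m := m)
  refine measureReal_eq_sum _ (F := fun x : ℕ × ℕ => StepEvent x.1 x.2)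
    (fun x _ => measurable_stepEvent _ _) ?_ ?_
  · filter_upwards [ae_good hp hm] with w hw
    constructor
    · intro h
      obtain ⟨j, t, h1⟩ := Regular.exists_annihilateOn_first h (Nat.succ_pos _)
      obtain ⟨i, rfl⟩ : ∃ i, j = i + 1 := ⟨j - 1, by have := Regular.lt_of_ends h1 rfl; omega⟩
      obtain ⟨h2, h3, h4⟩ := hw.regular.ends_of_firstArrivalOn h h1
      have h5 := h3.1
      obtain ⟨j, rfl⟩ : ∃ j, s = j + i := ⟨s - i, by omega⟩
      exact ⟨(i, j), by simp [add_comm], h2, h3, h4⟩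
    · rintro ⟨⟨i, j⟩, hij, h1, h2, h3⟩
      obtain rfl : i + j = s := by simpa using hij
      have h4 := (hw.regular.firstArrivalOn_of_ends h1 h2 h3).1
      rwa [show i + j + 2 = j + (i + 2) by ring]
  · filter_upwards [ae_good hp hm] with w hw
    rintro ⟨i, j⟩ hij ⟨i', j'⟩ hij' ⟨h1, h2, h3⟩ ⟨h1', h2', h3'⟩
    obtain rfl : i + j = s := by simpa using hij
    have hij' : i' + j' = i + j := by simpa using hij'
    obtain ⟨t, h4⟩ := (hw.regular.firstArrivalOn_of_ends h1 h2 h3).2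
    obtain ⟨t', h4'⟩ := (hw.regular.firstArrivalOn_of_ends h1' h2' h3').2
    simp only at h4 h4'
    rw [show j' + (i' + 2) = j + (i + 2) by omega] at h4'
    have h5 := (hw.regular.partner_unique h4 h4').1
    simp only [Prod.mk.injEq]
    omega

/-- The velocities of `0` and `i + 1` are decreasing, so they are `(0, -1)`, `(1, -1)` or `(1, 0)`.
In the first case the static `0` waits for the arrival of `i + 1`, and the prefix splits off as
independent pieces; the third case is the release event. -/
theorem stepEvent_prob [IsProbabilityMeasure m] (hp : p ∈ Icc (0 : ℝ) 1)
    (hm : m (Iic 0) = 0) (i j : ℕ) : (wordLaw p m).real {w | w.StepEvent i j} =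
      p * arrivalProb p m i * arrivalProb p m j + faceProb p m i * arrivalProb p m j +
        releaseProb p m i j := by
  have := isProbabilityMeasure_wordLaw hp (m := m)
  have h2 := measureReal_eq_sum (μ := wordLaw p m) Finset.univ
    (E := fun w : Word => w.StepEvent i j)
    (F := ![fun w : Word => ⌊w (1, 0)⌋ = 0 ∧ ((w.shift 1).toConfig.FirstArrivalOn 0 i ∧
        ((w.shift 1).shift (i + 1)).toConfig.FirstArrivalOn 0 j),
      fun w : Word => w.FaceEvent i ∧ (w.shift (i + 2)).toConfig.FirstArrivalOn 0 j,
      fun w : Word => w.ReleaseEvent i j])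
    ?_ ?_ ?_
  · rw [h2, Fin.sum_univ_three]
    refine congrArg₂ _ (congrArg₂ _ ?_ ?_) rfl
    · have h3 := wordLaw_and_shift hp (m := m) (N := 1) (E := fun w : Word => ⌊w (1, 0)⌋ = 0)
        (F := fun w : Word => w.toConfig.FirstArrivalOn 0 i ∧
          (w.shift (i + 1)).toConfig.FirstArrivalOn 0 j) (measurable_floor_eq 1 _ 0)
        ((measurable_firstArrivalOn 0 i).and (measurable_firstArrivalOn_shift _ _))
        (fun w w' h => by rw [h 1 0 one_pos])
      refine h3.trans ?_
      rw [wordLaw_and_shift hp (m := m) (N := i + 1)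
        (E := fun w : Word => w.toConfig.FirstArrivalOn 0 i)
        (F := fun w : Word => w.toConfig.FirstArrivalOn 0 j) (measurable_firstArrivalOn 0 i)
        (measurable_firstArrivalOn 0 j) (fun w w' h => h.firstArrivalOn_iff (by omega) 0),
        wordLaw_vel hp]
      unfold arrivalProb
      simp
      ring
    · exact wordLaw_and_shift hp (m := m) (N := i + 2) (E := FaceEvent i)
        (F := fun w : Word => w.toConfig.FirstArrivalOn 0 j) (measurable_faceEvent i)
        (measurable_firstArrivalOn 0 j) (fun w w' h => by
          unfold FaceEvent
          rw [h 1 0 (by omega), h 1 (i + 1) (by omega), h.endsAnnihilate_iff (by omega)])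
  · intro i' _
    fin_cases i'
    · exact (measurable_floor_eq 1 _ _).and
        ((measurable_firstArrivalOn_shift 1 i).and
          ((measurable_firstArrivalOn_shift _ _).comp (measurable_shift 1)))
    · exact (measurable_faceEvent i).and (measurable_firstArrivalOn_shift _ _)
    · exact measurable_releaseEvent i j
  · filter_upwards [ae_good hp hm] with w hw
    simp only [Finset.mem_univ, true_and, Fin.exists_fin_succ, Matrix.cons_val_zero,
      Matrix.cons_val_succ, IsEmpty.exists_iff, or_false]
    rw [shift_shift, show i + 1 + 1 = i + 2 by ring, ← firstArrivalOn_shift w (i + 2),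
      ← firstArrivalOn_shift w 1]
    have h3 := hw.vel_cases 0
    have h4 := hw.vel_cases (i + 1)
    have h5 := fun h => hw.vel_lt_of_ends (k := i) h
    have h6 : ⌊w (1, 0)⌋ = 0 → (w.toConfig.EndsAnnihilate 0 (i + 1) ↔
        w.toConfig.FirstArrivalOn 1 (i + 1)) := fun h => hw.regular.ends_iff_of_static h
    unfold StepEvent FaceEvent ReleaseEvent
    constructor
    · rintro ⟨h7, h8, h9⟩
      have := h5 h7
      rcases h4 with h4 | h4 | h4
      · rcases h3 with h3 | h3 | h3
        · omega
        · exact Or.inl ⟨h3, (h6 h3).1 h7, h8⟩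
        · exact Or.inr (Or.inl ⟨⟨h3, h4, h7⟩, h8⟩)
      · exact Or.inr (Or.inr ⟨h4, h7, h8, h9 h4⟩)
      · omega
    · rintro (⟨h7, h8, h9⟩ | ⟨⟨h7, h8, h9⟩, h10⟩ | ⟨h7, h8, h9, h10⟩)
      · have h8 := (h6 h7).2 h8
        have := h5 h8
        exact ⟨h8, h9, fun h => by omega⟩
      · exact ⟨h9, h10, fun h => by omega⟩
      · exact ⟨h8, h9, fun _ => h10⟩
  · filter_upwards [ae_good hp hm] with w hw
    have h5 := fun h => hw.vel_lt_of_ends (k := i) h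
    have e1 : ⌊w (1, 0)⌋ = 0 → ¬ w.FaceEvent i := fun h h' => by
      have := h'.1
      omega
    have e2 : ⌊w (1, 0)⌋ = 0 → ¬ w.ReleaseEvent i j := fun h h' => by
      have := h5 h'.2.1
      have := h'.1
      omega
    have e3 : w.FaceEvent i → ¬ w.ReleaseEvent i j := fun h h' => by
      have := h'.1
      have := h.2.1
      omega
    intro x _ y _
    fin_cases x <;> fin_cases y
    · exact fun _ _ => rfl
    · exact fun h h' => (e1 h.1 h'.1).elim
    · exact fun h h' => (e2 h.1 h').elim
    · exact fun h h' => (e1 h'.1 h.1).elim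
    · exact fun _ _ => rfl
    · exact fun h h' => (e3 h.1 h').elim
    · exact fun h h' => (e2 h'.1 h).elim
    · exact fun h h' => (e3 h'.1 h).elim
    · exact fun _ _ => rfl

/-- Recursion according to the annihilation of the first particle. -/
theorem arrivalProb_succ_succ [IsProbabilityMeasure m] (hp : p ∈ Icc (0 : ℝ) 1)
    (hm : m (Iic 0) = 0) (s : ℕ) : arrivalProb p m (s + 2) =
      ∑ x ∈ Finset.HasAntidiagonal.antidiagonal s, (p * arrivalProb p m x.1 * arrivalProb p m x.2 +
        faceProb p m x.1 * arrivalProb p m x.2 + releaseProb p m x.1 x.2) := by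
  rw [arrivalProb_eq_sum_step hp hm]
  exact Finset.sum_congr rfl fun x _ => stepEvent_prob hp hm x.1 x.2

/-- The indices `⟨(t, k), (i, j)⟩` with `i + j = t` and `t + k + 2 = s`. -/
def releaseIndices (s : ℕ) : Finset ((_ : ℕ × ℕ) × (ℕ × ℕ)) :=
  if 2 ≤ s then (Finset.HasAntidiagonal.antidiagonal (s - 2)).sigma fun x =>
    Finset.HasAntidiagonal.antidiagonal x.1 else ∅

theorem mem_releaseIndices {s t k i j : ℕ} :
    (⟨(t, k), (i, j)⟩ : (_ : ℕ × ℕ) × (ℕ × ℕ)) ∈ releaseIndices s ↔ i + j = t ∧ t + k + 2 = s := by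
  unfold releaseIndices
  split_ifs with h
  · simp only [Finset.mem_sigma, Finset.HasAntidiagonal.mem_antidiagonal]
    omega
  · simp only [Finset.notMem_empty, false_iff]
    omega

theorem Good.release_vel {w : Word} (hw : w.Good) {i j : ℕ} (h : w.ReleaseEvent i j) :
    ⌊w (1, 0)⌋ = 1 := by
  have := hw.vel_lt_of_ends h.2.1
  have := hw.vel_cases 0
  have := h.1
  omega

/-- Recursion according to the fate of a right-moving particle placed before a first arrival. -/
theorem faceProb_recursion [IsProbabilityMeasure m] (hp : p ∈ Icc (0 : ℝ) 1)
    (hm : m (Iic 0) = 0) (s : ℕ) : (1 - p) / 2 * arrivalProb p m s = faceProb p m s +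
      ∑ x ∈ releaseIndices s, releaseProb p m x.2.1 x.2.2 * arrivalProb p m x.1.2 := by
  have := isProbabilityMeasure_wordLaw hp (m := m)
  have h1 := wordLaw_and_shift hp (m := m) (N := 1) (E := fun w : Word => ⌊w (1, 0)⌋ = 1)
    (F := fun w : Word => w.toConfig.FirstArrivalOn 0 s) (measurable_floor_eq 1 _ 1)
    (measurable_firstArrivalOn 0 s) (fun w w' h => by rw [h 1 0 one_pos])
  rw [wordLaw_vel hp] at h1
  -- The index `none` stands for the annihilation of the first particle with the arrival itself;
  -- `some` stands for the releases.
  have h2 := measureReal_eq_sum (μ := wordLaw p m) (Finset.insertNone (releaseIndices s))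
    (E := fun w : Word => ⌊w (1, 0)⌋ = 1 ∧ (w.shift 1).toConfig.FirstArrivalOn 0 s)
    (F := fun x w => x.elim (w.FaceEvent s) fun x => w.ReleaseEvent x.2.1 x.2.2 ∧
      (w.shift (x.2.1 + x.2.2 + 3)).toConfig.FirstArrivalOn 0 x.1.2) ?_ ?_ ?_
  · rw [h2, Finset.sum_insertNone] at h1
    simp only [Option.elim] at h1
    have h3 : (1 - p) / 2 * arrivalProb p m s = (wordLaw p m).real {w | w.FaceEvent s} +
        ∑ x ∈ releaseIndices s, (wordLaw p m).real {w | w.ReleaseEvent x.2.1 x.2.2 ∧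
          (w.shift (x.2.1 + x.2.2 + 3)).toConfig.FirstArrivalOn 0 x.1.2} := by
      rw [h1]
      unfold arrivalProb
      simp
    rw [h3]
    refine congrArg₂ _ rfl (Finset.sum_congr rfl fun x _ => ?_)
    refine wordLaw_and_shift hp (m := m) (N := x.2.1 + x.2.2 + 3) (E := ReleaseEvent x.2.1 x.2.2)
      (F := fun w : Word => w.toConfig.FirstArrivalOn 0 x.1.2) (measurable_releaseEvent _ _)
      (measurable_firstArrivalOn 0 _) (fun w w' h => ?_)
    unfold ReleaseEvent Sooner
    rw [h 1 _ (by omega), h.endsAnnihilate_iff (by omega), h.firstArrivalOn_iff (by omega),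
      h.pos_eq (n := 0) (by omega), h.pos_eq (n := x.2.1 + 1) (by omega),
      h.pos_eq (n := x.2.2 + (x.2.1 + 2)) (by omega), toConfig_spin, toConfig_spin,
      h 2 _ (by omega)]
  · rintro (_ | x) _
    · exact measurable_faceEvent s
    · exact (measurable_releaseEvent _ _).and (measurable_firstArrivalOn_shift _ _)
  · filter_upwards [ae_good hp hm] with w hw
    rw [← firstArrivalOn_shift w 1 s]
    constructor
    · rintro ⟨h3, h4⟩
      rcases hw.regular.ends_or_release_of_firstArrivalOn_succ (a := 0) h3 h4 with
        h5 | ⟨k, l, h5, h6, h7, h8, h9⟩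
      · exact ⟨none, by simp, h3, h4.2.1, h5⟩
      · have e1 : 0 < k := by
          obtain ⟨t, h5⟩ := h5
          exact Regular.lt_of_ends h5 rfl
        have e2 := h7.1
        have e3 := h9.1
        obtain ⟨i, rfl⟩ : ∃ i, k = i + 1 := ⟨k - 1, by omega⟩
        obtain ⟨j, rfl⟩ : ∃ j, l = j + (i + 2) := ⟨l - (i + 2), by omega⟩
        obtain ⟨k, rfl⟩ : ∃ k, s = i + j + k + 2 := ⟨s - (i + j + 2), by omega⟩
        refine ⟨some ⟨(i + j, k), (i, j)⟩, ?_, ⟨h6, h5, h7, h8⟩, ?_⟩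
        · rw [Finset.some_mem_insertNone, mem_releaseIndices]
          exact ⟨rfl, rfl⟩
        · simp only
          rw [← firstArrivalOn_shift]
          rw [show j + (i + 2) + 1 = i + j + 3 by ring,
            show i + j + k + 2 + 1 = k + (i + j + 3) by ring] at h9
          exact h9
    · rintro ⟨_ | ⟨⟨t, k⟩, ⟨i, j⟩⟩, hx, h3⟩
      · exact ⟨h3.1, hw.regular.firstArrivalOn_succ_of_ends h3.2.2 h3.2.1⟩
      · obtain ⟨h4, h5⟩ := h3
        rw [Finset.some_mem_insertNone, mem_releaseIndices] at hx
        obtain ⟨rfl, rfl⟩ := hx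
        refine ⟨hw.release_vel h4, ?_⟩
        simp only at h4 h5
        rw [← firstArrivalOn_shift] at h5
        refine hw.regular.firstArrivalOn_succ_of_release (a := 0) h4.2.1 h4.1 h4.2.2.1 h4.2.2.2 ?_
        rw [show j + (i + 2) + 1 = i + j + 3 by ring,
            show i + j + k + 2 + 1 = k + (i + j + 3) by ring]
        exact h5
  · filter_upwards [ae_good hp hm] with w hw
    have key : ∀ i j n, w.ReleaseEvent i j → j + (i + 2) ≤ n →
        ∃ t, w.toConfig.AnnihilateOn (Icc 0 n) 0 (i + 1) t := fun i j n h hn =>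
      hw.regular.annihilateOn_of_release h.2.1 h.2.2.1 h.2.2.2 hn
    rintro (_ | ⟨⟨t, k⟩, ⟨i, j⟩⟩) hx (_ | ⟨⟨t', k'⟩, ⟨i', j'⟩⟩) hx' h h'
    · rfl
    · exfalso
      rw [Finset.some_mem_insertNone, mem_releaseIndices] at hx'
      obtain ⟨t, h3⟩ := key i' j' (s + 1) h'.1 (by omega)
      obtain ⟨t', h4⟩ := h.2.2
      have := (hw.regular.partner_unique h3 h4).1
      omega
    · exfalso
      rw [Finset.some_mem_insertNone, mem_releaseIndices] at hx
      obtain ⟨t, h3⟩ := key i j (s + 1) h.1 (by omega)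
      obtain ⟨t', h4⟩ := h'.2.2
      have := (hw.regular.partner_unique h3 h4).1
      omega
    · rw [Finset.some_mem_insertNone, mem_releaseIndices] at hx hx'
      obtain ⟨t, h3⟩ := key i j (s + 1) h.1 (by omega)
      obtain ⟨t', h4⟩ := key i' j' (s + 1) h'.1 (by omega)
      have h5 := (hw.regular.partner_unique h3 h4).1
      obtain rfl : i' = i := by omega
      have h6 := hw.regular.firstArrivalOn_unique h.1.2.2.1 h'.1.2.2.1
      simp only at h6
      obtain rfl : j' = j := by omega
      obtain rfl : k' = k := by omega
      obtain ⟨rfl, _⟩ := hx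
      obtain ⟨rfl, _⟩ := hx'
      rfl

end Word

end BallisticAnnihilation

/-! ### Power series: uniqueness, evaluation and the algebraic equation. -/

namespace BallisticAnnihilation

open PowerSeries in
/-- The algebraic equation determines the generating series. -/
theorem eq_of_powerSeries_equation {p : ℝ} {f g : PowerSeries ℝ}
    (hf : C p * X * f ^ 4 - C (1 + 2 * p) * X * f ^ 2 + 2 * f - C (1 - p) * X = 0)
    (hg : C p * X * g ^ 4 - C (1 + 2 * p) * X * g ^ 2 + 2 * g - C (1 - p) * X = 0) : f = g := by
  -- The difference of the two equations is divisible by `f - g`; the cofactor has constant term 2,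
  -- so it is not zero.
  have h : (f - g) * (2 + X * (C p * (f + g) * (f ^ 2 + g ^ 2) - C (1 + 2 * p) * (f + g))) = 0 := by
    linear_combination hf - hg
  rcases mul_eq_zero.1 h with h | h
  · exact sub_eq_zero.1 h
  · have h2 : (2 : PowerSeries ℝ) = C 2 := (map_ofNat C 2).symm
    have := congrArg (constantCoeff (R := ℝ)) h
    rw [h2] at this
    simp at this

/-- The power series `f` converges absolutely at `x`, with sum `y`. -/
def HasValue (f : PowerSeries ℝ) (x y : ℝ) : Prop :=
  Summable (fun n => |f.coeff n * x ^ n|) ∧ ∑' n, f.coeff n * x ^ n = y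

namespace HasValue

variable {f g : PowerSeries ℝ} {x y z : ℝ}

theorem unique (hf : HasValue f x y) (hf' : HasValue f x z) : y = z := hf.2.symm.trans hf'.2

theorem add (hf : HasValue f x y) (hg : HasValue g x z) : HasValue (f + g) x (y + z) := by
  have h1 := hf.1.of_abs
  have h2 := hg.1.of_abs
  refine ⟨?_, ?_⟩
  · refine Summable.of_nonneg_of_le (fun _ => abs_nonneg _) (fun n => ?_) (hf.1.add hg.1)
    rw [map_add, add_mul]
    exact abs_add_le _ _
  · simp only [map_add, add_mul]
    rw [h1.tsum_add h2, hf.2, hg.2]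

theorem mul (hf : HasValue f x y) (hg : HasValue g x z) : HasValue (f * g) x (y * z) := by
  have h1 : Summable fun n => ‖f.coeff n * x ^ n‖ := hf.1
  have h2 : Summable fun n => ‖g.coeff n * x ^ n‖ := hg.1
  have h3 : ∀ n, (f * g).coeff n * x ^ n = ∑ kl ∈ Finset.HasAntidiagonal.antidiagonal n,
      f.coeff kl.1 * x ^ kl.1 * (g.coeff kl.2 * x ^ kl.2) := by
    intro n
    rw [PowerSeries.coeff_mul, Finset.sum_mul]
    refine Finset.sum_congr rfl fun kl hkl => ?_
    rw [← Finset.HasAntidiagonal.mem_antidiagonal.1 hkl, pow_add]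
    ring
  have h4 := summable_norm_sum_mul_antidiagonal_of_summable_norm h1 h2
  refine ⟨?_, ?_⟩
  · simp only [h3]
    simpa only [Real.norm_eq_abs] using h4
  · rw [tsum_congr h3, ← tsum_mul_tsum_eq_tsum_sum_antidiagonal_of_summable_norm h1 h2, hf.2, hg.2]

theorem const (a x : ℝ) : HasValue (PowerSeries.C a) x a := by
  have h : ∀ n, n ≠ 0 → (PowerSeries.C a).coeff n * x ^ n = 0 := by
    intro n hn
    rw [PowerSeries.coeff_C, if_neg hn, zero_mul]
  refine ⟨summable_of_ne_finset_zero (s := {0}) fun n hn => ?_, ?_⟩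
  · rw [h n (by simpa using hn), abs_zero]
  · rw [tsum_eq_single 0 h]
    simp

theorem var (x : ℝ) : HasValue (PowerSeries.X : PowerSeries ℝ) x x := by
  have h : ∀ n, n ≠ 1 → (PowerSeries.X : PowerSeries ℝ).coeff n * x ^ n = 0 := by
    intro n hn
    rw [PowerSeries.coeff_X, if_neg hn, zero_mul]
  refine ⟨summable_of_ne_finset_zero (s := {1}) fun n hn => ?_, ?_⟩
  · rw [h n (by simpa using hn), abs_zero]
  · rw [tsum_eq_single 1 h]
    simp

end HasValue

namespace Word

open PowerSeries

variable {p : ℝ} {m : Measure ℝ}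

/-- The generating series of the first arrival at `0`. -/
noncomputable def arrivalSeries (p : ℝ) (m : Measure ℝ) : PowerSeries ℝ :=
  X * PowerSeries.mk (arrivalProb p m)

theorem arrivalSeries_equation [IsProbabilityMeasure m] (hp : p ∈ Icc (0 : ℝ) 1)
    (hm : m (Iic 0) = 0) :
    C p * X * arrivalSeries p m ^ 4 - C (1 + 2 * p) * X * arrivalSeries p m ^ 2 +
      2 * arrivalSeries p m - C (1 - p) * X = 0 := by
  set α : PowerSeries ℝ := PowerSeries.mk (arrivalProb p m) with hα
  set γ : PowerSeries ℝ := PowerSeries.mk (faceProb p m) with hγ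
  set β : PowerSeries ℝ := PowerSeries.mk fun s =>
    ∑ x ∈ Finset.HasAntidiagonal.antidiagonal s, releaseProb p m x.1 x.2 with hβ
  -- Summing over the antidiagonal and over its transpose symmetrizes the release probabilities, so
  -- that only their known symmetric sums remain.
  have hββ : 2 * β = C p * α ^ 2 := by
    ext s
    have h1 : ∑ x ∈ Finset.HasAntidiagonal.antidiagonal s, releaseProb p m x.1 x.2 =
        ∑ x ∈ Finset.HasAntidiagonal.antidiagonal s, releaseProb p m x.2 x.1 :=
      (Finset.Nat.sum_antidiagonal_swap (n := s) (f := fun x => releaseProb p m x.1 x.2)).symm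
    rw [two_mul, map_add, coeff_C_mul, pow_two, coeff_mul]
    simp only [hβ, hα, coeff_mk]
    nth_rewrite 2 [h1]
    rw [← Finset.sum_add_distrib, Finset.mul_sum]
    refine Finset.sum_congr rfl fun x _ => ?_
    rw [raceProb_add hp hm]
    ring
  have hstep : α = C ((1 - p) / 2) + (C p * α ^ 2 + γ * α + β) * X ^ 2 := by
    ext s
    rw [map_add, coeff_mul_X_pow']
    match s with
    | 0 => simp [hα, arrivalProb_zero hp]
    | 1 => simp [hα, arrivalProb_one hp hm]
    | s + 2 =>
      rw [coeff_C, if_neg (by omega), if_pos (by omega), Nat.add_sub_cancel, zero_add, map_add,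
        map_add, coeff_C_mul, pow_two, coeff_mul, coeff_mul, hα, coeff_mk,
        arrivalProb_succ_succ hp hm, Finset.sum_add_distrib, Finset.sum_add_distrib,
        Finset.mul_sum]
      simp only [hγ, hβ, coeff_mk, mul_assoc]
  have hface : C ((1 - p) / 2) * α = γ + β * α * X ^ 2 := by
    ext s
    rw [coeff_C_mul, map_add, coeff_mul_X_pow', hα, coeff_mk, faceProb_recursion hp hm, hγ,
      coeff_mk, releaseIndices]
    congr 1
    split_ifs with h
    · rw [Finset.sum_sigma, coeff_mul]
      refine Finset.sum_congr rfl fun x _ => ?_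
      rw [hβ, coeff_mk, coeff_mk, Finset.sum_mul]
    · simp
  have e1 : (C (1 - p) : PowerSeries ℝ) = 2 * C ((1 - p) / 2) := by
    rw [two_mul, ← map_add]; congr 1; ring
  have e2 : (C (1 + 2 * p) : PowerSeries ℝ) = 3 * C p + 2 * C ((1 - p) / 2) := by
    rw [show (3 : PowerSeries ℝ) = C 3 from (map_ofNat C 3).symm,
      show (2 : PowerSeries ℝ) = C 2 from (map_ofNat C 2).symm, ← map_mul, ← map_mul, ← map_add]
    congr 1; ring
  rw [arrivalSeries, ← hα, e1, e2]
  -- The multiple of `hface` cancels the series `γ`. What is left of `β` is `2 * β * (X ^ 3 - X ^ 5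
  -- * α ^ 2)`, whence the coefficient of `hββ`.
  linear_combination (2 * X) * hstep - 2 * X ^ 3 * α * hface + (X ^ 3 - X ^ 5 * α ^ 2) * hββ

end Word

end BallisticAnnihilation

/-! ### From the probabilistic model to the law of a word. -/

namespace BallisticAnnihilation

section Model

variable {Ω : Type*} {p : ℝ} {m : Measure ℝ} {D : ℕ → Ω → ℝ} {V S : ℕ → Ω → ℤ}

/-- The word formed by the interdistances, the velocities and the spins. -/
def sample (D : ℕ → Ω → ℝ) (V S : ℕ → Ω → ℤ) (ω : Ω) : Word :=
  fun x => (![fun n => D n ω, fun n => (V n ω : ℝ), fun n => (S n ω : ℝ)] : Fin 3 → ℕ → ℝ) x.1 x.2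

theorem toConfig_sample (D : ℕ → Ω → ℝ) (V S : ℕ → Ω → ℤ) (ω : Ω) :
    (sample D V S ω).toConfig = configOf (fun n => D n ω) (fun n => V n ω) (fun n => S n ω) := by
  simp [Word.toConfig, sample]

variable [MeasurableSpace Ω] {P : Measure Ω}

theorem iIndepFun_fin_three [IsProbabilityMeasure P] {E : Type*} [MeasurableSpace E]
    {X : Fin 3 → Ω → E}
    (hX : ∀ i, Measurable (X i)) (h01 : IndepFun (X 0) (X 1) P)
    (h2 : IndepFun (fun ω => (X 0 ω, X 1 ω)) (X 2) P) : iIndepFun X P := by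
  rw [iIndepFun_iff_map_fun_eq_pi_map fun i => (hX i).aemeasurable]
  have : ∀ i, IsProbabilityMeasure (P.map (X i)) := fun i =>
    Measure.isProbabilityMeasure_map (hX i).aemeasurable
  refine (Measure.pi_eq fun s hs => ?_).symm
  rw [Measure.map_apply (measurable_pi_lambda _ hX) (.univ_pi hs), Fin.prod_univ_three,
    Measure.map_apply (hX 0) (hs 0), Measure.map_apply (hX 1) (hs 1),
    Measure.map_apply (hX 2) (hs 2), ← h01.measure_inter_preimage_eq_mul _ _ (hs 0) (hs 1)]
  have h := h2.measure_inter_preimage_eq_mul _ _ ((hs 0).prod (hs 1)) (hs 2)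
  refine Eq.trans (congrArg P ?_) h
  ext ω
  simp [Fin.forall_fin_succ, and_assoc]

/-- The prescribed masses already add up to 1, so there is none outside `s`. -/
theorem map_intCast_of_prob [IsProbabilityMeasure P] {X : Ω → ℤ} (hX : Measurable X)
    {s : Finset ℤ} {q : ℤ → ℝ}
    (hq : ∀ z ∈ s, P.real {ω | X ω = z} = q z) (hs : ∑ z ∈ s, q z = 1) :
    P.map (fun ω => (X ω : ℝ)) = ∑ z ∈ s, ENNReal.ofReal (q z) • Measure.dirac (z : ℝ) := by
  have hc : Measurable fun z : ℤ => (z : ℝ) := .of_discrete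
  have hP : ∀ z, MeasurableSet {ω | X ω = z} := fun z => hX (measurableSet_singleton z)
  have hae : ∀ᵐ ω ∂P, X ω ∈ s := by
    have h1 : {ω | X ω ∈ s} = ⋃ z ∈ s, {ω | X ω = z} := by
      ext ω
      simp
    have h2 : P.real {ω | X ω ∈ s} = 1 := by
      rw [h1, measureReal_biUnion_finset _ fun z _ => hP z, Finset.sum_congr rfl hq, hs]
      intro z _ z' _ hzz
      exact Set.disjoint_left.2 fun ω h h' => hzz (h.symm.trans h')
    have h3 : MeasurableSet {ω | X ω ∈ s} := hX s.measurableSet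
    rw [ae_iff]
    exact (prob_compl_eq_zero_iff h3).2
      ((ENNReal.toReal_eq_one_iff _).1 h2)
  have hX' : P.map X = ∑ z ∈ s, ENNReal.ofReal (q z) • Measure.dirac z := by
    refine Measure.ext_of_singleton fun z => ?_
    rw [Measure.map_apply hX (measurableSet_singleton z), Measure.finsetSum_apply]
    simp only [Measure.smul_apply, Measure.dirac_apply, smul_eq_mul]
    by_cases hz : z ∈ s
    · rw [Finset.sum_eq_single z (fun y _ hy => by simp [hy]) (fun h => (h hz).elim), ← hq z hz]
      simp [Measure.real]
      rfl
    · rw [Finset.sum_eq_zero fun y hy => by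
        rw [indicator_of_notMem, mul_zero]
        rintro rfl
        exact hz hy]
      refine measure_mono_null (t := {ω | ¬ X ω ∈ s}) ?_ hae
      rintro ω rfl
      exact hz
  have h := congrArg (Measure.map fun z : ℤ => (z : ℝ)) hX'
  rw [Measure.map_map hc hX] at h
  refine h.trans ?_
  rw [Measure.map_finset_sum hc.aemeasurable]
  simp [Measure.map_smul, Measure.map_dirac' hc]

namespace IsModel

theorem measurable_sample_apply (h : IsModel P p m D V S) (c : Fin 3) (n : ℕ) :
    Measurable fun ω => sample D V S ω (c, n) := by
  have hc : Measurable fun z : ℤ => (z : ℝ) := .of_discrete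
  fin_cases c
  · exact h.measurable_D n
  · exact hc.comp (h.measurable_V n)
  · exact hc.comp (h.measurable_S n)

theorem measurable_sample (h : IsModel P p m D V S) : Measurable (sample D V S) :=
  measurable_pi_lambda _ fun x => h.measurable_sample_apply x.1 x.2

theorem map_sample_apply [IsProbabilityMeasure P] (h : IsModel P p m D V S) (c : Fin 3) (n : ℕ) :
    P.map (fun ω => sample D V S ω (c, n)) = Word.letterLaw p m c := by
  fin_cases c
  · exact h.law_D n
  · refine (map_intCast_of_prob (h.measurable_V n) (s := {0, 1, -1})
      (q := fun z => if z = 0 then p else (1 - p) / 2) ?_ ?_).trans ?_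
    · simp [h.prob_V_zero n, h.prob_V_pos n, h.prob_V_neg n]
    · simp
    · simp [Word.letterLaw, Word.velLaw, smul_add]
  · refine (map_intCast_of_prob (h.measurable_S n) (s := {1, -1})
      (q := fun _ => 1 / 2) ?_ ?_).trans ?_
    · simp only [Finset.mem_insert, Finset.mem_singleton]
      rintro z (rfl | rfl)
      exacts [h.prob_S_pos n, h.prob_S_neg n]
    · norm_num
    · simp [Word.letterLaw, Word.spinLaw, smul_add]

/-- Independence of the three sequences, combined with independence inside each of them, gives joint
independence of all the letters. -/
theorem iIndepFun_sample [IsProbabilityMeasure P] (h : IsModel P p m D V S) :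
    iIndepFun (fun (x : Fin 3 × ℕ) ω => sample D V S ω x) P := by
  have hc : Measurable fun z : ℤ => (z : ℝ) := .of_discrete
  have hc' : Measurable fun (v : ℕ → ℤ) n => (v n : ℝ) :=
    measurable_pi_lambda _ fun n => hc.comp (measurable_pi_apply n)
  refine iIndepFun_uncurry' (X := fun c n ω => sample D V S ω (c, n))
    h.measurable_sample_apply (iIndepFun_fin_three (fun c => ?_) ?_ ?_) fun c => ?_
  · exact measurable_pi_lambda _ fun n => h.measurable_sample_apply c n
  · exact h.indep_D_V.comp measurable_id hc'
  · exact h.indep_DV_S.comp (measurable_id.prodMap hc') hc'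
  · fin_cases c
    · exact h.indep_D
    · exact h.indep_V.comp (fun _ z => (z : ℝ)) fun _ => hc
    · exact h.indep_S.comp (fun _ z => (z : ℝ)) fun _ => hc

/-- The law of the word does not depend on the probability space. -/
theorem map_sample [IsProbabilityMeasure P] (h : IsModel P p m D V S) :
    P.map (sample D V S) = Word.wordLaw p m := by
  have h' := h.iIndepFun_sample.map_fun_eq_infinitePi_map
    fun x : Fin 3 × ℕ => h.measurable_sample_apply x.1 x.2
  exact h'.trans <| congrArg Measure.infinitePi (funext fun x => h.map_sample_apply x.1 x.2)

end IsModel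

end Model

end BallisticAnnihilation

/-! ### The law of the first arrival and its generating series. -/

namespace BallisticAnnihilation

namespace Config

theorem firstArrival_ne_zero (c : Config) : c.firstArrival ≠ 0 := by
  have h : (1 : ℕ∞) ≤ c.firstArrival := le_iInf₂ fun i _ => by
    exact_mod_cast Nat.succ_le_succ (Nat.zero_le i)
  exact (zero_lt_one.trans_le h).ne'

end Config

namespace Word

variable {p : ℝ} {m : Measure ℝ}

theorem ae_firstArrival_eq_iff (hp : p ∈ Icc (0 : ℝ) 1) [IsProbabilityMeasure m]
    (hm : m (Iic 0) = 0) (k : ℕ) : {w : Word | w.toConfig.firstArrival = ((k + 1 : ℕ) : ℕ∞)}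
      =ᵐ[wordLaw p m] {w : Word | w.toConfig.FirstArrivalOn 0 k} := by
  filter_upwards [ae_good hp hm] with w hw
  exact propext (hw.regular.firstArrival_eq_iff hw.pos_pos k)

/-- Only almost everywhere: the identification of the level sets with the measurable events
`FirstArrivalOn 0 k` is available for `Good` words. -/
theorem aemeasurable_firstArrival (hp : p ∈ Icc (0 : ℝ) 1) [IsProbabilityMeasure m]
    (hm : m (Iic 0) = 0) :
    AEMeasurable (fun w : Word => w.toConfig.firstArrival) (wordLaw p m) := by
  have h1 : ∀ n : ℕ, NullMeasurableSet ((fun w : Word => w.toConfig.firstArrival) ⁻¹' {(n : ℕ∞)})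
      (wordLaw p m) := by
    rintro (_ | k)
    · convert! nullMeasurableSet_empty
      exact eq_empty_of_forall_notMem fun w hw => w.toConfig.firstArrival_ne_zero hw
    · exact (measurableSet_setOfPred.2 (measurable_firstArrivalOn 0 k)).nullMeasurableSet.congr
        (ae_firstArrival_eq_iff hp hm k).symm
  refine NullMeasurable.aemeasurable (ENat.measurable_iff.2 h1 :)

/-- The law of the index of the first particle that reaches `0`. -/
noncomputable def arrivalLaw (p : ℝ) (m : Measure ℝ) : Measure ℕ∞ :=
  (wordLaw p m).map fun w => w.toConfig.firstArrival

theorem isProbabilityMeasure_arrivalLaw (hp : p ∈ Icc (0 : ℝ) 1) [IsProbabilityMeasure m]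
    (hm : m (Iic 0) = 0) : IsProbabilityMeasure (arrivalLaw p m) := by
  have := isProbabilityMeasure_wordLaw hp (m := m)
  exact Measure.isProbabilityMeasure_map (aemeasurable_firstArrival hp hm)

theorem coeff_arrivalSeries (hp : p ∈ Icc (0 : ℝ) 1) [IsProbabilityMeasure m]
    (hm : m (Iic 0) = 0) (n : ℕ) :
    (arrivalSeries p m).coeff n = (arrivalLaw p m).real {(n : ℕ∞)} := by
  rw [arrivalLaw, map_measureReal_apply_of_aemeasurable (aemeasurable_firstArrival hp hm)
    (measurableSet_singleton _)]
  cases n with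
  | zero =>
    rw [arrivalSeries, PowerSeries.coeff_zero_X_mul]
    convert! measureReal_empty.symm
    exact eq_empty_of_forall_notMem fun w hw => w.toConfig.firstArrival_ne_zero hw
  | succ k =>
    rw [arrivalSeries, PowerSeries.coeff_succ_X_mul, PowerSeries.coeff_mk]
    exact measureReal_congr (ae_firstArrival_eq_iff hp hm k).symm

/-- The law of the first arrival does not depend on the law of the interdistances. -/
theorem arrivalLaw_eq (hp : p ∈ Icc (0 : ℝ) 1) {m' : Measure ℝ} [IsProbabilityMeasure m]
    [IsProbabilityMeasure m'] (hm : m (Iic 0) = 0) (hm' : m' (Iic 0) = 0) :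
    arrivalLaw p m = arrivalLaw p m' := by
  have := isProbabilityMeasure_arrivalLaw hp hm
  have := isProbabilityMeasure_arrivalLaw hp hm'
  have h1 := eq_of_powerSeries_equation (arrivalSeries_equation hp hm)
    (arrivalSeries_equation hp hm')
  have h2 : ∀ n : ℕ, arrivalLaw p m {(n : ℕ∞)} = arrivalLaw p m' {(n : ℕ∞)} := fun n => by
    have h3 := congrArg (PowerSeries.coeff n) h1
    rwa [coeff_arrivalSeries hp hm, coeff_arrivalSeries hp hm', measureReal_eq_measureReal_iff]
      at h3
  have h4 : ∀ μ : Measure ℕ∞, μ (range ((↑) : ℕ → ℕ∞)) = ∑' n : ℕ, μ {(n : ℕ∞)} := fun μ => by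
    rw [← iUnion_singleton_eq_range, measure_iUnion _ fun n => measurableSet_singleton _]
    intro i j hij
    simpa using hij
  -- The series gives the masses of the finite values only; the mass at `⊤` is the complement, both
  -- laws having total mass 1.
  have h5 : ({⊤} : Set ℕ∞) = (range ((↑) : ℕ → ℕ∞))ᶜ := by
    ext n
    cases n <;> simp
  refine Measure.ext_of_singleton fun n => ?_
  cases n with
  | top =>
    rw [h5, prob_compl_eq_one_sub .of_discrete, prob_compl_eq_one_sub .of_discrete, h4, h4]
    simp only [h2]
  | coe n => exact h2 n

/-- The function `x ^ n * 1_{n < ∞}` on the extended natural numbers. -/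
noncomputable def powFinite (x : ℝ) : ℕ∞ → ℝ := {n | n < ⊤}.indicator fun n => x ^ n.toNat

theorem integrable_powFinite (hp : p ∈ Icc (0 : ℝ) 1) [IsProbabilityMeasure m]
    (hm : m (Iic 0) = 0) {x : ℝ} (hx : x ∈ Icc (-1 : ℝ) 1) :
    Integrable (powFinite x) (arrivalLaw p m) := by
  have := isProbabilityMeasure_arrivalLaw hp hm
  refine Integrable.of_bound (Measurable.of_discrete.aestronglyMeasurable) 1
    (ae_of_all _ fun n => ?_)
  refine (norm_indicator_le_norm_self _ _).trans ?_
  rw [norm_pow]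
  exact pow_le_one₀ (norm_nonneg _) (abs_le.2 hx)

theorem hasValue_arrivalSeries (hp : p ∈ Icc (0 : ℝ) 1) [IsProbabilityMeasure m]
    (hm : m (Iic 0) = 0) {x : ℝ} (hx : x ∈ Icc (-1 : ℝ) 1) :
    HasValue (arrivalSeries p m) x (∫ n, powFinite x n ∂arrivalLaw p m) := by
  have := isProbabilityMeasure_arrivalLaw hp hm
  have hinj : Function.Injective ((↑) : ℕ → ℕ∞) := Nat.cast_injective
  constructor
  · have h1 : Summable fun n : ℕ => (arrivalLaw p m).real {(n : ℕ∞)} := by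
      refine summable_measure_toReal (fun n => measurableSet_singleton _) fun i j hij => ?_
      simpa using hij
    refine Summable.of_nonneg_of_le (fun _ => abs_nonneg _) (fun n => ?_) h1
    rw [coeff_arrivalSeries hp hm, abs_mul, abs_of_nonneg measureReal_nonneg, abs_pow]
    exact mul_le_of_le_one_right measureReal_nonneg (pow_le_one₀ (abs_nonneg _) (abs_le.2 hx))
  · rw [integral_countable (integrable_powFinite hp hm hx), ← hinj.tsum_eq]
    · refine tsum_congr fun n => ?_
      rw [coeff_arrivalSeries hp hm, smul_eq_mul, powFinite,
        indicator_of_mem (show (n : ℕ∞) ∈ {n : ℕ∞ | n < ⊤} from ENat.natCast_lt_top n),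
        ENat.toNat_natCast]
    · intro n hn
      cases n with
      | top => simp [powFinite] at hn
      | coe n => exact ⟨n, rfl⟩

end Word

theorem HasValue.equation {f : PowerSeries ℝ} {p x y : ℝ} (hf : HasValue f x y)
    (h : PowerSeries.C p * PowerSeries.X * f ^ 4 -
      PowerSeries.C (1 + 2 * p) * PowerSeries.X * f ^ 2 + 2 * f -
      PowerSeries.C (1 - p) * PowerSeries.X = 0) :
    p * x * y ^ 4 - (1 + 2 * p) * x * y ^ 2 + 2 * y - (1 - p) * x = 0 := by
  have hX := HasValue.var x
  -- `HasValue` is stable under sums and products, so the equation is evaluated as an equality of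
  -- two sides without subtraction.
  have h2 := hf.mul hf
  have hl := (((HasValue.const p x).mul hX).mul (h2.mul h2)).add ((HasValue.const 2 x).mul hf)
  have hr := (((HasValue.const (1 + 2 * p) x).mul hX).mul h2).add
    ((HasValue.const (1 - p) x).mul hX)
  have e : (PowerSeries.C 2 : PowerSeries ℝ) = 2 := map_ofNat PowerSeries.C 2
  have hlr : PowerSeries.C p * PowerSeries.X * (f * f * (f * f)) + PowerSeries.C 2 * f =
      PowerSeries.C (1 + 2 * p) * PowerSeries.X * (f * f) +
        PowerSeries.C (1 - p) * PowerSeries.X := by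
    rw [e]
    linear_combination h
  rw [hlr] at hl
  linear_combination hl.unique hr

theorem A_eq {Ω : Type*} (D : ℕ → Ω → ℝ) (V S : ℕ → Ω → ℤ) :
    A D V S = (fun w : Word => w.toConfig.firstArrival) ∘ sample D V S := by
  funext ω
  rw [Function.comp_apply, toConfig_sample, A]

namespace IsModel

variable {Ω : Type*} [MeasurableSpace Ω] {P : Measure Ω} [IsProbabilityMeasure P] {p : ℝ}
  {m : Measure ℝ} {D : ℕ → Ω → ℝ} {V S : ℕ → Ω → ℤ}

theorem aemeasurable_firstArrival (h : IsModel P p m D V S) (hp : p ∈ Icc (0 : ℝ) 1)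
    [IsProbabilityMeasure m] (hm : m (Iic 0) = 0) :
    AEMeasurable (fun w : Word => w.toConfig.firstArrival) (P.map (sample D V S)) := by
  rw [h.map_sample]
  exact Word.aemeasurable_firstArrival hp hm

theorem aemeasurable_A (h : IsModel P p m D V S) (hp : p ∈ Icc (0 : ℝ) 1)
    [IsProbabilityMeasure m] (hm : m (Iic 0) = 0) : AEMeasurable (A D V S) P := by
  rw [A_eq]
  exact (h.aemeasurable_firstArrival hp hm).comp_measurable h.measurable_sample

theorem map_A (h : IsModel P p m D V S) (hp : p ∈ Icc (0 : ℝ) 1)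
    [IsProbabilityMeasure m] (hm : m (Iic 0) = 0) : P.map (A D V S) = Word.arrivalLaw p m := by
  rw [A_eq, ← AEMeasurable.map_map_of_aemeasurable (h.aemeasurable_firstArrival hp hm)
    h.measurable_sample.aemeasurable, h.map_sample, Word.arrivalLaw]

end IsModel

end BallisticAnnihilation

theorem theorem2 (p : ℝ) (hp : p ∈ Set.Icc (0 : ℝ) 1)
    {Ω : Type*} [MeasurableSpace Ω] (P : MeasureTheory.Measure Ω)
    [MeasureTheory.IsProbabilityMeasure P]
    (m : MeasureTheory.Measure ℝ) [MeasureTheory.IsProbabilityMeasure m]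
    (hm : m (Set.Iic 0) = 0)
    (D : ℕ → Ω → ℝ) (V S : ℕ → Ω → ℤ)
    (hmodel : BallisticAnnihilation.IsModel P p m D V S)
    {Ω' : Type*} [MeasurableSpace Ω'] (P' : MeasureTheory.Measure Ω')
    [MeasureTheory.IsProbabilityMeasure P']
    (m' : MeasureTheory.Measure ℝ) [MeasureTheory.IsProbabilityMeasure m']
    (hm' : m' (Set.Iic 0) = 0)
    (D' : ℕ → Ω' → ℝ) (V' S' : ℕ → Ω' → ℤ)
    (hmodel' : BallisticAnnihilation.IsModel P' p m' D' V' S') :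
    ProbabilityTheory.IdentDistrib (BallisticAnnihilation.A D V S)
      (BallisticAnnihilation.A D' V' S') P P' ∧
    ∀ x ∈ Set.Icc (-1 : ℝ) 1,
      MeasureTheory.Integrable (BallisticAnnihilation.powA D V S x) P ∧
      p * x * BallisticAnnihilation.genSeries P D V S x ^ 4
        - (1 + 2 * p) * x * BallisticAnnihilation.genSeries P D V S x ^ 2
        + 2 * BallisticAnnihilation.genSeries P D V S x - (1 - p) * x = 0 := by
  open BallisticAnnihilation in
  refine ⟨⟨hmodel.aemeasurable_A hp hm, hmodel'.aemeasurable_A hp hm', ?_⟩, fun x hx => ?_⟩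
  · rw [hmodel.map_A hp hm, hmodel'.map_A hp hm', Word.arrivalLaw_eq hp hm hm']
  · have hA := hmodel.aemeasurable_A hp hm
    have hpow : powA D V S x = Word.powFinite x ∘ A D V S := rfl
    have hint := Word.integrable_powFinite hp hm hx
    rw [← hmodel.map_A hp hm] at hint
    refine ⟨(integrable_map_measure Measurable.of_discrete.aestronglyMeasurable hA).1 hint, ?_⟩
    refine HasValue.equation ?_ (Word.arrivalSeries_equation hp hm)
    have hgen : genSeries P D V S x = ∫ n, Word.powFinite x n ∂Word.arrivalLaw p m := by
      rw [← hmodel.map_A hp hm,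
        integral_map hA Measurable.of_discrete.aestronglyMeasurable, genSeries, hpow]
      rfl
    rw [hgen]
    exact Word.hasValue_arrivalSeries hp hm hx
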